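/- **Conventions.** "Polynomial time" means time bounded by a polynomial in $n$ on a classical machine; one program serves all $n\ge 1$ and receives $n$ and its further input. A family of distributions $D_{n,a}$ is *samplable in polynomial time* if a polynomial-time program, given $n$, $a$ and polynomially many fair coin flips, outputs each $b$ with probability $D_{n,a}(b)$. Complex values $v_{n,a}$ are *computable in polynomial time* if, for every polynomial $e$ with natural-number coefficients, integers $u,w$ with $|(u+iw)/2^{e(n)}-v_{n,a}|\le 2^{-e(n)}$ can be computed from $n,a$ in polynomial time. A *circuit* on $n$ qubits is a finite sequence of gates from $\{R_x(\theta),R_z(\theta),CZ : \theta=\pm 2\pi/2^t,\ t\ge 1\}$; its size is the number of gates. A family of states $|\varphi_n\rangle$ on $n$ qubits is *CT* if its amplitudes $\langle x|\varphi_n\rangle$ are computable in polynomial time and, for every polynomial $e$, some distribution samplable in polynomial time is within $l_1$ distance $2^{-e(n)}$ of $|\langle x|\varphi_n\rangle|^2$ for all $n\ge1$. A family of unitary Hermitian operations $M_{n,j}$ ($1\le j\le n$) on $n$ qubits is *ECS$_1$* if there is a constant $s$ such that every column of every $M_{n,j}$ has at most $s$ non-zero entries and, for $x\in\{0,1\}^n$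 and $1\le l\le s$, the row index $\gamma_l(x)$ of the $l$-th non-zero entry (from top to bottom) of column $x$ of $M_{n,j}$ is computable exactly in polynomial time from $n,j,l,x$, and its value $\beta_l(x)$ is computable in polynomial time in the above sense; if there is no such entry, $\gamma_l(x)=0^n$ and $\beta_l(x)=0$. A family of circuits $C_n$ is *CT-ECS$_1$* if $C_n=V_nU_n$ ($U_n$ applied first) with circuits $U_n,V_n$ of size polynomial in $n$ such that $U_n|0^n\rangle$ is CT and the operations $V_n^\dagger Z_jV_n$ ($1\le j\le n$) are ECS$_1$. **Theorem.** Let $(C_n)_{n\ge1}$ be a polynomial-time uniform family of CT-ECS$_1$ circuits, $C_n$ acting on $n$ qubits initialized to $|0^n\rangle$. Let $m(n)=O(\log n)$, and suppose that only $m(n)$ distinct qubits of $C_n$, whose list is computable from $n$ in polynomial time, are measured in the $Z$ basis at the end, without noise. Let $p_n$ be the resulting output distribution over $\{0,1\}^{m(n)}$. Let $f$ be a polynomial with natural-number coefficients and $f(n)>0$ for all $n\ge 1$. Then: 1. There is a polynomial-time randomized algorithm which, on input $n$, outputs a bit string of length polynomial in $n$ describing a probability distribution $\tilde q$ over $\{0,1\}^{m(n)}$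 such that for all $n\ge 1$ $$\Pr\left[\|p_n-\tilde q\|_1\le \frac1{f(n)}\right]\ge 1-\frac1{\exp(n)},$$ and $\tilde q$ is samplable in polynomial time given its description. 2. In particular, there is a family of probability distributions $q_n$ over $\{0,1\}^{m(n)}$, samplable in polynomial time, with $\|p_n-q_n\|_1\le 1/f(n)$ for all $n\ge1$. -/

import Mathlib

open scoped Matrix

/-! ### Classical computation

A small programming language over data built from integers and pairs, with an
explicit step count.  Every primitive operation is charged one step plus the bit size of the data
it is applied to, so that (as for the logarithmic-cost RAM) a program running for `t` steps is
simulated by a Turing machine in time polynomial in `t` and conversely: "polynomial time" has its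
usual meaning. -/

/-- Data: integers and pairs. -/
inductive Val where
  | int (z : ℤ)
  | pair (a b : Val)

namespace Val

/-- Bit size of a datum. -/
def size : Val → ℕ
  | int z => 1 + Nat.size z.natAbs
  | pair a b => 1 + a.size + b.size

/-- The integer stored in an atom (and `0` for a pair). -/
def toInt : Val → ℤ
  | int z => z
  | pair _ _ => 0

/-- First component (and `0` for an atom). -/
def fst : Val → Val
  | int _ => int 0
  | pair a _ => a

/-- Second component (and `0` for an atom). -/
def snd : Val → Val
  | int _ => int 0
  | pair _ b => b

/-- `1` for pairs, `0` for atoms. -/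
def isPair : Val → Val
  | int _ => int 0
  | pair _ _ => int 1

/-- Lists: the empty list is `0`, and `a :: l` is the pair of `a` and `l`. -/
def ofList : List Val → Val
  | [] => int 0
  | a :: l => pair a (ofList l)

end Val

/-- Primitive operations; the binary ones act on the two components of a pair. -/
inductive Op where
  | id | fst | snd | isPair | add | sub | mul | div | le

/-- Effect of a primitive operation. -/
def Op.apply : Op → Val → Val
  | .id, v => v
  | .fst, v => v.fst
  | .snd, v => v.snd
  | .isPair, v => v.isPair
  | .add, v => .int (v.fst.toInt + v.snd.toInt)
  | .sub, v => .int (v.fst.toInt - v.snd.toInt)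
  | .mul, v => .int (v.fst.toInt * v.snd.toInt)
  | .div, v => .int (v.fst.toInt / v.snd.toInt)
  | .le, v => .int (if v.fst.toInt ≤ v.snd.toInt then 1 else 0)

/-- Programs. -/
inductive Prog where
  /-- apply a primitive operation -/
  | op (o : Op)
  /-- discard the input and return a constant -/
  | const (w : Val)
  /-- run `f`, then `g` on its result -/
  | seq (f g : Prog)
  /-- run `f` and `g` on the input and return the pair of the results -/
  | both (f g : Prog)
  /-- run `c` on the input; then run `g` on the input if the result was `0`, otherwise `f` -/
  | cond (c f g : Prog)
  /-- while the result of `c` is not `0`, replace the current datum by the result of `f` -/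
  | loop (c f : Prog)

/-- `Eval p v w t`: program `p`, started on `v`, halts with result `w` after exactly `t` steps. -/
inductive Eval : Prog → Val → Val → ℕ → Prop where
  | op (o : Op) (v : Val) : Eval (.op o) v (o.apply v) (1 + v.size)
  | const (w v : Val) : Eval (.const w) v w 1
  | seq {f g : Prog} {v w u : Val} {s t : ℕ} (hf : Eval f v w s) (hg : Eval g w u t) :
      Eval (.seq f g) v u (1 + s + t)
  | both {f g : Prog} {v w u : Val} {s t : ℕ} (hf : Eval f v w s) (hg : Eval g v u t) :
      Eval (.both f g) v (.pair w u) (1 + s + t)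
  | cond_true {c f g : Prog} {v b w : Val} {s t : ℕ} (hc : Eval c v b s) (hb : b ≠ .int 0)
      (hf : Eval f v w t) : Eval (.cond c f g) v w (1 + s + t)
  | cond_false {c f g : Prog} {v w : Val} {s t : ℕ} (hc : Eval c v (.int 0) s)
      (hg : Eval g v w t) : Eval (.cond c f g) v w (1 + s + t)
  | loop_stop {c f : Prog} {v : Val} {s : ℕ} (hc : Eval c v (.int 0) s) :
      Eval (.loop c f) v v (1 + s)
  | loop_step {c f : Prog} {v b w u : Val} {r s t : ℕ} (hc : Eval c v b r) (hb : b ≠ .int 0)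
      (hf : Eval f v w s) (hl : Eval (.loop c f) w u t) : Eval (.loop c f) v u (1 + r + s + t)

/-- The language is deterministic: result and step count are determined by program and input. -/
theorem Eval.det {p : Prog} {v w w' : Val} {t t' : ℕ} (h : Eval p v w t) (h' : Eval p v w' t') :
    w = w' ∧ t = t' := by
  induction h generalizing w' t' with
  | op o v => cases h'; exact ⟨rfl, rfl⟩
  | const w v => cases h'; exact ⟨rfl, rfl⟩
  | seq _ _ ih1 ih2 =>
    cases h' with
    | seq a b =>
      obtain ⟨rfl, rfl⟩ := ih1 a
      obtain ⟨rfl, rfl⟩ := ih2 b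
      exact ⟨rfl, rfl⟩
  | both _ _ ih1 ih2 =>
    cases h' with
    | both a b =>
      obtain ⟨rfl, rfl⟩ := ih1 a
      obtain ⟨rfl, rfl⟩ := ih2 b
      exact ⟨rfl, rfl⟩
  | cond_true _ hb _ ih1 ih2 =>
    cases h' with
    | cond_true a _ b =>
      obtain ⟨rfl, rfl⟩ := ih1 a
      obtain ⟨rfl, rfl⟩ := ih2 b
      exact ⟨rfl, rfl⟩
    | cond_false a _ => exact absurd (ih1 a).1 hb
  | cond_false _ _ ih1 ih2 =>
    cases h' with
    | cond_true a hb _ => exact absurd (ih1 a).1.symm hb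
    | cond_false a b =>
      obtain ⟨-, rfl⟩ := ih1 a
      obtain ⟨rfl, rfl⟩ := ih2 b
      exact ⟨rfl, rfl⟩
  | loop_stop _ ih1 =>
    cases h' with
    | loop_stop a => obtain ⟨-, rfl⟩ := ih1 a; exact ⟨rfl, rfl⟩
    | loop_step a hb _ _ => exact absurd (ih1 a).1.symm hb
  | loop_step _ hb _ _ ih1 ih2 ih3 =>
    cases h' with
    | loop_stop a => exact absurd (ih1 a).1 hb
    | loop_step a _ b c =>
      obtain ⟨rfl, rfl⟩ := ih1 a
      obtain ⟨rfl, rfl⟩ := ih2 b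
      obtain ⟨rfl, rfl⟩ := ih3 c
      exact ⟨rfl, rfl⟩

/-- Encoding of mathematical objects as data. -/
class ToVal (α : Type) where
  toVal : α → Val

instance : ToVal Unit := ⟨fun _ => .int 0⟩
instance : ToVal Bool := ⟨fun b => .int (if b then 1 else 0)⟩
instance : ToVal ℕ := ⟨fun k => .int k⟩
instance : ToVal ℤ := ⟨fun z => .int z⟩
instance {n : ℕ} : ToVal (Fin n) := ⟨fun i => .int i.val⟩
instance {α β : Type} [ToVal α] [ToVal β] : ToVal (α × β) :=
  ⟨fun a => .pair (ToVal.toVal a.1) (ToVal.toVal a.2)⟩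
instance {α : Type} [ToVal α] : ToVal (List α) := ⟨fun l => .ofList (l.map ToVal.toVal)⟩
instance {α : Type} [ToVal α] {n : ℕ} : ToVal (Fin n → α) :=
  ⟨fun x => ToVal.toVal (List.ofFn x)⟩

/-- A family of functions `F n` (`n ≥ 1`) is computable in polynomial time: one program computes
`F n a` from `n` and `a`, for all `n` and `a`, in at most `T(n)` steps for a fixed polynomial
`T`. -/
def PolyTime {α β : ℕ → Type} [∀ n, ToVal (α n)] [∀ n, ToVal (β n)]
    (F : ∀ n, α n → β n) : Prop :=
  ∃ (p : Prog) (T : Polynomial ℕ), ∀ n, 1 ≤ n → ∀ a : α n,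
    ∃ t ≤ T.eval n, Eval p (.pair (.int n) (ToVal.toVal a)) (ToVal.toVal (F n a)) t

/-- Strings of `n` bits; also the labels of the computational basis of `n` qubits. -/
abbrev Bits (n : ℕ) : Type := Fin n → Bool

open Classical in
/-- Probability of an event over `k` independent fair coin flips. -/
noncomputable def coinProb {k : ℕ} (E : Bits k → Prop) : ℝ :=
  (Finset.univ.filter E).card / 2 ^ k

/-- The distributions `D n a` on `β n` are samplable in polynomial time: a polynomial-time program,
given `n`, `a` and polynomially many fair coin flips, outputs `b` with probability `D n a b`. -/
def Samplable {α β : ℕ → Type} [∀ n, ToVal (α n)] [∀ n, ToVal (β n)]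
    (D : ∀ n, α n → β n → ℝ) : Prop :=
  ∃ (l : Polynomial ℕ) (F : ∀ n, α n × Bits (l.eval n) → β n), PolyTime F ∧
    ∀ n, 1 ≤ n → ∀ a b, D n a b = coinProb fun r => F n (a, r) = b

/-- Complex-valued functions are computable in polynomial time with exponential accuracy: for every
polynomial `e`, a polynomial-time program computes integers `u, v` such that `(u + i v) / 2 ^ e(n)`
is within `2 ^ (-e(n))` of the value. -/
def ComplexPolyTime {α : ℕ → Type} [∀ n, ToVal (α n)] (f : ∀ n, α n → ℂ) : Prop :=
  ∀ e : Polynomial ℕ, ∃ A : ∀ n, α n → ℤ × ℤ, PolyTime A ∧ ∀ n, 1 ≤ n → ∀ a,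
    ‖((A n a).1 + (A n a).2 * Complex.I) / 2 ^ e.eval n - f n a‖ ≤ 1 / 2 ^ e.eval n

/-! ### Quantum circuits -/

/-- Operations on `n` qubits, as matrices in the computational basis. -/
abbrev QOp (n : ℕ) : Type := Matrix (Bits n) (Bits n) ℂ

/-- Pauli `X`; `false` and `true` are the basis states `|0⟩` and `|1⟩`. -/
def pauliX : Matrix Bool Bool ℂ := Matrix.of fun a b => if a = b then 0 else 1

/-- Pauli `Z`. -/
def pauliZ : Matrix Bool Bool ℂ := Matrix.diagonal fun b => if b then -1 else 1

/-- The rotation `R_x(θ)`. -/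
noncomputable def rotX (θ : ℝ) : Matrix Bool Bool ℂ :=
  (Real.cos (θ / 2) : ℂ) • 1 - (Complex.I * (Real.sin (θ / 2) : ℂ)) • pauliX

/-- The rotation `R_z(θ)`. -/
noncomputable def rotZ (θ : ℝ) : Matrix Bool Bool ℂ :=
  (Real.cos (θ / 2) : ℂ) • 1 - (Complex.I * (Real.sin (θ / 2) : ℂ)) • pauliZ

/-- The one-qubit operation `g` applied to qubit `i`. -/
def onQubit {n : ℕ} (g : Matrix Bool Bool ℂ) (i : Fin n) : QOp n :=
  Matrix.of fun y x => if ∀ k, k ≠ i → y k = x k then g (y i) (x i) else 0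

/-- Controlled-`Z` on qubits `i` and `j`. -/
def controlledZ {n : ℕ} (i j : Fin n) : QOp n :=
  Matrix.diagonal fun x => if x i && x j then -1 else 1

/-- Elementary gates: `R_x(±2π/2^t)`, `R_z(±2π/2^t)` with `t ≥ 1`, and `CZ`; the sign is negative
if `neg = true`. -/
inductive Gate (n : ℕ) where
  | rx (neg : Bool) (t : ℕ) (ht : 1 ≤ t) (i : Fin n)
  | rz (neg : Bool) (t : ℕ) (ht : 1 ≤ t) (i : Fin n)
  | cz (i j : Fin n) (hij : i ≠ j)

/-- The angle `±2π/2^t`. -/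
noncomputable def gateAngle (neg : Bool) (t : ℕ) : ℝ :=
  (if neg then -1 else 1) * (2 * Real.pi / 2 ^ t)

/-- Matrix of an elementary gate. -/
noncomputable def Gate.mat {n : ℕ} : Gate n → QOp n
  | .rx neg t _ i => onQubit (rotX (gateAngle neg t)) i
  | .rz neg t _ i => onQubit (rotZ (gateAngle neg t)) i
  | .cz i j _ => controlledZ i j

instance {n : ℕ} : ToVal (Gate n) where
  toVal
    | .rx neg t _ i => .pair (.int 0) (ToVal.toVal (neg, t, i))
    | .rz neg t _ i => .pair (.int 1) (ToVal.toVal (neg, t, i))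
    | .cz i j _ => .pair (.int 2) (ToVal.toVal (i, j))

/-- A quantum circuit on `n` qubits is a list of elementary gates, in order of application; its
size is the length of the list. The circuit `VU` (first `U`, then `V`) is `U ++ V`. -/
abbrev Circuit (n : ℕ) : Type := List (Gate n)

/-- Matrix of a circuit. -/
noncomputable def Circuit.mat {n : ℕ} : Circuit n → QOp n
  | [] => 1
  | g :: C => Circuit.mat C * g.mat

/-- The state `C|0ⁿ⟩`. -/
noncomputable def Circuit.state {n : ℕ} (C : Circuit n) : Bits n → ℂ :=
  C.mat *ᵥ Pi.single (fun _ => false) 1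

/-- Distribution of the outcomes in `{0,1}^m` when the qubits `Q 0, …, Q (m - 1)` of `C|0ⁿ⟩` are
measured in the computational basis. -/
noncomputable def Circuit.outDist {n m : ℕ} (C : Circuit n) (Q : Fin m → Fin n) (y : Bits m) : ℝ :=
  ∑ x : Bits n, if (fun i => x (Q i)) = y then ‖C.state x‖ ^ 2 else 0

/-- The circuits of the family have size polynomial in `n`. -/
def PolySize (C : ∀ n, Circuit n) : Prop :=
  ∃ P : Polynomial ℕ, ∀ n, 1 ≤ n → (C n).length ≤ P.eval n

/-! ### CT states and ECS operations -/

/-- Computationally tractable (families of) states. -/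
def IsCT (φ : ∀ n, Bits n → ℂ) : Prop :=
  (∀ e : Polynomial ℕ, ∃ D : ∀ n, Unit → Bits n → ℝ, Samplable D ∧
    ∀ n, 1 ≤ n → ∑ x, |D n () x - ‖φ n x‖ ^ 2| ≤ 1 / 2 ^ e.eval n) ∧
  ComplexPolyTime φ

open Classical in
/-- Row indices of the non-zero entries of the column of `M` indexed by `x`, from top to bottom
(that is, in lexicographic order). -/
noncomputable def colSupport {n : ℕ} (M : QOp n) (x : Bits n) : List (Bits n) :=
  (((Finset.univ.filter fun y => M y x ≠ 0).map toLex.toEmbedding).sort).map ofLex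

/-- Row index of the non-zero entry number `j` (counted from `0`) of the column indexed by `x`,
or `0ⁿ` if there is none. -/
noncomputable def rowOf {n : ℕ} (M : QOp n) (j : ℕ) (x : Bits n) : Bits n :=
  (colSupport M x).getD j fun _ => false

/-- The non-zero entry number `j` (counted from `0`) of the column indexed by `x`, or `0` if there
is none. -/
noncomputable def entryOf {n : ℕ} (M : QOp n) (j : ℕ) (x : Bits n) : ℂ :=
  ((colSupport M x).map fun y => M y x).getD j 0

/-- The operations `M n i` (`i : Fin n`) are, uniformly in `n` and `i`, efficiently computable
sparse with at most `s(n)` non-zero entries in each column. -/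
def IsECSWith (s : Polynomial ℕ) (M : ∀ n, Fin n → QOp n) : Prop :=
  (∀ n, 1 ≤ n → ∀ i, M n i ∈ Matrix.unitaryGroup (Bits n) ℂ ∧ (M n i).IsHermitian ∧
    ∀ x, (colSupport (M n i) x).length ≤ s.eval n) ∧
  PolyTime (fun n (a : Fin n × Fin (s.eval n) × Bits n) => rowOf (M n a.1) a.2.1 a.2.2) ∧
  ComplexPolyTime (fun n (a : Fin n × Fin (s.eval n) × Bits n) => entryOf (M n a.1) a.2.1 a.2.2)

/-- ECS₁: the number of non-zero entries in each column is bounded by a constant. -/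
def IsECS1 (M : ∀ n, Fin n → QOp n) : Prop := ∃ c : ℕ, IsECSWith (Polynomial.C c) M

/-- CT-ECS₁ circuits: `C = VU` with polynomial-size circuits `U` and `V`, such that `U|0ⁿ⟩` is CT
and the operations `V† Z_j V` are ECS₁. -/
def IsCTECS1 (C : ∀ n, Circuit n) : Prop :=
  ∃ U V : ∀ n, Circuit n, (∀ n, 1 ≤ n → C n = U n ++ V n) ∧ PolySize U ∧ PolySize V ∧
    IsCT (fun n => (U n).state) ∧
    IsECS1 fun n j => ((V n).mat)ᴴ * onQubit pauliZ j * (V n).mat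

/-! Write `φ` for the state `U|0ⁿ⟩` and `M_j` for `V† Z_j V`. In the Heisenberg picture the
probability of an outcome `y` is `⟨φ|P|φ⟩`, where `P` is the product over the measured qubits of the
operations `(1 ± M_j) / 2`, with signs given by the bits of `y` (`pulledProj_succ`,
`outDist_append`). Each factor has at most `c + 1` terms per column: the identity and the `c`
entries of `M_j`. Hence a column of `P` is a sum over `(c + 1) ^ m` walks, each following one term
per factor (`sum_walkCoef_mul`). This number is polynomial in `n` because `m = O(log n)`
(`exists_poly_pow_le`).

To estimate `⟨φ|P|φ⟩`, sample `x` with probability close to `|φ x|²` and add up the contributions of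
the walks from `x`. The naive contribution contains the quotient `φ z / φ x`, which is unbounded.
Since `P` is Hermitian, the entry `(z, x)` may instead be weighted by `2 Re(conj (φ z) P z x φ x) /
(|φ x|² + |φ z|²)`, the quantity `ratioTerm`. It has the same mean (`sum_norm_sq_mul_ratioTerm`) and
is bounded by `|P z x|` (`abs_ratioTerm_le`), so every estimate is bounded by a polynomial.
`ratioTerm` is unstable at small amplitudes, so it is only ever evaluated at the rounded amplitudes,
for which the identity is exact too; the exact amplitudes enter through the Hermitian form itself.
Summing rounding errors over all basis states costs a factor `2 ^ n`, which is paid for by `n`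
additional bits of precision (`abs_mean_sampleInt_sub_le`).

Hoeffding's inequality (`card_abs_avg_sub_mean_le`) makes the average of polynomially many estimates
accurate with exponentially small failure probability, and a union bound covers the `2 ^ m`
outcomes. The averages are clamped and written in a table, which is the description of the
distribution. Sampling from it needs no normalization: a uniform number is located among the partial
sums of the weights, with the excess cut off or the deficit given to the last entry
(`sum_abs_sub_table_le`). `exists_polyTime_table` collects this. For the second part of the theorem,
drawing a table and then an outcome samples the averaged distribution, whose error is the accuracy
of the tables plus twice the failure probability (`sum_abs_sub_average_le`).

Running times are handled by `PolyComp`, a relation between an environment and a value indexed by an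
arbitrary type of instances. Inside a loop the index type is enlarged by the loop counter (`Below`),
and case distinctions restrict it to a subtype. Polynomial bounds on sizes are part of the relation,
since the cost of a primitive depends on the size of its input. -/

/-! ### Polynomially bounded quantities -/

/-- `g` is bounded by a polynomial in the size parameter `N`. -/
def PolyBdd {ι : Type} (N g : ι → ℕ) : Prop := ∃ T : Polynomial ℕ, ∀ i, g i ≤ T.eval (N i)

namespace PolyBdd

variable {ι κ : Type} {N g h : ι → ℕ}

theorem mono (hg : PolyBdd N g) (hle : ∀ i, h i ≤ g i) : PolyBdd N h := by
  obtain ⟨T, hT⟩ := hg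
  exact ⟨T, fun i => (hle i).trans (hT i)⟩

theorem const (c : ℕ) : PolyBdd N fun _ => c := ⟨Polynomial.C c, fun i => by simp⟩

theorem self : PolyBdd N N := ⟨Polynomial.X, fun i => by simp⟩

theorem eval (T : Polynomial ℕ) : PolyBdd N fun i => T.eval (N i) := ⟨T, fun _ => le_rfl⟩

theorem add (hg : PolyBdd N g) (hh : PolyBdd N h) : PolyBdd N fun i => g i + h i := by
  obtain ⟨T, hT⟩ := hg
  obtain ⟨T', hT'⟩ := hh
  exact ⟨T + T', fun i => by simpa using add_le_add (hT i) (hT' i)⟩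

theorem mul (hg : PolyBdd N g) (hh : PolyBdd N h) : PolyBdd N fun i => g i * h i := by
  obtain ⟨T, hT⟩ := hg
  obtain ⟨T', hT'⟩ := hh
  exact ⟨T * T', fun i => by simpa using Nat.mul_le_mul (hT i) (hT' i)⟩

theorem reindex (hg : PolyBdd N g) (r : κ → ι) : PolyBdd (fun j => N (r j)) fun j => g (r j) := by
  obtain ⟨T, hT⟩ := hg
  exact ⟨T, fun i => hT (r i)⟩

end PolyBdd

/-! ### Sizes of data -/

namespace Val

theorem size_fst_le (v : Val) : v.fst.size ≤ v.size := by cases v <;> simp [size, fst]; omega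

theorem size_snd_le (v : Val) : v.snd.size ≤ v.size := by cases v <;> simp [size, snd]

theorem size_int_le {z : ℤ} {B : ℕ} (h : z.natAbs ≤ 2 ^ B) : (int z).size ≤ B + 2 := by
  have : Nat.size z.natAbs ≤ B + 1 :=
    Nat.size_le.2 (h.trans_lt (Nat.pow_lt_pow_right (by norm_num) (by omega)))
  simp only [size]; omega

theorem natAbs_lt_of_size (z : ℤ) : z.natAbs < 2 ^ (int z).size :=
  (Nat.lt_size_self _).trans_le (Nat.pow_le_pow_right (by norm_num) (by simp [size]))

theorem iterate_snd_ofList (l : List Val) (k : ℕ) : snd^[k] (ofList l) = ofList (l.drop k) := by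
  induction k generalizing l with
  | zero => rfl
  | succ k ih =>
    rw [Function.iterate_succ_apply]
    cases l with
    | nil => simpa [ofList, snd] using ih []
    | cons a l => simpa [ofList, snd] using ih l

theorem size_iterate_snd_le (v : Val) (k : ℕ) : (snd^[k] v).size ≤ v.size := by
  induction k with
  | zero => exact le_rfl
  | succ k ih => rw [Function.iterate_succ_apply']; exact (size_snd_le _).trans ih

theorem size_ofList_le {l : List Val} {B : ℕ} (h : ∀ v ∈ l, v.size ≤ B) :
    (ofList l).size ≤ 1 + l.length * (B + 1) := by
  induction l with
  | nil => simp [ofList, size]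
  | cons a l ih =>
    have := h a (by simp)
    have := ih fun v hv => h v (by simp [hv])
    simp only [ofList, size, List.length_cons, add_mul]
    omega

end Val

theorem size_toVal_bits {n : ℕ} (x : Bits n) : (ToVal.toVal x).size ≤ 1 + n * 3 := by
  have := Val.size_ofList_le (l := (List.ofFn x).map ToVal.toVal) (B := 2) (by
    intro v hv
    obtain ⟨b, -, rfl⟩ := List.mem_map.1 hv
    cases b <;> simp [ToVal.toVal, Val.size])
  simpa [ToVal.toVal] using this

/-- Functions on `Fin n` are stored as lists, so the value at `k` is the head after `k` tails. This
is how programs read bit strings and the list of measured qubits. -/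
theorem toVal_fun_drop {α : Type} [ToVal α] {n : ℕ} (x : Fin n → α) (k : Fin n) :
    (Val.snd^[k] (ToVal.toVal x)).fst = ToVal.toVal (x k) := by
  change (Val.snd^[k] (Val.ofList ((List.ofFn x).map ToVal.toVal))).fst = _
  rw [Val.iterate_snd_ofList, ← List.map_drop, List.drop_eq_getElem_cons (by simp)]
  simp [Val.ofList, Val.fst]

/-! ### Computability from an environment in polynomial time -/

/-- One program computes `x i` from `e i` for all `i`, in time polynomial in the size parameter
`N i`; the data have polynomial size. -/
def PolyComp {ι : Type} (N : ι → ℕ) (e x : ι → Val) : Prop :=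
  PolyBdd N (fun i => (e i).size) ∧ PolyBdd N (fun i => (x i).size) ∧
    ∃ (p : Prog) (T : Polynomial ℕ), ∀ i, ∃ t ≤ T.eval (N i), Eval p (e i) (x i) t

/-- Pairs `(i, k)` with `k < K i`. -/
abbrev Below {ι : Type} (K : ι → ℕ) : Type := {j : ι × ℕ // j.2 < K j.1}

theorem Below.castSucc_proof {ι : Type} {K : ι → ℕ} (j : Below K) : j.1.2 < K j.1.1 + 1 :=
  j.2.trans (Nat.lt_succ_self _)

/-- A pair `(i, k)` with `k < K i` as a pair with `k < K i + 1`. -/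
abbrev Below.castSucc {ι : Type} {K : ι → ℕ} (j : Below K) : Below fun i => K i + 1 :=
  ⟨j.1, j.castSucc_proof⟩

namespace PolyComp

variable {ι κ : Type} {N : ι → ℕ} {e x y z : ι → Val}

open Val (pair int)

theorem congr (h : PolyComp N e x) (hxy : ∀ i, x i = y i) : PolyComp N e y := by
  rwa [← funext hxy]

theorem reindex (h : PolyComp N e x) (r : κ → ι) :
    PolyComp (fun j => N (r j)) (fun j => e (r j)) fun j => x (r j) := by
  obtain ⟨he, hx, p, T, hp⟩ := h
  exact ⟨he.reindex r, hx.reindex r, p, T, fun j => hp (r j)⟩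

theorem trans (h : PolyComp N e x) (h' : PolyComp N x y) : PolyComp N e y := by
  obtain ⟨he, -, p, T, hp⟩ := h
  obtain ⟨-, hy, q, S, hq⟩ := h'
  refine ⟨he, hy, .seq p q, 1 + T + S, fun i => ?_⟩
  obtain ⟨t, ht, h1⟩ := hp i
  obtain ⟨s, hs, h2⟩ := hq i
  exact ⟨_, by simp; omega, .seq h1 h2⟩

/-- The cost is governed by the size of the input, which `h` already bounds. The size of the result
needs its own bound, since iterated multiplications can exceed every polynomial. -/
theorem op (o : Op) (h : PolyComp N e x) (hy : PolyBdd N fun i => (o.apply (x i)).size) :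
    PolyComp N e fun i => o.apply (x i) := by
  refine h.trans ⟨h.2.1, hy, .op o, ?_⟩
  obtain ⟨T, hT⟩ := h.2.1
  exact ⟨1 + T, fun i => ⟨_, by simpa using hT i, .op o (x i)⟩⟩

theorem self (he : PolyBdd N fun i => (e i).size) : PolyComp N e e := by
  obtain ⟨T, hT⟩ := id he
  exact ⟨he, he, .op .id, 1 + T, fun i => ⟨_, by simpa using hT i, .op .id (e i)⟩⟩

theorem const (he : PolyBdd N fun i => (e i).size) (w : Val) : PolyComp N e fun _ => w :=
  ⟨he, .const _, .const w, 1, fun i => ⟨1, by simp, .const w (e i)⟩⟩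

theorem pair (hx : PolyComp N e x) (hy : PolyComp N e y) :
    PolyComp N e fun i => .pair (x i) (y i) := by
  obtain ⟨he, hxs, p, T, hp⟩ := hx
  obtain ⟨-, hys, q, S, hq⟩ := hy
  refine ⟨he, ((PolyBdd.const 1).add hxs).add hys, .both p q, 1 + T + S, fun i => ?_⟩
  obtain ⟨t, ht, h1⟩ := hp i
  obtain ⟨s, hs, h2⟩ := hq i
  exact ⟨_, by simp; omega, .both h1 h2⟩

theorem fst' (h : PolyComp N e x) : PolyComp N e fun i => (x i).fst :=
  h.op .fst (h.2.1.mono fun _ => Val.size_fst_le _)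

theorem snd' (h : PolyComp N e x) : PolyComp N e fun i => (x i).snd :=
  h.op .snd (h.2.1.mono fun _ => Val.size_snd_le _)

theorem fst (h : PolyComp N e fun i => .pair (x i) (y i)) : PolyComp N e x := h.fst'

theorem snd (h : PolyComp N e fun i => .pair (x i) (y i)) : PolyComp N e y := h.snd'

theorem isPair (h : PolyComp N e x) : PolyComp N e fun i => (x i).isPair :=
  h.op .isPair ((PolyBdd.const 2).mono fun i => by
    cases x i <;> simp [Op.apply, Val.isPair, Val.size])

/-- Values computed from the first component of an environment. -/
theorem weaken (h : PolyComp N e x) (hy : PolyBdd N fun i => (y i).size) :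
    PolyComp N (fun i => .pair (e i) (y i)) x :=
  (self (((PolyBdd.const 1).add h.1).add hy)).fst.trans h

/-- The last variable of an environment. -/
theorem var (he : PolyBdd N fun i => (e i).size) (hy : PolyBdd N fun i => (y i).size) :
    PolyComp N (fun i => .pair (e i) (y i)) y :=
  (self (((PolyBdd.const 1).add he).add hy)).snd

/-! ### Integer arithmetic -/

section Arithmetic

variable {a b : ι → ℤ} {k l : ι → ℕ}

theorem add (ha : PolyComp N e fun i => int (a i)) (hb : PolyComp N e fun i => int (b i)) :
    PolyComp N e fun i => int (a i + b i) :=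
  (ha.pair hb).op .add <| ((ha.2.1.add hb.2.1).add (.const 3)).mono fun i =>
    (Val.size_int_le (B := (int (a i)).size + (int (b i)).size) (by
      have h1 := Val.natAbs_lt_of_size (a i)
      have h2 := Val.natAbs_lt_of_size (b i)
      have h3 := Nat.one_le_two_pow (n := (int (a i)).size)
      have h4 := Nat.one_le_two_pow (n := (int (b i)).size)
      have := Int.natAbs_add_le (a i) (b i)
      simp only [Val.fst, Val.snd, Val.toInt]
      rw [pow_add]
      nlinarith)).trans (by dsimp only; omega)

theorem sub (ha : PolyComp N e fun i => int (a i)) (hb : PolyComp N e fun i => int (b i)) :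
    PolyComp N e fun i => int (a i - b i) :=
  (ha.pair hb).op .sub <| ((ha.2.1.add hb.2.1).add (.const 3)).mono fun i =>
    (Val.size_int_le (B := (int (a i)).size + (int (b i)).size) (by
      have h1 := Val.natAbs_lt_of_size (a i)
      have h2 := Val.natAbs_lt_of_size (b i)
      have h3 := Nat.one_le_two_pow (n := (int (a i)).size)
      have h4 := Nat.one_le_two_pow (n := (int (b i)).size)
      have := Int.natAbs_sub_le (a i) (b i)
      simp only [Val.fst, Val.snd, Val.toInt]
      rw [pow_add]
      nlinarith)).trans (by dsimp only; omega)

theorem mul (ha : PolyComp N e fun i => int (a i)) (hb : PolyComp N e fun i => int (b i)) :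
    PolyComp N e fun i => int (a i * b i) :=
  (ha.pair hb).op .mul <| ((ha.2.1.add hb.2.1).add (.const 3)).mono fun i =>
    (Val.size_int_le (B := (int (a i)).size + (int (b i)).size) (by
      simp only [Val.fst, Val.snd, Val.toInt, Int.natAbs_mul, pow_add]
      exact Nat.mul_le_mul (Val.natAbs_lt_of_size _).le (Val.natAbs_lt_of_size _).le)).trans
      (by dsimp only; omega)

theorem div (ha : PolyComp N e fun i => int (a i)) (hb : PolyComp N e fun i => int (b i)) :
    PolyComp N e fun i => int (a i / b i) :=
  (ha.pair hb).op .div <| (ha.2.1.add (.const 3)).mono fun i =>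
    (Val.size_int_le (B := (int (a i)).size) (by
      exact (Int.natAbs_ediv_le_natAbs _ _).trans (Val.natAbs_lt_of_size _).le)).trans
      (by dsimp only; omega)

theorem le (ha : PolyComp N e fun i => int (a i)) (hb : PolyComp N e fun i => int (b i)) :
    PolyComp N e fun i => ToVal.toVal (decide (a i ≤ b i)) :=
  ((ha.pair hb).op .le <| (PolyBdd.const 2).mono fun i => by
    simp only [Op.apply]; split_ifs <;> simp [Val.size]).congr fun i => by
      by_cases h : a i ≤ b i <;> simp [Op.apply, Val.fst, Val.snd, Val.toInt, ToVal.toVal, h]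

theorem natAdd (ha : PolyComp N e fun i => int (k i)) (hb : PolyComp N e fun i => int (l i)) :
    PolyComp N e fun i => int (k i + l i : ℕ) := (ha.add hb).congr fun i => by push_cast; rfl

theorem natMul (ha : PolyComp N e fun i => int (k i)) (hb : PolyComp N e fun i => int (l i)) :
    PolyComp N e fun i => int (k i * l i : ℕ) := (ha.mul hb).congr fun i => by push_cast; rfl

theorem natDiv (ha : PolyComp N e fun i => int (k i)) (hb : PolyComp N e fun i => int (l i)) :
    PolyComp N e fun i => int (k i / l i : ℕ) := (ha.div hb).congr fun i => by push_cast; rfl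

theorem natMod (ha : PolyComp N e fun i => int (k i)) (hb : PolyComp N e fun i => int (l i)) :
    PolyComp N e fun i => int (k i % l i : ℕ) :=
  (ha.sub (hb.mul (ha.div hb))).congr fun i => by
    push_cast; rw [Int.emod_def]

theorem natConst (he : PolyBdd N fun i => (e i).size) (c : ℕ) :
    PolyComp N e fun _ => int (c : ℕ) := const he _

/-- Values of a polynomial. -/
theorem eval (h : PolyComp N e fun i => int (k i)) (P : Polynomial ℕ) :
    PolyComp N e fun i => int (P.eval (k i) : ℕ) := by
  induction P using Polynomial.induction_on' with
  | add p q hp hq => exact (hp.natAdd hq).congr fun i => by simp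
  | monomial d c =>
    induction d with
    | zero => exact (natConst h.1 c).congr fun i => by simp
    | succ d ih => exact (ih.natMul h).congr fun i => by simp [pow_succ]; ring

end Arithmetic

/-! ### Case distinctions, loops and lists -/

/-- Case distinction; the branches need only be computable where they are used. -/
theorem ite {p : ι → Prop} [DecidablePred p]
    (hp : PolyComp N e fun i => ToVal.toVal (decide (p i)))
    (hx : PolyComp (fun i : {i // p i} => N i) (fun i => e i) fun i => x i)
    (hy : PolyComp (fun i : {i // ¬ p i} => N i) (fun i => e i) fun i => y i) :
    PolyComp N e fun i => if p i then x i else y i := by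
  obtain ⟨he, -, c, T, hc⟩ := hp
  obtain ⟨-, ⟨S1, hS1⟩, f, T1, hf⟩ := hx
  obtain ⟨-, ⟨S2, hS2⟩, g, T2, hg⟩ := hy
  refine ⟨he, ⟨S1 + S2, fun i => ?_⟩, .cond c f g, 1 + T + T1 + T2, fun i => ?_⟩
  · by_cases h : p i
    · simpa [h] using Nat.le_add_right_of_le (hS1 ⟨i, h⟩)
    · simpa [h] using Nat.le_add_left_of_le (hS2 ⟨i, h⟩)
  · obtain ⟨t, ht, h1⟩ := hc i
    by_cases h : p i
    · obtain ⟨s, hs, h2⟩ := hf ⟨i, h⟩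
      refine ⟨1 + t + s, by simp at hs ⊢; omega, ?_⟩
      simp only [h, if_true]
      exact .cond_true h1 (by simp [h, ToVal.toVal]) h2
    · obtain ⟨s, hs, h2⟩ := hg ⟨i, h⟩
      refine ⟨1 + t + s, by simp at hs ⊢; omega, ?_⟩
      simp only [h, if_false]
      simp only [h, decide_false, ToVal.toVal] at h1
      exact .cond_false h1 h2

theorem ite' {p : ι → Prop} [DecidablePred p]
    (hp : PolyComp N e fun i => ToVal.toVal (decide (p i)))
    (hx : PolyComp N e x) (hy : PolyComp N e y) : PolyComp N e fun i => if p i then x i else y i :=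
  hp.ite (hx.reindex _) (hy.reindex _)

/-- A loop running through the states `s i 0, …, s i (K i)`. -/
theorem loop {s : ι → ℕ → Val} {K : ι → ℕ} (hK : PolyBdd N K)
    (hs0 : PolyBdd N fun i => (s i 0).size) (hs1 : PolyBdd N fun i => (s i (K i)).size)
    (hc : PolyComp (fun j : Below fun i => K i + 1 => N j.1.1) (fun j => s j.1.1 j.1.2)
      fun j => int (K j.1.1 - j.1.2))
    (hf : PolyComp (fun j : Below K => N j.1.1) (fun j => s j.1.1 j.1.2)
      fun j => s j.1.1 (j.1.2 + 1)) :
    PolyComp N (fun i => s i 0) fun i => s i (K i) := by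
  obtain ⟨-, -, c, T, hc⟩ := hc
  obtain ⟨-, -, f, S, hf⟩ := hf
  obtain ⟨R, hR⟩ := hK
  refine ⟨hs0, hs1, .loop c f, 1 + T + R * (1 + T + S), fun i => ?_⟩
  -- Induction on the number `d` of remaining rounds. The guard evaluates to exactly this number, so
  -- it vanishes only at the last state.
  have key : ∀ d k, k + d = K i → ∃ t ≤ 1 + T.eval (N i) + d * (1 + T.eval (N i) + S.eval (N i)),
      Eval (.loop c f) (s i k) (s i (K i)) t := by
    intro d
    induction d with
    | zero =>
      intro k hk
      obtain rfl : k = K i := by omega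
      obtain ⟨t, ht, h⟩ := hc ⟨(i, K i), by simp⟩
      simp only [sub_self] at h
      exact ⟨1 + t, by simp at ht ⊢; omega, Eval.loop_stop h⟩
    | succ d ih =>
      intro k hk
      obtain ⟨t, ht, h⟩ := hc ⟨(i, k), by simp; omega⟩
      obtain ⟨u, hu, h'⟩ := hf ⟨(i, k), by simp; omega⟩
      obtain ⟨r, hr, h''⟩ := ih (k + 1) (by omega)
      refine ⟨1 + t + u + r, ?_, .loop_step h ?_ h' h''⟩
      · simp only [add_mul, one_mul] at ht hu hr ⊢; omega
      · simp only [ne_eq, Val.int.injEq]; omega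
  obtain ⟨t, ht, h⟩ := key (K i) 0 (by omega)
  refine ⟨t, ht.trans ?_, h⟩
  simp only [Polynomial.eval_add, Polynomial.eval_mul, Polynomial.eval_one]
  gcongr
  exact hR i

/-- Iteration with access to the environment and to the loop counter. -/
theorem fold {s : ι → ℕ → Val} {K : ι → ℕ} (hKb : PolyBdd N K)
    (hK : PolyComp N e fun i => int (K i)) (h0 : PolyComp N e fun i => s i 0)
    (hs : PolyBdd (fun j : Below fun i => K i + 1 => N j.1.1) fun j => (s j.1.1 j.1.2).size)
    (hstep : PolyComp (fun j : Below K => N j.1.1)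
      (fun j => .pair (.pair (e j.1.1) (int j.1.2)) (s j.1.1 j.1.2))
      fun j => s j.1.1 (j.1.2 + 1)) :
    PolyComp N e fun i => s i (K i) := by
  have hs1 : PolyBdd N fun i => (s i (K i)).size :=
    hs.reindex (fun i : ι => (⟨(i, K i), by simp⟩ : Below fun i => K i + 1))
  have hcount : PolyBdd (fun j : Below fun i => K i + 1 => N j.1.1) fun j => (int j.1.2).size :=
    ((hKb.reindex fun j : Below fun i => K i + 1 => j.1.1).add (.const 2)).mono fun j =>
      Val.size_int_le (by simpa using (Nat.lt_succ_iff.1 j.2).trans Nat.lt_two_pow_self.le)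
  have hst : PolyBdd (fun j : Below fun i => K i + 1 => N j.1.1) fun j =>
      (Val.pair (.pair (.pair (e j.1.1) (int j.1.2)) (s j.1.1 j.1.2)) (int (K j.1.1))).size :=
    (((PolyBdd.const 1).add (((PolyBdd.const 1).add (((PolyBdd.const 1).add
      (hK.1.reindex _)).add hcount)).add hs)).add (hK.2.1.reindex _)).mono fun j => le_rfl
  have hst' : PolyBdd (fun j : Below K => N j.1.1) fun j =>
      (Val.pair (.pair (.pair (e j.1.1) (int j.1.2)) (s j.1.1 j.1.2)) (int (K j.1.1))).size :=
    hst.reindex fun j : Below K => j.castSucc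
  have hz := const (e := e) hK.1 (int 0)
  -- The loop datum carries the environment, the counter, the state and the bound, because guard and
  -- body see nothing but the current datum. The state is projected out at the end.
  refine (((((self hK.1).pair hz).pair h0).pair hK).trans (loop (s := fun i k =>
    .pair (.pair (.pair (e i) (int k)) (s i k)) (int (K i))) hKb ?_ ?_ ?_ ?_)).fst.snd
  · exact ((((self hK.1).pair hz).pair h0).pair hK).2.1
  · exact hst.reindex (fun i : ι => (⟨(i, K i), by simp⟩ : Below fun i => K i + 1))
  · exact (self hst).snd.sub (self hst).fst.fst.snd
  · have hst0 := self hst'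
    refine ((hst0.fst.fst.fst.pair ?_).pair (hst0.fst.trans hstep)).pair hst0.snd
    exact (hst0.fst.fst.snd.add (const hst' (int 1))).congr fun j => by push_cast; rfl

/-- Polynomial size of the environment inside a bounded iteration. -/
theorem polyBdd_counter {K : ι → ℕ} (hKb : PolyBdd N K) :
    PolyBdd (fun j : Below K => N j.1.1) fun j => (int j.1.2).size :=
  ((hKb.reindex fun j : Below K => j.1.1).add (.const 2)).mono fun j =>
    Val.size_int_le (by simpa using j.2.le.trans Nat.lt_two_pow_self.le)

/-- Values of the environment inside a bounded iteration. -/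
theorem inBelow (h : PolyComp N e x) {K : ι → ℕ} (hKb : PolyBdd N K) :
    PolyComp (fun j : Below K => N j.1.1) (fun j => .pair (e j.1.1) (int j.1.2))
      fun j => x j.1.1 :=
  (h.reindex fun j : Below K => j.1.1).weaken (polyBdd_counter hKb)

theorem counter {K : ι → ℕ} (he : PolyBdd N fun i => (e i).size) (hKb : PolyBdd N K) :
    PolyComp (fun j : Below K => N j.1.1) (fun j => .pair (e j.1.1) (int j.1.2))
      fun j => int j.1.2 :=
  var (he.reindex _) (polyBdd_counter hKb)

/-- The partial sums are the loop states. They stay small because a sum of `R` numbers of `T` bits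
has about `R + T` bits. -/
theorem sum {f : ι → ℕ → ℤ} {K : ι → ℕ} (hKb : PolyBdd N K)
    (hK : PolyComp N e fun i => int (K i))
    (hf : PolyComp (fun j : Below K => N j.1.1) (fun j => .pair (e j.1.1) (int j.1.2))
      fun j => int (f j.1.1 j.1.2)) :
    PolyComp N e fun i => int (∑ k ∈ Finset.range (K i), f i k) := by
  have hs : PolyBdd (fun j : Below fun i => K i + 1 => N j.1.1) fun j =>
      (int (∑ k ∈ Finset.range j.1.2, f j.1.1 k)).size := by
    obtain ⟨T, hT⟩ := hf.2.1
    obtain ⟨R, hR⟩ := hKb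
    refine ⟨R + T + 2, fun ⟨⟨i, k⟩, hk⟩ => ?_⟩
    have h1 : ∀ m ∈ Finset.range k, (f i m).natAbs ≤ 2 ^ T.eval (N i) := fun m hm => by
      have h2 : m < K i := by have := Finset.mem_range.1 hm; simp at hk; omega
      exact (Val.natAbs_lt_of_size _).le.trans
        (Nat.pow_le_pow_right (by norm_num) (hT ⟨(i, m), h2⟩))
    have h3 : (∑ m ∈ Finset.range k, f i m).natAbs ≤ k * 2 ^ T.eval (N i) := by
      refine (Int.natAbs_sum_le _ _).trans ?_
      simpa using Finset.sum_le_card_nsmul _ _ _ h1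
    refine (Val.size_int_le (B := R.eval (N i) + T.eval (N i)) (h3.trans ?_)).trans (by simp)
    rw [pow_add]
    have h4 : k ≤ R.eval (N i) := by have := hR i; simp at hk; omega
    exact Nat.mul_le_mul (h4.trans Nat.lt_two_pow_self.le) le_rfl
  have hs' : PolyBdd (fun j : Below K => N j.1.1) fun j =>
      (int (∑ k ∈ Finset.range j.1.2, f j.1.1 k)).size :=
    hs.reindex fun j : Below K => j.castSucc
  refine fold (s := fun i k => int (∑ m ∈ Finset.range k, f i m)) hKb hK
    ((const hK.1 (int 0)).congr fun i => by simp) hs ?_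
  have hv := (self hf.1).weaken hs' |>.pair (var hf.1 hs')
  exact (hv.snd.add (hv.fst.trans hf)).congr fun j => by rw [Finset.sum_range_succ]

theorem natSum {f : ι → ℕ → ℕ} {K : ι → ℕ} (hKb : PolyBdd N K)
    (hK : PolyComp N e fun i => int (K i))
    (hf : PolyComp (fun j : Below K => N j.1.1) (fun j => .pair (e j.1.1) (int j.1.2))
      fun j => int (f j.1.1 j.1.2)) :
    PolyComp N e fun i => int (∑ k ∈ Finset.range (K i), f i k : ℕ) :=
  (sum hKb hK (f := fun i k => (f i k : ℤ)) hf).congr fun i => by push_cast; rfl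

/-- Powers, with an exponent of polynomial value. -/
theorem natPow {b k : ι → ℕ} (hb : PolyComp N e fun i => int (b i)) (hkb : PolyBdd N k)
    (hk : PolyComp N e fun i => int (k i)) : PolyComp N e fun i => int (b i ^ k i : ℕ) := by
  have hs : PolyBdd (fun j : Below fun i => k i + 1 => N j.1.1) fun j =>
      (int (b j.1.1 ^ j.1.2 : ℕ)).size := by
    obtain ⟨T, hT⟩ := hb.2.1
    obtain ⟨R, hR⟩ := hkb
    refine ⟨T * R + 2, fun ⟨⟨i, m⟩, hm⟩ => ?_⟩
    refine (Val.size_int_le (B := T.eval (N i) * R.eval (N i)) ?_).trans (by simp)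
    have h1 : b i ≤ 2 ^ T.eval (N i) := by
      simpa using (Val.natAbs_lt_of_size (b i)).le.trans
        (Nat.pow_le_pow_right (by norm_num) (hT i))
    have h2 : m ≤ R.eval (N i) := by have := hR i; simp at hm; omega
    calc b i ^ m ≤ (2 ^ T.eval (N i)) ^ m := Nat.pow_le_pow_left h1 m
      _ ≤ (2 ^ T.eval (N i)) ^ R.eval (N i) := Nat.pow_le_pow_right (by positivity) h2
      _ = _ := (pow_mul _ _ _).symm
  have hs' : PolyBdd (fun j : Below k => N j.1.1) fun j => (int (b j.1.1 ^ j.1.2 : ℕ)).size :=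
    hs.reindex fun j : Below k => j.castSucc
  refine fold (s := fun i m => int (b i ^ m : ℕ)) hkb hk
    ((const hk.1 (int 1)).congr fun i => by simp) hs ?_
  exact ((var (((hb.inBelow hkb)).1) hs').natMul ((hb.inBelow hkb).weaken hs')).congr
    fun j => by rw [pow_succ]

/-- Tabulation of a function. -/
theorem ofFn {f : ι → ℕ → Val} {K : ι → ℕ} (hKb : PolyBdd N K)
    (hK : PolyComp N e fun i => int (K i))
    (hf : PolyComp (fun j : Below K => N j.1.1) (fun j => .pair (e j.1.1) (int j.1.2))
      fun j => f j.1.1 j.1.2) :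
    PolyComp N e fun i => Val.ofList (List.ofFn fun k : Fin (K i) => f i k) := by
  -- Lists grow at the front, so the table is filled from its end: after `k` rounds it holds the
  -- last `k` values.
  let s : ι → ℕ → Val := fun i k => .ofList ((List.range' (K i - k) k).map (f i))
  have hs : PolyBdd (fun j : Below fun i => K i + 1 => N j.1.1) fun j => (s j.1.1 j.1.2).size := by
    obtain ⟨T, hT⟩ := hf.2.1
    obtain ⟨R, hR⟩ := hKb
    refine ⟨1 + R * (T + 1), fun ⟨⟨i, k⟩, hk⟩ => ?_⟩
    refine (Val.size_ofList_le (B := T.eval (N i)) fun v hv => ?_).trans ?_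
    · obtain ⟨m, hm, rfl⟩ := List.mem_map.1 hv
      have h2 : m < K i := by rw [List.mem_range'_1] at hm; dsimp only at hk hm; omega
      exact hT ⟨(i, m), h2⟩
    · simp only [List.length_map, List.length_range', Polynomial.eval_add, Polynomial.eval_mul,
        Polynomial.eval_one]
      have h4 : k ≤ R.eval (N i) := by have := hR i; simp at hk; omega
      gcongr
  have hs' : PolyBdd (fun j : Below K => N j.1.1) fun j => (s j.1.1 j.1.2).size :=
    hs.reindex fun j : Below K => j.castSucc
  have hstep : ∀ i k, k < K i → s i (k + 1) = .pair (f i (K i - 1 - k)) (s i k) := by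
    intro i k hk
    have h1 : K i - (k + 1) = K i - 1 - k := by omega
    have h2 : K i - 1 - k + 1 = K i - k := by omega
    simp only [s, List.range'_succ, List.map_cons, Val.ofList, h1, h2]
  refine (fold (s := s) hKb hK ((const hK.1 (int 0)).congr fun i => by simp [s, Val.ofList]) hs
    ?_).congr fun i => ?_
  · have hidx : PolyComp (fun j : Below K => N j.1.1) (fun j => .pair (e j.1.1) (int j.1.2))
        fun j => int (K j.1.1 - 1 - j.1.2 : ℕ) :=
      (((hK.inBelow hKb).sub (const hf.1 (int 1))).sub (counter hK.1 hKb)).congr fun j => by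
        have := j.2
        congr 1; omega
    have hf' := hf.reindex fun j : Below K =>
      (⟨(j.1.1, K j.1.1 - 1 - j.1.2), by have := j.2; dsimp only; omega⟩ : Below K)
    refine ((((((self hK.1).inBelow hKb).pair hidx).trans hf').weaken hs').pair
      (var hf.1 hs')).congr fun j => ?_
    exact (hstep _ _ j.2).symm
  · simp only [s, Nat.sub_self]
    congr 1
    apply List.ext_getElem <;> simp

/-- The tail of a list. -/
theorem drop {k : ι → ℕ} (hx : PolyComp N e x) (hkb : PolyBdd N k)
    (hk : PolyComp N e fun i => int (k i)) : PolyComp N e fun i => Val.snd^[k i] (x i) := by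
  have hs : PolyBdd (fun j : Below fun i => k i + 1 => N j.1.1) fun j =>
      (Val.snd^[j.1.2] (x j.1.1)).size :=
    (hx.2.1.reindex _).mono fun j => Val.size_iterate_snd_le _ _
  have hs' : PolyBdd (fun j : Below k => N j.1.1) fun j => (Val.snd^[j.1.2] (x j.1.1)).size :=
    (hx.2.1.reindex _).mono fun j => Val.size_iterate_snd_le _ _
  exact fold (s := fun i m => Val.snd^[m] (x i)) hkb hk hx hs
    ((var ((hx.inBelow hkb)).1 hs').snd'.congr fun j =>
      (Function.iterate_succ_apply' _ _ _).symm)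

/-- Entries of a list. -/
theorem apply {α : ι → Type} [∀ i, ToVal (α i)] {k : ι → ℕ} {v : ∀ i, Fin (k i) → α i}
    {m : ∀ i, Fin (k i)} (hv : PolyComp N e fun i => ToVal.toVal (v i)) (hkb : PolyBdd N k)
    (hm : PolyComp N e fun i => ToVal.toVal (m i)) :
    PolyComp N e fun i => ToVal.toVal (v i (m i)) :=
  (hv.drop (hkb.mono fun i => (m i).2.le) hm).fst'.congr fun i => toVal_fun_drop _ _

/-- Subroutine calls. `PolyTime` speaks of steps only, so the size of the returned value is bounded
separately. -/
theorem ofPolyTime {α β : ℕ → Type} [∀ n, ToVal (α n)] [∀ n, ToVal (β n)]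
    {F : ∀ n, α n → β n} (hF : PolyTime F) (hN : ∀ i, 1 ≤ N i) {a : ∀ i, α (N i)}
    (hn : PolyComp N e fun i => int (N i)) (ha : PolyComp N e fun i => ToVal.toVal (a i))
    (hb : PolyBdd N fun i => (ToVal.toVal (F (N i) (a i))).size) :
    PolyComp N e fun i => ToVal.toVal (F (N i) (a i)) := by
  obtain ⟨p, T, hp⟩ := hF
  exact (hn.pair ha).trans ⟨(hn.pair ha).2.1, hb, p, T, fun i => hp _ (hN i) _⟩

/-- With the type of all admissible inputs as index type, `PolyComp` provides a single program for
all `n`, which is the required uniformity. -/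
theorem polyTime {α β : ℕ → Type} [∀ n, ToVal (α n)] [∀ n, ToVal (β n)]
    {F : ∀ n, α n → β n}
    (h : PolyComp (fun i : {i : Σ n, α n // 1 ≤ i.1} => i.1.1)
      (fun i => .pair (int i.1.1) (ToVal.toVal i.1.2)) fun i => ToVal.toVal (F i.1.1 i.1.2)) :
    PolyTime F := by
  obtain ⟨-, -, p, T, hp⟩ := h
  exact ⟨p, T, fun n hn a => hp ⟨⟨n, a⟩, hn⟩⟩

end PolyComp

/-! ### Circuits are unitary -/

section Qubit

variable {n : ℕ}

theorem onQubit_mul (g h : Matrix Bool Bool ℂ) (i : Fin n) :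
    onQubit g i * onQubit h i = onQubit (g * h) i := by
  ext y x
  simp only [Matrix.mul_apply, onQubit, Matrix.of_apply, ite_mul, zero_mul, mul_ite, mul_zero]
  -- Only intermediate states that agree with `y` away from `i` contribute, so the sum over `z`
  -- collapses to a sum over the bit at `i`.
  have key : ∀ z : Bits n, (if ∀ k, k ≠ i → z k = x k then
      if ∀ k, k ≠ i → y k = z k then g (y i) (z i) * h (z i) (x i) else 0 else 0) =
      ∑ b : Bool, if Function.update y i b = z then
        if ∀ k, k ≠ i → y k = x k then g (y i) b * h b (x i) else 0 else 0 := by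
    intro z
    by_cases hz : ∀ k, k ≠ i → y k = z k
    · have h1 : ∀ b, Function.update y i b = z ↔ b = z i := fun b => by
        refine ⟨fun hb => by simp [← hb], fun hb => ?_⟩
        ext k
        by_cases hk : k = i
        · subst hk; simp [hb]
        · simp [hk, hz k hk]
      have h2 : (∀ k, k ≠ i → z k = x k) ↔ ∀ k, k ≠ i → y k = x k :=
        forall₂_congr fun k hk => by rw [hz k hk]
      rw [if_pos hz]
      simp [h1, h2]
    · simp only [if_neg hz, ite_self]
      rw [Finset.sum_eq_zero]
      intro b _
      rw [if_neg]
      rintro rfl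
      exact hz fun k hk => by simp [hk]
  simp only [key]
  rw [Finset.sum_comm]
  simp only [Finset.sum_ite_eq, Finset.mem_univ, if_true]
  split_ifs <;> simp

theorem onQubit_one (i : Fin n) : onQubit (1 : Matrix Bool Bool ℂ) i = 1 := by
  ext y x
  by_cases h : y = x
  · subst h; simp [onQubit]
  · rw [Matrix.one_apply_ne h]
    simp only [onQubit, Matrix.of_apply]
    split_ifs with h1
    · apply Matrix.one_apply_ne
      intro h2
      exact h (funext fun k => by
        by_cases hk : k = i
        · rw [hk, h2]
        · exact h1 k hk)
    · rfl

theorem conjTranspose_onQubit (g : Matrix Bool Bool ℂ) (i : Fin n) :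
    (onQubit g i)ᴴ = onQubit gᴴ i := by
  ext y x
  simp only [onQubit, Matrix.conjTranspose_apply, Matrix.of_apply]
  have : (∀ k, k ≠ i → x k = y k) ↔ ∀ k, k ≠ i → y k = x k := by simp only [eq_comm]
  simp only [this]
  split_ifs <;> simp

theorem onQubit_mem_unitaryGroup {g : Matrix Bool Bool ℂ}
    (hg : g ∈ Matrix.unitaryGroup Bool ℂ) (i : Fin n) :
    onQubit g i ∈ Matrix.unitaryGroup (Bits n) ℂ := by
  rw [Matrix.mem_unitaryGroup_iff, Matrix.star_eq_conjTranspose] at hg ⊢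
  rw [conjTranspose_onQubit, onQubit_mul, hg, onQubit_one]

theorem onQubit_pauliZ (i : Fin n) :
    onQubit pauliZ i = Matrix.diagonal fun x : Bits n => if x i then -1 else 1 := by
  ext y x
  by_cases h : y = x
  · subst h; simp [onQubit, pauliZ]
  · rw [Matrix.diagonal_apply_ne _ h]
    simp only [onQubit, Matrix.of_apply, pauliZ]
    split_ifs with h1
    · apply Matrix.diagonal_apply_ne
      intro h2
      exact h (funext fun k => by
        by_cases hk : k = i
        · rw [hk, h2]
        · exact h1 k hk)
    · rfl

/-- Since `P` is Hermitian with square one, the product with the adjoint is `(c - isP)(c + isP) = c²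
+ s²`. -/
theorem rotation_mem_unitaryGroup {P : Matrix Bool Bool ℂ} (hP : P.IsHermitian) (hP2 : P * P = 1)
    (c s : ℝ) (hcs : c ^ 2 + s ^ 2 = 1) :
    ((c : ℂ) • 1 - (Complex.I * (s : ℂ)) • P) ∈ Matrix.unitaryGroup Bool ℂ := by
  rw [Matrix.mem_unitaryGroup_iff, Matrix.star_eq_conjTranspose]
  have h : ((c : ℂ) • (1 : Matrix Bool Bool ℂ) - (Complex.I * (s : ℂ)) • P)ᴴ =
      (c : ℂ) • 1 + (Complex.I * (s : ℂ)) • P := by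
    simp [Matrix.conjTranspose_sub, Matrix.conjTranspose_smul, hP.eq, neg_smul]
  have hcs' : (c : ℂ) * c + s * s = 1 := by
    rw [← sq, ← sq]; exact_mod_cast hcs
  rw [h]
  simp only [sub_mul, mul_add, Matrix.smul_mul, Matrix.mul_smul, Matrix.one_mul, Matrix.mul_one,
    hP2, smul_smul]
  have h1 : Complex.I * (s : ℂ) * (Complex.I * s) = -(s * s) := by
    linear_combination (s * s : ℂ) * Complex.I_mul_I
  rw [h1, mul_comm (Complex.I * (s : ℂ)) (c : ℂ)]
  trans ((c : ℂ) * c + s * s) • (1 : Matrix Bool Bool ℂ)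
  · module
  · rw [hcs', one_smul]

theorem Gate.mat_mem_unitaryGroup (g : Gate n) : g.mat ∈ Matrix.unitaryGroup (Bits n) ℂ := by
  cases g with
  | rx neg t ht i =>
    refine onQubit_mem_unitaryGroup (rotation_mem_unitaryGroup ?_ ?_ _ _
      (Real.cos_sq_add_sin_sq _)) i
    · ext a b; cases a <;> cases b <;> simp [pauliX, Matrix.conjTranspose_apply]
    · ext a b; cases a <;> cases b <;> simp [pauliX, Matrix.mul_apply]
  | rz neg t ht i =>
    refine onQubit_mem_unitaryGroup (rotation_mem_unitaryGroup ?_ ?_ _ _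
      (Real.cos_sq_add_sin_sq _)) i
    · ext a b; cases a <;> cases b <;> simp [pauliZ, Matrix.conjTranspose_apply]
    · ext a b; cases a <;> cases b <;> simp [pauliZ, Matrix.mul_apply]
  | cz i j hij =>
    rw [Matrix.mem_unitaryGroup_iff, Matrix.star_eq_conjTranspose]
    simp only [Gate.mat, controlledZ, Matrix.diagonal_conjTranspose, Matrix.diagonal_mul_diagonal]
    rw [← Matrix.diagonal_one]
    congr 1
    ext x
    simp only [Pi.star_apply]
    split_ifs <;> simp

theorem Circuit.mat_mem_unitaryGroup (C : Circuit n) :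
    C.mat ∈ Matrix.unitaryGroup (Bits n) ℂ := by
  induction C with
  | nil => exact one_mem _
  | cons g C ih => exact mul_mem ih g.mat_mem_unitaryGroup

theorem Circuit.mat_append (C D : Circuit n) :
    Circuit.mat (C ++ D) = Circuit.mat D * Circuit.mat C := by
  induction C with
  | nil => simp [Circuit.mat]
  | cons g C ih => simp only [List.cons_append, Circuit.mat, ih, Matrix.mul_assoc]

theorem Circuit.state_append (C D : Circuit n) :
    Circuit.state (C ++ D) = Circuit.mat D *ᵥ Circuit.state C := by
  simp only [Circuit.state, Circuit.mat_append, Matrix.mulVec_mulVec]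

theorem Circuit.sum_norm_sq_state (C : Circuit n) : ∑ x, ‖C.state x‖ ^ 2 = 1 := by
  have h : star C.state ⬝ᵥ C.state = 1 := by
    have hu := Matrix.mem_unitaryGroup_iff'.1 C.mat_mem_unitaryGroup
    rw [Matrix.star_eq_conjTranspose] at hu
    rw [Circuit.state, Matrix.star_mulVec, ← Matrix.dotProduct_mulVec, Matrix.mulVec_mulVec, hu,
      Matrix.one_mulVec]
    simp
  have h' : ((∑ x, ‖C.state x‖ ^ 2 : ℝ) : ℂ) = 1 := by
    rw [← h]
    simp [dotProduct, Complex.conj_mul']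
  exact_mod_cast h'

theorem Circuit.norm_state_le_one (C : Circuit n) (x : Bits n) : ‖C.state x‖ ≤ 1 := by
  have h := Finset.single_le_sum (f := fun x => ‖C.state x‖ ^ 2) (fun _ _ => by positivity)
    (Finset.mem_univ x)
  rw [C.sum_norm_sq_state] at h
  exact (sq_le_one_iff₀ (norm_nonneg _)).1 h

theorem Circuit.outDist_nonneg {m : ℕ} (C : Circuit n) (Q : Fin m → Fin n) (y : Bits m) :
    0 ≤ C.outDist Q y :=
  Finset.sum_nonneg fun x _ => by split_ifs <;> positivity

theorem Circuit.sum_outDist {m : ℕ} (C : Circuit n) (Q : Fin m → Fin n) :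
    ∑ y, C.outDist Q y = 1 := by
  simp only [Circuit.outDist]
  rw [Finset.sum_comm, ← C.sum_norm_sq_state]
  simp

end Qubit

/-! ### The measurement projector as a product of sparse operations -/

section Projector

variable {n m : ℕ}

/-- Diagonal projector onto the basis states whose first `k` qubits in the list `Q` read `y`. -/
noncomputable def readProj (Q : Fin m → Fin n) (y : Bits m) (k : ℕ) : QOp n :=
  Matrix.diagonal fun x => if ∀ i : Fin m, i.1 < k → x (Q i) = y i then 1 else 0

/-- The measurement projector pulled back through `V`. -/
noncomputable def pulledProj (V : QOp n) (Q : Fin m → Fin n) (y : Bits m) (k : ℕ) : QOp n :=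
  Vᴴ * readProj Q y k * V

/-- The sign `(-1)^b`. -/
def bitSign (b : Bool) : ℤ := if b then -1 else 1

variable (V : QOp n) (Q : Fin m → Fin n) (y : Bits m)

theorem pulledProj_isHermitian (k : ℕ) : (pulledProj V Q y k).IsHermitian := by
  apply Matrix.isHermitian_conjTranspose_mul_mul
  rw [Matrix.IsHermitian, readProj, Matrix.diagonal_conjTranspose]
  congr 1
  ext x
  simp only [Pi.star_apply]
  split_ifs <;> simp

variable {V}

theorem pulledProj_zero (hV : V ∈ Matrix.unitaryGroup (Bits n) ℂ) : pulledProj V Q y 0 = 1 := by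
  have hu := Matrix.mem_unitaryGroup_iff'.1 hV
  rw [Matrix.star_eq_conjTranspose] at hu
  simp [pulledProj, readProj, hu]

/-- Reading one more bit multiplies the projector by `(1 ± Z) / 2`. Inserting `V V† = 1` between the
factors conjugates each `Z` separately, so that only the sparse operations `V† Z V` occur. -/
theorem pulledProj_succ (hV : V ∈ Matrix.unitaryGroup (Bits n) ℂ) {k : ℕ} (hk : k < m) :
    pulledProj V Q y (k + 1) = ((1 / 2 : ℂ) • (1 + (bitSign (y ⟨k, hk⟩) : ℂ) •
      (Vᴴ * onQubit pauliZ (Q ⟨k, hk⟩) * V))) * pulledProj V Q y k := by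
  have hu' := Matrix.mem_unitaryGroup_iff'.1 hV
  have hu := Matrix.mem_unitaryGroup_iff.1 hV
  rw [Matrix.star_eq_conjTranspose] at hu hu'
  have h : readProj Q y (k + 1) = ((1 / 2 : ℂ) • (1 + (bitSign (y ⟨k, hk⟩) : ℂ) •
      onQubit pauliZ (Q ⟨k, hk⟩))) * readProj Q y k := by
    rw [onQubit_pauliZ, readProj, readProj, ← Matrix.diagonal_one, ← Matrix.diagonal_smul,
      Matrix.diagonal_add, ← Matrix.diagonal_smul, Matrix.diagonal_mul_diagonal]
    congr 1
    ext x
    have h1 : (∀ i : Fin m, i.1 < k + 1 → x (Q i) = y i) ↔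
        x (Q ⟨k, hk⟩) = y ⟨k, hk⟩ ∧ ∀ i : Fin m, i.1 < k → x (Q i) = y i := by
      refine ⟨fun h => ⟨h _ (by simp), fun i hi => h i (by omega)⟩, fun h i hi => ?_⟩
      rcases Nat.lt_succ_iff_lt_or_eq.1 hi with hi | hi
      · exact h.2 i hi
      · obtain rfl : i = ⟨k, hk⟩ := Fin.ext hi
        exact h.1
    simp only [h1, Pi.smul_apply, smul_eq_mul]
    by_cases h2 : ∀ i : Fin m, i.1 < k → x (Q i) = y i
    · cases x (Q ⟨k, hk⟩) <;> cases y ⟨k, hk⟩ <;> simp [bitSign] <;> norm_num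
    · simp [h2]
  simp only [pulledProj, h, Matrix.smul_mul, Matrix.add_mul, Matrix.mul_smul, Matrix.mul_add,
    Matrix.one_mul]
  congr 3
  simp only [← Matrix.mul_assoc]
  rw [Matrix.mul_assoc _ V Vᴴ, hu, Matrix.mul_one]

/-- The Born rule with `V` moved from the state to the projector: what remains is a Hermitian form
in the tractable state `U|0ⁿ⟩`. -/
theorem outDist_append (U V : Circuit n) :
    ((Circuit.outDist (U ++ V) Q y : ℝ) : ℂ) =
      star (Circuit.state U) ⬝ᵥ (pulledProj (Circuit.mat V) Q y m *ᵥ Circuit.state U) := by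
  rw [pulledProj, ← Matrix.mulVec_mulVec, ← Matrix.mulVec_mulVec, Matrix.dotProduct_mulVec,
    ← Matrix.star_mulVec, ← Circuit.state_append]
  simp only [Circuit.outDist, dotProduct, readProj, Matrix.mulVec_diagonal, Pi.star_apply]
  push_cast
  refine Finset.sum_congr rfl fun x _ => ?_
  have h : ((fun i => x (Q i)) = y) ↔ ∀ i : Fin m, i.1 < m → x (Q i) = y i :=
    ⟨fun h i _ => congrFun h i, fun h => funext fun i => h i i.2⟩
  simp only [h]
  split_ifs
  · simp [Complex.conj_mul']
  · simp

end Projector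

/-! ### Quadratic forms of Hermitian operations -/

section Quadratic

variable {α : Type*} [Fintype α]

/-- The summand at the entry `(z, x)` of a Hermitian form, divided by the weight of the two
indices. -/
noncomputable def ratioTerm (c u v : ℂ) : ℝ :=
  2 * (star v * c * u).re / (‖u‖ ^ 2 + ‖v‖ ^ 2)

/-- This is `2|u||v| ≤ |u|² + |v|²`, and the reason for dividing by the weights of both indices: the
quotient `v / u` has no such bound. If both amplitudes vanish, the term is zero by the convention
for division. -/
theorem abs_ratioTerm_le (c u v : ℂ) : |ratioTerm c u v| ≤ ‖c‖ := by
  rw [ratioTerm, abs_div, abs_of_nonneg (by positivity : 0 ≤ ‖u‖ ^ 2 + ‖v‖ ^ 2)]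
  refine div_le_of_le_mul₀ (by positivity) (norm_nonneg _) ?_
  have h1 : |(star v * c * u).re| ≤ ‖v‖ * ‖c‖ * ‖u‖ := by
    refine (Complex.abs_re_le_norm _).trans ?_
    simp
  rw [abs_mul, abs_two]
  nlinarith [norm_nonneg c, mul_nonneg (norm_nonneg c) (sq_nonneg (‖u‖ - ‖v‖))]

theorem ratioTerm_sub (c c' u v : ℂ) :
    ratioTerm c u v - ratioTerm c' u v = ratioTerm (c - c') u v := by
  simp only [ratioTerm, ← sub_div, mul_sub, sub_mul, Complex.sub_re]

/-- Homogeneity of degree zero in the amplitudes: their common denominator cancels and Gaussian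
integers can be used in their place. -/
theorem ratioTerm_smul (r : ℝ) (hr : r ≠ 0) (c u v : ℂ) :
    ratioTerm c (r * u) (r * v) = ratioTerm c u v := by
  have h : star ((r : ℂ) * v) * c * (r * u) = ((r ^ 2 : ℝ) : ℂ) * (star v * c * u) := by
    push_cast
    rw [star_mul', Complex.star_def, Complex.conj_ofReal]; ring
  have h2 : ‖(r : ℂ) * u‖ ^ 2 + ‖(r : ℂ) * v‖ ^ 2 = r ^ 2 * (‖u‖ ^ 2 + ‖v‖ ^ 2) := by
    simp [mul_pow]; ring
  rw [ratioTerm, h, h2, Complex.re_ofReal_mul, ratioTerm, mul_left_comm,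
    mul_div_mul_left _ _ (pow_ne_zero 2 hr)]

/-- A Hermitian form as an average over the squared amplitudes. -/
theorem sum_norm_sq_mul_ratioTerm {O : Matrix α α ℂ} (hO : O.IsHermitian) (a : α → ℂ) :
    ∑ x, ‖a x‖ ^ 2 * ∑ z, ratioTerm (O z x) (a x) (a z) = (star a ⬝ᵥ (O *ᵥ a)).re := by
  -- Hermiticity makes the term symmetric in `x` and `z`, so the weight `|a x|²` may be traded for
  -- `|a z|²`. Adding the two versions cancels the denominator; where it vanishes, both sides are
  -- zero.
  have hsymm : ∀ x z, ratioTerm (O z x) (a x) (a z) = ratioTerm (O x z) (a z) (a x) := by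
    intro x z
    have h : star (a x) * O x z * a z = star (star (a z) * O z x * a x) := by
      rw [← hO.apply x z]; simp only [star_mul', star_star]; ring
    rw [ratioTerm, ratioTerm, h, add_comm, Complex.star_def, Complex.conj_re]
  have hterm : ∀ x z, (‖a x‖ ^ 2 + ‖a z‖ ^ 2) * ratioTerm (O z x) (a x) (a z) =
      2 * (star (a z) * O z x * a x).re := by
    intro x z
    by_cases h : ‖a x‖ ^ 2 + ‖a z‖ ^ 2 = 0
    · have hx : a x = 0 := by
        have : ‖a x‖ ^ 2 = 0 := by nlinarith [sq_nonneg ‖a x‖, sq_nonneg ‖a z‖]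
        simpa using this
      rw [h, hx]; simp
    · rw [ratioTerm, mul_div_cancel₀ _ h]
  have h1 : ∑ x, ‖a x‖ ^ 2 * ∑ z, ratioTerm (O z x) (a x) (a z) =
      ∑ x, ∑ z, ‖a x‖ ^ 2 * ratioTerm (O z x) (a x) (a z) := by simp only [Finset.mul_sum]
  have h2 : ∑ x, ∑ z, ‖a x‖ ^ 2 * ratioTerm (O z x) (a x) (a z) =
      ∑ x, ∑ z, ‖a z‖ ^ 2 * ratioTerm (O z x) (a x) (a z) := by
    rw [Finset.sum_comm]
    exact Finset.sum_congr rfl fun x _ => Finset.sum_congr rfl fun z _ => by rw [hsymm]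
  have h3 : ∑ x, ∑ z, ‖a x‖ ^ 2 * ratioTerm (O z x) (a x) (a z) +
      ∑ x, ∑ z, ‖a z‖ ^ 2 * ratioTerm (O z x) (a x) (a z) =
      2 * ∑ x, ∑ z, (star (a z) * O z x * a x).re := by
    simp only [← Finset.sum_add_distrib, ← add_mul, hterm, Finset.mul_sum]
  have h4 : (star a ⬝ᵥ (O *ᵥ a)).re = ∑ x, ∑ z, (star (a z) * O z x * a x).re := by
    simp only [dotProduct, Matrix.mulVec, Finset.mul_sum, Complex.re_sum, Pi.star_apply]
    rw [Finset.sum_comm]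
    simp only [mul_assoc]
  rw [h1, h4]; linarith

end Quadratic

/-! ### Columns of sparse operations -/

section Column

variable {n : ℕ} (M : QOp n) (x : Bits n)

/-- Slots beyond the end of the list contribute nothing because the default coefficient is `0`; the
default position `d` is then irrelevant. -/
theorem sum_getD_mul {β γ : Type*} [CommSemiring γ] (l : List β) (g h : β → γ) (d : β) {c : ℕ}
    (hc : l.length ≤ c) :
    ∑ j ∈ Finset.range c, (l.map g).getD j 0 * h (l.getD j d) = (l.map fun b => g b * h b).sum := by
  induction l generalizing c with
  | nil => simp
  | cons b l ih =>
    obtain ⟨c, rfl⟩ : ∃ c', c = c' + 1 := ⟨c - 1, by simp at hc; omega⟩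
    rw [Finset.sum_range_succ']
    simp only [List.length_cons, Nat.add_le_add_iff_right] at hc
    simp only [List.map_cons, List.getD_cons_succ, ih hc, List.getD_cons_zero, List.sum_cons]
    rw [add_comm]

/-- The support lists each non-zero row once, so a sum over the `c` slots, padding included, is a
sum over the whole column. -/
theorem sum_entryOf_mul {c : ℕ} (hc : (colSupport M x).length ≤ c) (f : Bits n → ℂ) :
    ∑ j ∈ Finset.range c, entryOf M j x * f (rowOf M j x) = ∑ z, M z x * f z := by
  classical
  simp only [entryOf, rowOf]
  rw [sum_getD_mul _ (fun y => M y x) f _ hc]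
  have hnd : (colSupport M x).Nodup := by
    rw [colSupport]
    exact (Finset.sort_nodup _ _).map ofLex.injective
  rw [← List.sum_toFinset _ hnd]
  refine Finset.sum_subset (Finset.subset_univ _) fun z _ hz => ?_
  have : M z x = 0 := by
    by_contra h
    apply hz
    simp [colSupport, h]
  simp [this]

theorem norm_entryOf_le_one (hM : M ∈ Matrix.unitaryGroup (Bits n) ℂ) (j : ℕ) :
    ‖entryOf M j x‖ ≤ 1 := by
  rw [entryOf, List.getD_eq_getElem?_getD]
  by_cases h : j < (colSupport M x).length
  · simp only [List.getElem?_map, List.getElem?_eq_getElem h, Option.map_some, Option.getD_some]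
    exact entry_norm_bound_of_unitary hM _ _
  · rw [List.getElem?_eq_none (by simpa using h)]
    simp

end Column

/-! ### Walks along the non-zero entries of a product of sparse operations -/

/-- Splitting off the lowest digit in base `B` is a bijection from numbers below `B * C` to pairs of
a digit and a number below `C`. -/
theorem sum_range_mul_mod_div {R : Type*} [AddCommMonoid R] (B C : ℕ) (hB : 0 < B)
    (g : ℕ → ℕ → R) :
    ∑ w ∈ Finset.range (B * C), g (w % B) (w / B) =
      ∑ q ∈ Finset.range C, ∑ d ∈ Finset.range B, g d q := by
  induction C with
  | zero => simp
  | succ C ih =>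
    rw [mul_add, mul_one, Finset.sum_range_add, ih, Finset.sum_range_succ]
    congr 1
    refine Finset.sum_congr rfl fun d hd => ?_
    rw [Finset.mem_range] at hd
    rw [Nat.mul_add_mod, Nat.mod_eq_of_lt hd, Nat.mul_add_div hB, Nat.div_eq_of_lt hd, add_zero]

section Walk

variable {X : Type} (c : ℕ) (row : ℕ → ℕ → X → X)

/-- Step number `k` of a walk: stay for `d = 0`, and otherwise follow entry number `d - 1`. -/
def walkStep (k d : ℕ) (z : X) : X := if d = 0 then z else row k (d - 1) z

/-- Unread digits and position after `k` steps of the walk from `x` given by the base `c + 1` digits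
of `w`, least significant digit first. -/
def walk (w : ℕ) (x : X) : ℕ → ℕ × X
  | 0 => (w, x)
  | k + 1 => ((walk w x k).1 / (c + 1), walkStep row k ((walk w x k).1 % (c + 1)) (walk w x k).2)

/-- Product of the coefficients met on a walk. -/
def walkCoef {R : Type*} [CommSemiring R] (co : ℕ → ℕ → X → R) (w : ℕ) (x : X) : ℕ → R
  | 0 => 1
  | k + 1 => walkCoef co w x k *
      co k ((walk c row w x k).1 % (c + 1)) (walk c row w x k).2

/-- Induction on the number of steps: one step reads the lowest unread digit, and summing over that
digit applies `H k` by `hH`. The induction closes because `C` leaves room for unread digits and `G`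
may depend on them; the applications take `C = 1`. -/
theorem sum_walkCoef_mul [Fintype X] [DecidableEq X] {co : ℕ → ℕ → X → ℂ}
    {P H : ℕ → Matrix X X ℂ} {m : ℕ} (h0 : P 0 = 1) (hP : ∀ k < m, P (k + 1) = H k * P k)
    (hH : ∀ k < m, ∀ (z : X) (g : X → ℂ),
      ∑ d ∈ Finset.range (c + 1), co k d z * g (walkStep row k d z) = ∑ z', H k z' z * g z')
    (x : X) (k : ℕ) (hk : k ≤ m) (C : ℕ) (G : ℕ → X → ℂ) :
    ∑ w ∈ Finset.range ((c + 1) ^ k * C),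
      walkCoef c row co w x k * G (walk c row w x k).1 (walk c row w x k).2 =
      ∑ q ∈ Finset.range C, ∑ z, P k z x * G q z := by
  induction k generalizing C G with
  | zero => simp [walkCoef, walk, h0, Matrix.one_apply]
  | succ k ih =>
    have h1 := ih (by omega) ((c + 1) * C) fun q z =>
      co k (q % (c + 1)) z * G (q / (c + 1)) (walkStep row k (q % (c + 1)) z)
    simp only [walkCoef, walk]
    rw [pow_succ, mul_assoc]
    simp only [← mul_assoc] at h1 ⊢
    rw [h1, sum_range_mul_mod_div (c + 1) C (Nat.succ_pos c)
      fun d q => ∑ z, P k z x * co k d z * G q (walkStep row k d z)]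
    refine Finset.sum_congr rfl fun q _ => ?_
    rw [Finset.sum_comm]
    simp only [mul_assoc, ← Finset.mul_sum, hH k hk, hP k hk, Matrix.mul_apply]
    simp only [Finset.mul_sum, Finset.sum_mul]
    rw [Finset.sum_comm]
    exact Finset.sum_congr rfl fun z _ => Finset.sum_congr rfl fun z' _ => by ring

theorem norm_walkCoef_le {co : ℕ → ℕ → X → ℂ} (hco : ∀ k d z, ‖co k d z‖ ≤ 1) (w : ℕ) (x : X)
    (k : ℕ) : ‖walkCoef c row co w x k‖ ≤ 1 := by
  induction k with
  | zero => simp [walkCoef]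
  | succ k ih =>
    rw [walkCoef, norm_mul]
    exact mul_le_one₀ ih (norm_nonneg _) (hco _ _ _)

/-- The factors are exchanged one at a time; each exchange costs at most `ε`, as all other factors
have norm at most one. -/
theorem norm_walkCoef_sub_le {co co' : ℕ → ℕ → X → ℂ} {ε : ℝ} (hco : ∀ k d z, ‖co k d z‖ ≤ 1)
    (hco' : ∀ k d z, ‖co' k d z‖ ≤ 1) (hε : ∀ k d z, ‖co' k d z - co k d z‖ ≤ ε)
    (w : ℕ) (x : X) (k : ℕ) :
    ‖walkCoef c row co' w x k - walkCoef c row co w x k‖ ≤ k * ε := by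
  induction k with
  | zero => simp [walkCoef]
  | succ k ih =>
    simp only [walkCoef]
    set a := walkCoef c row co w x k
    set a' := walkCoef c row co' w x k
    set b := co k ((walk c row w x k).1 % (c + 1)) (walk c row w x k).2
    set b' := co' k ((walk c row w x k).1 % (c + 1)) (walk c row w x k).2
    have h0 : a' * b' - a * b = (a' - a) * b' + a * (b' - b) := by ring
    have h1 : ‖a' - a‖ * ‖b'‖ ≤ k * ε * 1 :=
      mul_le_mul ih (hco' _ _ _) (norm_nonneg _) ((norm_nonneg _).trans ih)
    have h2 : ‖a‖ * ‖b' - b‖ ≤ 1 * ε :=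
      mul_le_mul (norm_walkCoef_le c row hco w x k) (hε _ _ _) (norm_nonneg _) zero_le_one
    rw [h0]
    refine (norm_add_le _ _).trans ?_
    rw [norm_mul, norm_mul]
    push_cast
    linarith

/-- With one denominator `D` for all steps, the product along a walk is computed exactly in Gaussian
integers and divided once by `D ^ k`. -/
theorem walkCoef_div (g : ℕ → ℕ → X → GaussianInt) (D : ℂ) (w : ℕ) (x : X) (k : ℕ) :
    walkCoef c row (fun k d z => (g k d z : ℂ) / D) w x k =
      ((walkCoef c row g w x k : GaussianInt) : ℂ) / D ^ k := by
  induction k with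
  | zero => simp [walkCoef]
  | succ k ih => rw [walkCoef, ih, walkCoef, GaussianInt.toComplex_mul, pow_succ, div_mul_div_comm]

end Walk

/-! ### The integer estimator -/

section Estimator

/-- `2 ^ e` times `ratioTerm`, rounded to an integer, for Gaussian integers `u`, `v` and
`c = P / D`. -/
def ratioInt (e D : ℕ) (P u v : GaussianInt) : ℤ :=
  (2 * (star v * P * u).re * 2 ^ e) / ((u.norm + v.norm) * D)

theorem normSq_toComplex (u : GaussianInt) : ‖(u : ℂ)‖ ^ 2 = (u.norm : ℝ) := by
  rw [← Complex.normSq_eq_norm_sq, GaussianInt.intCast_real_norm]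

/-- The case `b = 0` needs no hypothesis, as both divisions then return `0`. This matches `ratioInt`
and `ratioTerm` when both amplitudes vanish. -/
theorem abs_ediv_sub_div_le (a b : ℤ) : |((a / b : ℤ) : ℝ) - (a : ℝ) / b| ≤ 1 := by
  by_cases hb : b = 0
  · simp [hb]
  have hb' : (b : ℝ) ≠ 0 := by exact_mod_cast hb
  have h : (a : ℝ) = b * (a / b : ℤ) + (a % b : ℤ) := by exact_mod_cast (Int.mul_ediv_add_emod a b).symm
  have h1 : ((a / b : ℤ) : ℝ) - (a : ℝ) / b = -((a % b : ℤ) / (b : ℝ)) := by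
    rw [h]; field_simp; ring
  rw [h1, abs_neg, abs_div]
  refine div_le_one_of_le₀ ?_ (abs_nonneg _)
  rw [← Int.cast_abs, ← Int.cast_abs, Int.cast_le, abs_of_nonneg (Int.emod_nonneg _ hb)]
  exact (Int.emod_lt_abs _ hb).le

theorem abs_ratioInt_sub_le (e D : ℕ) (P u v : GaussianInt) :
    |(ratioInt e D P u v : ℝ) / 2 ^ e - ratioTerm ((P : ℂ) / D) u v| ≤ 1 / 2 ^ e := by
  have h : ratioTerm ((P : ℂ) / D) u v =
      (((2 * (star v * P * u).re * 2 ^ e : ℤ) : ℝ) / (((u.norm + v.norm) * D : ℤ) : ℝ)) / 2 ^ e := by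
    have h1 : star (v : ℂ) * ((P : ℂ) / D) * u = ((star v * P * u : GaussianInt) : ℂ) / D := by
      rw [GaussianInt.toComplex_mul, GaussianInt.toComplex_mul, GaussianInt.toComplex_star]
      simp only [Complex.star_def]; ring
    rw [ratioTerm, h1, normSq_toComplex, normSq_toComplex, Complex.div_natCast_re,
      ← GaussianInt.intCast_re]
    push_cast
    rw [div_div, mul_div_mul_right _ _ (by positivity : (2 : ℝ) ^ e ≠ 0), mul_comm _ (D : ℝ),
      ← div_div]
    ring
  rw [h, ← sub_div, abs_div, abs_of_pos (by positivity : (0 : ℝ) < 2 ^ e)]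
  gcongr
  exact abs_ediv_sub_div_le _ _

variable {n m : ℕ} (c e : ℕ) (row : ℕ → ℕ → Bits n → Bits n)

/-- Estimate, in units of `2 ^ (-e)`, obtained from the sample `x`: the sum over all walks from
`x`, with amplitudes `a` and matrix entries `g` in units of `2 ^ (-e)`. -/
def sampleInt (g : ℕ → ℕ → Bits n → GaussianInt) (a : Bits n → GaussianInt) (m : ℕ)
    (x : Bits n) : ℤ :=
  ∑ w ∈ Finset.range ((c + 1) ^ m), ratioInt e ((2 ^ (e + 1)) ^ m)
    (walkCoef c row g w x m) (a x) (a (walk c row w x m).2)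

variable {c e row}

/-- Each of the `(c + 1) ^ m` walks contributes at most one from `ratioTerm` and at most one from
rounding. The denominator is `2 ^ (e + 1)` because the factors `(1 ± M) / 2` halve the entries of
`M`. -/
theorem abs_sampleInt_le {g : ℕ → ℕ → Bits n → GaussianInt} (a : Bits n → GaussianInt)
    (hg : ∀ k d z, ‖(g k d z : ℂ) / (2 ^ (e + 1) : ℂ)‖ ≤ 1) (x : Bits n) :
    |(sampleInt c e row g a m x : ℝ) / 2 ^ e| ≤ 2 * (c + 1) ^ m := by
  rw [sampleInt, Int.cast_sum, Finset.sum_div]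
  refine (Finset.abs_sum_le_sum_abs _ _).trans ?_
  have : ∀ w ∈ Finset.range ((c + 1) ^ m), |((ratioInt e ((2 ^ (e + 1)) ^ m)
    (walkCoef c row g w x m) (a x) (a (walk c row w x m).2) : ℤ) : ℝ) / 2 ^ e| ≤ 2 := by
    intro w _
    have h1 := abs_ratioInt_sub_le e ((2 ^ (e + 1)) ^ m) (walkCoef c row g w x m) (a x)
      (a (walk c row w x m).2)
    have h2 := abs_ratioTerm_le (((walkCoef c row g w x m : GaussianInt) : ℂ) / ((2 ^ (e + 1)) ^ m : ℕ)) (a x)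
      (a (walk c row w x m).2)
    have h3 := norm_walkCoef_le c row hg w x m
    rw [walkCoef_div] at h3
    push_cast at h1 h2
    have h4 : (1 : ℝ) / 2 ^ e ≤ 1 := div_le_one_of_le₀ (one_le_pow₀ one_le_two) (by positivity)
    rw [abs_le] at *
    constructor <;> linarith [h1.1, h1.2, h2.1, h2.2]
  refine (Finset.sum_le_card_nsmul _ _ _ this).trans ?_
  simp [mul_comm]

variable {co : ℕ → ℕ → Bits n → ℂ} {P H : ℕ → QOp n}

/-- `ratioTerm` is the real part of a linear function of its coefficient, so path coefficients may
be collected into the entries of the product. -/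
theorem sum_walk_ratioTerm (h0 : P 0 = 1) (hP : ∀ k < m, P (k + 1) = H k * P k)
    (hH : ∀ k < m, ∀ (z : Bits n) (f : Bits n → ℂ),
      ∑ d ∈ Finset.range (c + 1), co k d z * f (walkStep row k d z) = ∑ z', H k z' z * f z')
    (a : Bits n → ℂ) (x : Bits n) :
    ∑ w ∈ Finset.range ((c + 1) ^ m),
      ratioTerm (walkCoef c row co w x m) (a x) (a (walk c row w x m).2) =
      ∑ z, ratioTerm (P m z x) (a x) (a z) := by
  have key := sum_walkCoef_mul c row h0 hP hH x m le_rfl 1 fun _ z =>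
    star (a z) * a x * ((2 / (‖a x‖ ^ 2 + ‖a z‖ ^ 2) : ℝ) : ℂ)
  have hterm : ∀ (b : ℂ) (z : Bits n), ratioTerm b (a x) (a z) =
      (b * (star (a z) * a x * ((2 / (‖a x‖ ^ 2 + ‖a z‖ ^ 2) : ℝ) : ℂ))).re := by
    intro b z
    rw [show b * (star (a z) * a x * ((2 / (‖a x‖ ^ 2 + ‖a z‖ ^ 2) : ℝ) : ℂ)) =
      ((2 / (‖a x‖ ^ 2 + ‖a z‖ ^ 2) : ℝ) : ℂ) * (star (a z) * b * a x) by ring,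
      Complex.re_ofReal_mul, ratioTerm]
    ring
  simp only [mul_one, Finset.sum_range_one] at key
  simp only [hterm, ← Complex.re_sum, key]

theorem norm_star_mul_sub_le {a a' b b' : ℂ} {ε : ℝ} (hε : ε ≤ 1) (ha : ‖a‖ ≤ 1) (hb : ‖b‖ ≤ 1)
    (haa : ‖a' - a‖ ≤ ε) (hbb : ‖b' - b‖ ≤ ε) : ‖star a' * b' - star a * b‖ ≤ 3 * ε := by
  have h0 : star a' * b' - star a * b =
      star (a' - a) * (b' - b) + star (a' - a) * b + star a * (b' - b) := by
    rw [star_sub]; ring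
  have hε0 : 0 ≤ ε := (norm_nonneg _).trans haa
  rw [h0]
  refine (norm_add₃_le).trans ?_
  simp only [norm_mul, norm_star]
  have h1 : ‖a' - a‖ * ‖b' - b‖ ≤ ε * 1 :=
    mul_le_mul haa (hbb.trans hε) (norm_nonneg _) hε0
  have h2 : ‖a' - a‖ * ‖b‖ ≤ ε * 1 := mul_le_mul haa hb (norm_nonneg _) hε0
  have h3 : ‖a‖ * ‖b' - b‖ ≤ 1 * ε := mul_le_mul ha hbb (norm_nonneg _) zero_le_one
  linarith

/-- The mean of the integer estimator is close to the value of the Hermitian form. -/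
theorem abs_mean_sampleInt_sub_le (h0 : P 0 = 1) (hP : ∀ k < m, P (k + 1) = H k * P k)
    (hH : ∀ k < m, ∀ (z : Bits n) (f : Bits n → ℂ),
      ∑ d ∈ Finset.range (c + 1), co k d z * f (walkStep row k d z) = ∑ z', H k z' z * f z')
    (hPm : (P m).IsHermitian) {g : ℕ → ℕ → Bits n → GaussianInt} {a : Bits n → GaussianInt}
    (hco : ∀ k d z, ‖co k d z‖ ≤ 1) (hg : ∀ k d z, ‖(g k d z : ℂ) / (2 ^ (e + 1) : ℂ)‖ ≤ 1)
    (hgco : ∀ k d z, ‖(g k d z : ℂ) / (2 ^ (e + 1) : ℂ) - co k d z‖ ≤ 1 / 2 ^ e)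
    {φ : Bits n → ℂ} (hφ : ∀ x, ‖φ x‖ ≤ 1)
    (ha : ∀ x, ‖(a x : ℂ) / (2 ^ e : ℂ) - φ x‖ ≤ 1 / 2 ^ e)
    {D : Bits n → ℝ} (hD0 : ∀ x, 0 ≤ D x) (hD1 : ∑ x, D x = 1)
    (hD : ∑ x, |D x - ‖φ x‖ ^ 2| ≤ 1 / 2 ^ e) :
    |∑ x, D x * ((sampleInt c e row g a m x : ℝ) / 2 ^ e) - (star φ ⬝ᵥ (P m *ᵥ φ)).re| ≤
      (c + 1) ^ m * (2 ^ n * (m + 8)) / 2 ^ e := by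
  set W : ℝ := (c + 1) ^ m with hW
  set ε : ℝ := 1 / 2 ^ e with hεdef
  have hW1 : 1 ≤ W := one_le_pow₀ (by linarith [Nat.cast_nonneg (α := ℝ) c])
  have hε0 : 0 < ε := by positivity
  have hε1 : ε ≤ 1 := div_le_one_of_le₀ (one_le_pow₀ one_le_two) (by positivity)
  set b : Bits n → ℂ := fun x => (a x : ℂ) / (2 ^ e : ℂ) with hb
  -- `R` is formed with the rounded amplitudes `b`. It is never compared with its analogue for `φ`,
  -- since `ratioTerm` does not depend continuously on amplitudes near zero; only the bound `hRW`
  -- and the exact identity for `b` are used.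
  set R : Bits n → ℝ := fun x => ∑ z, ratioTerm (P m z x) (b x) (b z) with hR
  have hRsum : ∀ x, R x = ∑ w ∈ Finset.range ((c + 1) ^ m),
      ratioTerm (walkCoef c row co w x m) (b x) (b (walk c row w x m).2) := fun x =>
    (sum_walk_ratioTerm h0 hP hH b x).symm
  have hRW : ∀ x, |R x| ≤ W := fun x => by
    rw [hRsum]
    refine (Finset.abs_sum_le_sum_abs _ _).trans ((Finset.sum_le_card_nsmul _ _ 1 fun w _ =>
      (abs_ratioTerm_le _ _ _).trans (norm_walkCoef_le c row hco w x m)).trans ?_)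
    simp [hW]
  -- rounding
  have hround : ∀ x, |(sampleInt c e row g a m x : ℝ) / 2 ^ e - R x| ≤ W * (ε + m * ε) := by
    intro x
    rw [hRsum, sampleInt, Int.cast_sum, Finset.sum_div, ← Finset.sum_sub_distrib]
    refine (Finset.abs_sum_le_sum_abs _ _).trans ((Finset.sum_le_card_nsmul _ _ (ε + m * ε)
      fun w _ => ?_).trans ?_)
    · have h1 := abs_ratioInt_sub_le e ((2 ^ (e + 1)) ^ m) (walkCoef c row g w x m) (a x)
        (a (walk c row w x m).2)
      have h2 := norm_walkCoef_sub_le c row hco hg hgco w x m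
      rw [walkCoef_div] at h2
      have h3 : ratioTerm (walkCoef c row co w x m) (b x) (b (walk c row w x m).2) =
          ratioTerm (walkCoef c row co w x m) (a x) (a (walk c row w x m).2) := by
        rw [← ratioTerm_smul (1 / 2 ^ e) (by positivity) _ (a x : ℂ)]
        simp only [hb]
        push_cast
        congr 1 <;> ring
      rw [h3]
      have h4 := (abs_ratioTerm_le (((walkCoef c row g w x m : GaussianInt) : ℂ) / ((2 ^ (e + 1)) ^ m : ℕ) -
        walkCoef c row co w x m) (a x) (a (walk c row w x m).2))
      rw [← ratioTerm_sub] at h4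
      push_cast at h1 h4
      refine (abs_sub_le _ _ _).trans (add_le_add h1 (h4.trans h2))
    · simp [hW, mul_add]
  have e1 : |∑ x, D x * ((sampleInt c e row g a m x : ℝ) / 2 ^ e) - ∑ x, D x * R x| ≤
      W * (ε + m * ε) := by
    rw [← Finset.sum_sub_distrib]
    refine (Finset.abs_sum_le_sum_abs _ _).trans ?_
    calc ∑ x, |D x * ((sampleInt c e row g a m x : ℝ) / 2 ^ e) - D x * R x|
        ≤ ∑ x, D x * (W * (ε + m * ε)) := Finset.sum_le_sum fun x _ => by
          rw [← mul_sub, abs_mul, abs_of_nonneg (hD0 x)]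
          exact mul_le_mul_of_nonneg_left (hround x) (hD0 x)
      _ = _ := by rw [← Finset.sum_mul, hD1, one_mul]
  have e2 : |∑ x, D x * R x - ∑ x, ‖φ x‖ ^ 2 * R x| ≤ ε * W := by
    rw [← Finset.sum_sub_distrib]
    refine (Finset.abs_sum_le_sum_abs _ _).trans ?_
    calc ∑ x, |D x * R x - ‖φ x‖ ^ 2 * R x| ≤ ∑ x, |D x - ‖φ x‖ ^ 2| * W :=
          Finset.sum_le_sum fun x _ => by
            rw [← sub_mul, abs_mul]
            exact mul_le_mul_of_nonneg_left (hRW x) (abs_nonneg _)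
      _ ≤ _ := by rw [← Finset.sum_mul]; exact mul_le_mul_of_nonneg_right hD (by linarith)
  have hcard : (Finset.univ : Finset (Bits n)).card = 2 ^ n := by simp
  -- No summable bound on the rounding errors is available, so each of the `2 ^ n` basis states is
  -- charged separately.
  have e3 : |∑ x, ‖φ x‖ ^ 2 * R x - ∑ x, ‖b x‖ ^ 2 * R x| ≤ 2 ^ n * (3 * ε * W) := by
    rw [← Finset.sum_sub_distrib]
    refine (Finset.abs_sum_le_sum_abs _ _).trans ((Finset.sum_le_card_nsmul _ _ (3 * ε * W)
      fun x _ => ?_).trans ?_)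
    · rw [← sub_mul, abs_mul]
      refine mul_le_mul ?_ (hRW x) (abs_nonneg _) (by positivity)
      have h := norm_star_mul_sub_le hε1 (hφ x) (hφ x) (ha x) (ha x)
      simp only [Complex.star_def] at h
      rw [Complex.conj_mul', Complex.conj_mul', norm_sub_rev]
        at h
      rw [← Real.norm_eq_abs, ← Complex.norm_real]
      push_cast
      exact h
    · rw [hcard]; simp
  -- The average against `|b x|²` is exactly the Hermitian form at `b`. Its distance from the form
  -- at `φ` is expanded over walks, with `W` terms for each `x`.
  have e4 : |∑ x, ‖b x‖ ^ 2 * R x - (star φ ⬝ᵥ (P m *ᵥ φ)).re| ≤ 2 ^ n * (W * (3 * ε)) := by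
    rw [hR, sum_norm_sq_mul_ratioTerm hPm, ← Complex.sub_re]
    have h : star b ⬝ᵥ (P m *ᵥ b) - star φ ⬝ᵥ (P m *ᵥ φ) = ∑ x,
        ∑ w ∈ Finset.range ((c + 1) ^ m), walkCoef c row co w x m *
          (star (b (walk c row w x m).2) * b x - star (φ (walk c row w x m).2) * φ x) := by
      have key := fun x => sum_walkCoef_mul c row h0 hP hH x m le_rfl 1 fun _ z =>
        star (b z) * b x - star (φ z) * φ x
      simp only [mul_one, Finset.sum_range_one] at key
      simp only [key, dotProduct, Matrix.mulVec, Pi.star_apply, Finset.mul_sum]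
      rw [← Finset.sum_sub_distrib]
      simp only [← Finset.sum_sub_distrib]
      rw [Finset.sum_comm]
      exact Finset.sum_congr rfl fun x _ => Finset.sum_congr rfl fun z _ => by ring
    refine (Complex.abs_re_le_norm _).trans ?_
    rw [h]
    refine (norm_sum_le _ _).trans ((Finset.sum_le_card_nsmul _ _ (W * (3 * ε))
      fun x _ => ?_).trans ?_)
    · refine (norm_sum_le _ _).trans ((Finset.sum_le_card_nsmul _ _ (3 * ε)
        fun w _ => ?_).trans ?_)
      · rw [norm_mul]
        have h1 := norm_star_mul_sub_le hε1 (hφ (walk c row w x m).2) (hφ x)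
          (ha (walk c row w x m).2) (ha x)
        have h2 := norm_walkCoef_le c row hco w x m
        calc _ ≤ 1 * (3 * ε) := mul_le_mul h2 h1 (norm_nonneg _) zero_le_one
          _ = _ := one_mul _
      · simp [hW]
    · rw [hcard]; simp
  have h2n : (1 : ℝ) ≤ 2 ^ n := one_le_pow₀ one_le_two
  have hfin : W * (ε + m * ε) + ε * W + 2 ^ n * (3 * ε * W) + 2 ^ n * (W * (3 * ε)) ≤
      W * (2 ^ n * (m + 8)) / 2 ^ e := by
    rw [div_eq_mul_one_div _ ((2 : ℝ) ^ e), ← hεdef]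
    have h1 : W * ε * (m + 2) * 1 ≤ W * ε * (m + 2) * 2 ^ n :=
      mul_le_mul_of_nonneg_left h2n (by positivity)
    linarith
  refine le_trans ?_ hfin
  rw [abs_le] at *
  constructor <;> linarith [e1.1, e1.2, e2.1, e2.2, e3.1, e3.2, e4.1, e4.2]

end Estimator

/-! ### Coin flips -/

section Coins

open Classical in
theorem coinProb_mono {k : ℕ} {E F : Bits k → Prop} (h : ∀ r, E r → F r) :
    coinProb E ≤ coinProb F := by
  unfold coinProb
  gcongr with r
  exact h r

theorem coinProb_nonneg {k : ℕ} (E : Bits k → Prop) : 0 ≤ coinProb E := by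
  unfold coinProb; positivity

theorem coinProb_not {k : ℕ} (E : Bits k → Prop) : coinProb (fun r => ¬ E r) = 1 - coinProb E := by
  classical
  unfold coinProb
  have h := Finset.card_filter_add_card_filter_not (s := (Finset.univ : Finset (Bits k))) E
  have h' : ((Finset.univ.filter E).card : ℝ) + (Finset.univ.filter fun r => ¬ E r).card = 2 ^ k := by
    rw [← Nat.cast_add, h]; simp
  rw [eq_sub_iff_add_eq, ← add_div, add_comm, div_eq_one_iff_eq (by positivity)]
  convert h'

theorem coinProb_exists_le {k : ℕ} {ι : Type*} (s : Finset ι) (E : ι → Bits k → Prop) :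
    coinProb (fun r => ∃ i ∈ s, E i r) ≤ ∑ i ∈ s, coinProb (E i) := by
  classical
  unfold coinProb
  rw [← Finset.sum_div]
  gcongr
  norm_cast
  refine (Finset.card_le_card fun r hr => ?_).trans (Finset.card_biUnion_le (s := s)
    (t := fun i => Finset.univ.filter (E i)))
  simpa using hr

theorem sum_coinProb_mul {k : ℕ} {β : Type*} [Fintype β] (F : Bits k → β) (g : β → ℝ) :
    ∑ b, coinProb (fun r => F r = b) * g b = (∑ r, g (F r)) / 2 ^ k := by
  classical
  unfold coinProb
  simp only [div_mul_eq_mul_div]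
  rw [← Finset.sum_div, ← Finset.sum_fiberwise (s := Finset.univ) (g := F) (f := fun r => g (F r))]
  congr 1
  refine Finset.sum_congr rfl fun b _ => ?_
  rw [Finset.sum_congr rfl (g := fun _ => g b) (fun r hr => by rw [(Finset.mem_filter.1 hr).2])]
  rw [Finset.sum_const, nsmul_eq_mul]

theorem sum_coinProb {k : ℕ} {β : Type*} [Fintype β] (F : Bits k → β) :
    ∑ b, coinProb (fun r => F r = b) = 1 := by
  simpa using sum_coinProb_mul F fun _ => 1

/-- The first coins. -/
def coinsFst {l k j : ℕ} (h : l = k + j) (r : Bits l) : Bits k :=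
  fun i => r (Fin.cast h.symm (Fin.castAdd j i))

/-- The last coins. -/
def coinsSnd {l k j : ℕ} (h : l = k + j) (r : Bits l) : Bits j :=
  fun i => r (Fin.cast h.symm (Fin.natAdd k i))

theorem coinProb_split {l k j : ℕ} (h : l = k + j) (E : Bits k → Bits j → Prop) :
    coinProb (fun r : Bits l => E (coinsFst h r) (coinsSnd h r)) =
      (∑ r, coinProb (E r)) / 2 ^ k := by
  classical
  subst h
  unfold coinProb
  rw [← Finset.sum_div, pow_add, div_div, mul_comm ((2 : ℝ) ^ j)]
  congr 1
  norm_cast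
  rw [← Finset.card_sigma]
  refine Finset.card_bij' (fun r _ => ⟨coinsFst rfl r, coinsSnd rfl r⟩)
    (fun p _ => Fin.append p.1 p.2) ?_ ?_ ?_ ?_
  · intro r hr; simpa using hr
  · rintro ⟨r, s⟩ hr
    have h1 : coinsFst rfl (Fin.append r s) = r := by ext i; simp [coinsFst]
    have h2 : coinsSnd rfl (Fin.append r s) = s := by ext i; simp [coinsSnd]
    simpa [h1, h2] using hr
  · intro r _
    exact Fin.append_castAdd_natAdd
  · rintro ⟨r, s⟩ _
    have h1 : coinsFst rfl (Fin.append r s) = r := by ext i; simp [coinsFst]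
    have h2 : coinsSnd rfl (Fin.append r s) = s := by ext i; simp [coinsSnd]
    simp [h1, h2]

/-- Block number `k` of a string of coins. -/
def coinsBlock {l K L : ℕ} (h : l = K * L) (r : Bits l) (k : Fin K) : Bits L :=
  fun i => r (Fin.cast h.symm (finProdFinEquiv (k, i)))

open Classical in
theorem coinProb_block {l K L : ℕ} (h : l = K * L) (E : (Fin K → Bits L) → Prop) :
    coinProb (fun r : Bits l => E (coinsBlock h r)) =
      ((Finset.univ.filter E).card : ℝ) / (2 ^ L) ^ K := by
  subst h
  unfold coinProb
  rw [← pow_mul, mul_comm L]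
  congr 2
  refine Finset.card_bij' (fun r _ => coinsBlock rfl r)
    (fun w _ i => w (finProdFinEquiv.symm i).1 (finProdFinEquiv.symm i).2) ?_ ?_ ?_ ?_
  · intro r hr; simpa using hr
  · intro w hw
    have : coinsBlock rfl (fun i => w (finProdFinEquiv.symm i).1 (finProdFinEquiv.symm i).2) = w := by
      ext k i; simp [coinsBlock]
    simpa only [Finset.mem_filter, Finset.mem_univ, true_and, this] using hw
  · intro r _
    ext i
    simp only [coinsBlock, Prod.mk.eta, Equiv.apply_symm_apply, Fin.cast_refl, id]
  · intro w _
    ext k i; simp [coinsBlock]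

end Coins

/-! ### Concentration of averages over independent samples -/

section Hoeffding

variable {Ω : Type*} [Fintype Ω]

/-- Hoeffding's lemma: by convexity the exponential lies below its chord on `[-b, b]`. The linear
part of the chord sums to zero, which leaves `cosh t ≤ exp (t² / 2)`. -/
theorem sum_exp_le_of_sum_eq_zero {Y : Ω → ℝ} {b : ℝ} (hb : 0 < b) (hY : ∀ w, |Y w| ≤ b)
    (h0 : ∑ w, Y w = 0) (s : ℝ) :
    ∑ w, Real.exp (s * Y w) ≤ Fintype.card Ω * Real.exp ((s * b) ^ 2 / 2) := by
  have h : ∀ w, Real.exp (s * Y w) ≤ Real.cosh (s * b) + Y w / b * Real.sinh (s * b) := by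
    intro w
    have h1 : |Y w / b| ≤ 1 := by rw [abs_div, abs_of_pos hb]; exact div_le_one_of_le₀ (hY w) hb.le
    have h2 := Real.exp_mul_le_cosh_add_mul_sinh h1 (s * b)
    rwa [show Y w / b * (s * b) = s * Y w by field_simp] at h2
  refine (Finset.sum_le_sum fun w _ => h w).trans ?_
  rw [Finset.sum_add_distrib, ← Finset.sum_mul, ← Finset.sum_div, h0]
  simp only [Finset.sum_const, Finset.card_univ, nsmul_eq_mul, zero_div, zero_mul, add_zero]
  gcongr
  exact Real.cosh_le_exp_half_sq _

open Classical in
-- Chernoff's method: the indicator of the event is bounded by an exponential, whose sum over all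
-- `K`-tuples factors.
theorem card_le_sum_of_bounded {Y : Ω → ℝ} {b δ : ℝ} (hb : 0 < b) (hδ : 0 ≤ δ)
    (hY : ∀ w, |Y w| ≤ b) (h0 : ∑ w, Y w = 0) (K : ℕ) :
    ((Finset.univ.filter fun w : Fin K → Ω => K * δ ≤ ∑ k, Y (w k)).card : ℝ) ≤
      (Fintype.card Ω : ℝ) ^ K * Real.exp (-(K * δ ^ 2 / (2 * b ^ 2))) := by
  -- This value minimizes the exponent `-sδ + s²b² / 2`.
  set s : ℝ := δ / b ^ 2 with hs
  have hs0 : 0 ≤ s := by positivity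
  have h1 : ((Finset.univ.filter fun w : Fin K → Ω => K * δ ≤ ∑ k, Y (w k)).card : ℝ) ≤
      ∑ w : Fin K → Ω, Real.exp (-(s * (K * δ))) * ∏ k, Real.exp (s * Y (w k)) := by
    rw [Finset.card_filter]
    push_cast
    refine Finset.sum_le_sum fun w _ => ?_
    rw [← Real.exp_sum, ← Real.exp_add, ← Finset.mul_sum]
    split_ifs with h
    · apply Real.one_le_exp
      nlinarith [mul_le_mul_of_nonneg_left h hs0]
    · exact (Real.exp_pos _).le
  refine h1.trans ?_
  rw [← Finset.mul_sum, ← Fintype.sum_pow (fun w => Real.exp (s * Y w))]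
  have h2 := sum_exp_le_of_sum_eq_zero hb hY h0 s
  have h3 : (∑ w, Real.exp (s * Y w)) ^ K ≤
      (Fintype.card Ω * Real.exp ((s * b) ^ 2 / 2)) ^ K :=
    pow_le_pow_left₀ (Finset.sum_nonneg fun w _ => (Real.exp_pos _).le) h2 K
  calc Real.exp (-(s * (K * δ))) * (∑ w, Real.exp (s * Y w)) ^ K
      ≤ Real.exp (-(s * (K * δ))) * (Fintype.card Ω * Real.exp ((s * b) ^ 2 / 2)) ^ K := by gcongr
    _ = _ := by
      rw [mul_pow, mul_left_comm, ← Real.exp_nat_mul, ← Real.exp_add]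
      congr 2
      rw [hs]; field_simp; ring

open Classical in
/-- Hoeffding's inequality for independent uniform samples from a finite type. -/
theorem card_abs_avg_sub_mean_le [Nonempty Ω] {X : Ω → ℝ} {b δ μ : ℝ} (hb : 0 < b) (hδ : 0 ≤ δ)
    (hX : ∀ w, |X w| ≤ b) (hμ : (∑ w, X w) / Fintype.card Ω = μ) {K : ℕ} (hK : 0 < K) :
    ((Finset.univ.filter fun w : Fin K → Ω => δ < |(∑ k, X (w k)) / K - μ|).card : ℝ) ≤
      (Fintype.card Ω : ℝ) ^ K * (2 * Real.exp (-(K * δ ^ 2 / (8 * b ^ 2)))) := by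
  have hΩ : (0 : ℝ) < Fintype.card Ω := by exact_mod_cast Fintype.card_pos
  have hK' : (0 : ℝ) < K := by exact_mod_cast hK
  have hμb : |μ| ≤ b := by
    rw [← hμ, abs_div, abs_of_pos hΩ, div_le_iff₀ hΩ]
    refine (Finset.abs_sum_le_sum_abs _ _).trans ((Finset.sum_le_card_nsmul _ _ b
      fun w _ => hX w).trans ?_)
    simp [mul_comm]
  have hsum : ∑ w, (X w - μ) = 0 := by
    rw [Finset.sum_sub_distrib, ← hμ]
    simp only [Finset.sum_const, Finset.card_univ, nsmul_eq_mul]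
    field_simp; ring
  have hsum' : ∑ w, (μ - X w) = 0 := by
    rw [← neg_zero, ← hsum, ← Finset.sum_neg_distrib]; simp
  -- Centering doubles the bound, which turns `2 b ^ 2` into `8 b ^ 2`.
  have hbd : ∀ w, |X w - μ| ≤ 2 * b := fun w =>
    (abs_sub _ _).trans (by linarith [hX w])
  have h1 := card_le_sum_of_bounded (by positivity : 0 < 2 * b) hδ hbd hsum K
  have h2 := card_le_sum_of_bounded (by positivity : 0 < 2 * b) hδ
    (fun w => by rw [abs_sub_comm]; exact hbd w) hsum' K
  rw [show 2 * (2 * b) ^ 2 = 8 * b ^ 2 by ring] at h1 h2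
  have hsub : (Finset.univ.filter fun w : Fin K → Ω => δ < |(∑ k, X (w k)) / K - μ|) ⊆
      (Finset.univ.filter fun w : Fin K → Ω => K * δ ≤ ∑ k, (X (w k) - μ)) ∪
      (Finset.univ.filter fun w : Fin K → Ω => K * δ ≤ ∑ k, (μ - X (w k))) := by
    intro w hw
    simp only [Finset.mem_filter, Finset.mem_univ, true_and, Finset.mem_union,
      Finset.sum_sub_distrib, Finset.sum_const, Finset.card_univ, Fintype.card_fin,
      nsmul_eq_mul] at hw ⊢
    have h3 : (∑ k, X (w k)) = K * ((∑ k, X (w k)) / K) := by field_simp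
    rw [h3, ← mul_sub, ← mul_sub]
    rcases lt_abs.1 hw with h | h
    · left; exact mul_le_mul_of_nonneg_left h.le hK'.le
    · right; exact mul_le_mul_of_nonneg_left (by linarith) hK'.le
  have h4 := (Finset.card_le_card hsub).trans (Finset.card_union_le _ _)
  have h5 : ((Finset.univ.filter fun w : Fin K → Ω => δ < |(∑ k, X (w k)) / K - μ|).card : ℝ) ≤
    ((Finset.univ.filter fun w : Fin K → Ω => K * δ ≤ ∑ k, (X (w k) - μ)).card : ℝ) +
    ((Finset.univ.filter fun w : Fin K → Ω => K * δ ≤ ∑ k, (μ - X (w k))).card : ℝ) := by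
    exact_mod_cast h4
  linarith

end Hoeffding

/-! ### Binary numbers -/

section Binary

/-- Bit strings as binary numbers, least significant bit first. -/
def bitsEquiv (n : ℕ) : Bits n ≃ Fin (2 ^ n) :=
  (Equiv.arrowCongr (Equiv.refl _) finTwoEquiv.symm).trans finFunctionFinEquiv

theorem bitsEquiv_val {n : ℕ} (x : Bits n) :
    (bitsEquiv n x : ℕ) = ∑ i : Fin n, (if x i then 1 else 0) * 2 ^ i.1 := by
  rw [bitsEquiv, Equiv.trans_apply, finFunctionFinEquiv_apply]
  refine Finset.sum_congr rfl fun i _ => ?_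
  simp only [Equiv.arrowCongr_apply, Function.comp_apply, Equiv.refl_symm, Equiv.refl_apply]
  cases x i <;> simp [finTwoEquiv]

theorem bitsEquiv_symm_apply {n : ℕ} (j : Fin (2 ^ n)) (i : Fin n) :
    (bitsEquiv n).symm j i = decide (1 ≤ j.1 / 2 ^ i.1 % 2) := by
  rcases Nat.mod_two_eq_zero_or_one (j.1 / 2 ^ i.1) with h | h <;>
    simp [bitsEquiv, Equiv.arrowCongr, finFunctionFinEquiv, h, finTwoEquiv]

theorem sum_bit_mul_two_pow {b c : ℕ} (hc : c < 2 ^ b) :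
    ∑ t ∈ Finset.range b, (if 1 ≤ c / 2 ^ t % 2 then 1 else 0) * 2 ^ t = c := by
  have h := bitsEquiv_val ((bitsEquiv b).symm ⟨c, hc⟩)
  simp only [Equiv.apply_symm_apply, bitsEquiv_symm_apply, decide_eq_true_eq] at h
  rw [Finset.sum_range]
  exact h.symm

end Binary

/-! ### Sampling from a table of weights -/

section Table

/-- The index selected by the number `u` in the table of weights `c` with `M` entries. -/
def tableIndex (c : ℕ → ℕ) (M u : ℕ) : ℕ :=
  ∑ j ∈ Finset.range (M - 1), if ∑ i ∈ Finset.range (j + 1), c i ≤ u then 1 else 0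

variable {c : ℕ → ℕ} {M : ℕ}

/-- Only `M - 1` thresholds are counted, so numbers beyond the total weight select the last entry
and the weights need not add up to a prescribed total. -/
theorem tableIndex_lt (hM : 0 < M) (u : ℕ) : tableIndex c M u < M := by
  rw [tableIndex, Finset.sum_boole, Nat.cast_id]
  have := (Finset.card_filter_le (Finset.range (M - 1))
    fun j => ∑ i ∈ Finset.range (j + 1), c i ≤ u)
  rw [Finset.card_range] at this
  omega

theorem tableIndex_eq {u j : ℕ} (hj : j < M) (h1 : ∑ i ∈ Finset.range j, c i ≤ u)
    (h2 : u < ∑ i ∈ Finset.range (j + 1), c i) : tableIndex c M u = j := by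
  have hmono : Monotone fun k => ∑ i ∈ Finset.range k, c i := fun a b hab =>
    Finset.sum_le_sum_of_subset (Finset.range_mono hab)
  rw [tableIndex, Finset.sum_boole, Nat.cast_id]
  have : (Finset.range (M - 1)).filter (fun k => ∑ i ∈ Finset.range (k + 1), c i ≤ u) =
      Finset.range j := by
    ext k
    simp only [Finset.mem_filter, Finset.mem_range]
    refine ⟨fun h => ?_, fun h => ⟨by omega, (hmono (by omega : k + 1 ≤ j)).trans h1⟩⟩
    by_contra hk
    have h3 := hmono (by omega : j + 1 ≤ k + 1)
    simp only at h3
    omega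
  rw [this, Finset.card_range]

theorem exists_table_interval {u : ℕ} (h : u < ∑ i ∈ Finset.range M, c i) :
    ∃ j < M, ∑ i ∈ Finset.range j, c i ≤ u ∧ u < ∑ i ∈ Finset.range (j + 1), c i := by
  induction M with
  | zero => simp at h
  | succ M ih =>
    by_cases h1 : u < ∑ i ∈ Finset.range M, c i
    · obtain ⟨j, hj, h2⟩ := ih h1
      exact ⟨j, by omega, h2⟩
    · exact ⟨M, by omega, by omega, h⟩

/-- The positive and negative parts of `p - q` have equal mass, so a one-sided bound controls the
whole distance. -/
theorem sum_abs_sub_le_of_forall_sub_le {ι : Type*} [Fintype ι] {p q : ι → ℝ} {δ : ℝ}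
    (hpq : ∑ i, p i = ∑ i, q i) (hδ : 0 ≤ δ) (h : ∀ i, q i - p i ≤ δ) :
    ∑ i, |p i - q i| ≤ 2 * (Fintype.card ι * δ) := by
  have h1 : ∀ i, |p i - q i| ≤ 2 * δ + (p i - q i) := fun i => by
    rw [abs_le]; constructor <;> linarith [h i]
  refine (Finset.sum_le_sum fun i _ => h1 i).trans ?_
  rw [Finset.sum_add_distrib, Finset.sum_sub_distrib, hpq]
  simp only [Finset.sum_const, Finset.card_univ, nsmul_eq_mul]
  linarith

/-- If the weights add up to at least `N`, no index is selected by more numbers than its weight;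
otherwise none by fewer. In both cases the one-sided comparison applies. -/
theorem sum_abs_sub_table_le {p : Fin M → ℝ} (hp : ∑ j, p j = 1)
    {N : ℕ} (hN : 0 < N) {δ : ℝ} (hδ : 0 ≤ δ) (hc : ∀ j : Fin M, |(c j : ℝ) / N - p j| ≤ δ) :
    ∑ j : Fin M, |p j - (((Finset.range N).filter fun u => tableIndex c M u = j).card : ℝ) / N| ≤
      2 * (M * δ) := by
  have hN' : (0 : ℝ) < N := by exact_mod_cast hN
  have hM : 0 < M := by
    rcases Nat.eq_zero_or_pos M with rfl | h
    · simp at hp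
    · exact h
  have hq : ∑ j : Fin M, (((Finset.range N).filter fun u => tableIndex c M u = j).card : ℝ) / N =
      1 := by
    rw [← Finset.sum_div, div_eq_one_iff_eq hN'.ne']
    norm_cast
    rw [← Finset.sum_range fun j => ((Finset.range N).filter fun u => tableIndex c M u = j).card,
      ← Finset.card_eq_sum_card_fiberwise, Finset.card_range]
    exact fun u _ => by simpa using tableIndex_lt hM u
  have hIco : ∀ j, (Finset.Ico (∑ i ∈ Finset.range j, c i)
      (∑ i ∈ Finset.range (j + 1), c i)).card = c j := fun j => by
    rw [Nat.card_Ico, Finset.sum_range_succ]; omega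
  rcases le_or_gt N (∑ i ∈ Finset.range M, c i) with hcase | hcase
  · have := sum_abs_sub_le_of_forall_sub_le (hp.trans hq.symm) hδ fun j => ?_
    · simpa using this
    have h1 : ((Finset.range N).filter fun u => tableIndex c M u = j).card ≤ c j := by
      rw [← hIco j]
      refine Finset.card_le_card fun u hu => ?_
      simp only [Finset.mem_filter, Finset.mem_range] at hu
      obtain ⟨k, hk, hk1, hk2⟩ := exists_table_interval (hu.1.trans_le hcase)
      obtain rfl : k = j := (tableIndex_eq hk hk1 hk2).symm.trans hu.2
      exact Finset.mem_Ico.2 ⟨hk1, hk2⟩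
    have h2 : (((Finset.range N).filter fun u => tableIndex c M u = j).card : ℝ) / N ≤ c j / N := by
      gcongr
    linarith [(abs_le.1 (hc j)).2]
  · have := sum_abs_sub_le_of_forall_sub_le (hq.trans hp.symm) hδ fun j => ?_
    · simp only [abs_sub_comm] at this ⊢
      simpa using this
    have h1 : c j ≤ ((Finset.range N).filter fun u => tableIndex c M u = j).card := by
      rw [← hIco j]
      refine Finset.card_le_card fun u hu => ?_
      rw [Finset.mem_Ico] at hu
      simp only [Finset.mem_filter, Finset.mem_range]
      refine ⟨hu.2.trans_le ((Finset.sum_le_sum_of_subset (Finset.range_mono j.2)).trans hcase.le),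
        tableIndex_eq j.2 hu.1 hu.2⟩
    have h2 : (c j : ℝ) / N ≤
        (((Finset.range N).filter fun u => tableIndex c M u = j).card : ℝ) / N := by gcongr
    linarith [(abs_le.1 (hc j)).1]

/-- Sampling with binary weights and coins. -/
theorem sum_abs_sub_coinProb_table_le {m b : ℕ} {p : Bits m → ℝ} (hp : ∑ y, p y = 1) {δ : ℝ}
    (hδ : 0 ≤ δ) (hc : ∀ j : Fin (2 ^ m), |(c j : ℝ) / 2 ^ b - p ((bitsEquiv m).symm j)| ≤ δ) :
    ∑ y, |p y - coinProb fun r : Bits b => (bitsEquiv m).symm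
      ⟨tableIndex c (2 ^ m) (bitsEquiv b r), tableIndex_lt (by positivity) _⟩ = y| ≤
      2 * (2 ^ m * δ) := by
  classical
  have h := sum_abs_sub_table_le (c := c) (p := fun j => p ((bitsEquiv m).symm j))
    (by rw [Equiv.sum_comp, hp]) (N := 2 ^ b) (by positivity) hδ (by simpa using hc)
  push_cast at h
  rw [← Equiv.sum_comp (bitsEquiv m)] at h
  refine le_of_eq_of_le (Finset.sum_congr rfl fun y _ => ?_) h
  rw [Equiv.symm_apply_apply]
  congr 2
  unfold coinProb
  congr 2
  refine Finset.card_bij' (fun r _ => (bitsEquiv b r : ℕ))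
    (fun u hu => (bitsEquiv b).symm ⟨u, by simpa using (Finset.mem_filter.1 hu).1⟩) ?_ ?_ ?_ ?_
  · intro r hr
    simp only [Finset.mem_filter, Finset.mem_univ, true_and, Equiv.symm_apply_eq] at hr
    simp [← hr]
  · intro u hu
    simp only [Finset.mem_filter, Finset.mem_univ, true_and, Equiv.symm_apply_eq] at hu ⊢
    simp [hu.2]
  · intro r _; simp
  · intro u _; simp

end Table

/-! ### More closure properties -/

namespace PolyComp

variable {ι : Type} {N : ι → ℕ} {e x : ι → Val}

open Val (int)

/-- Tabulation of a function, as an encoded function. -/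
theorem toValFun {α : ι → Type} [∀ i, ToVal (α i)] {K : ι → ℕ} {v : ∀ i, Fin (K i) → α i}
    (hKb : PolyBdd N K) (hK : PolyComp N e fun i => int (K i))
    (hv : PolyComp (fun j : Below K => N j.1.1) (fun j => .pair (e j.1.1) (int j.1.2))
      fun j => ToVal.toVal (v j.1.1 ⟨j.1.2, j.2⟩)) :
    PolyComp N e fun i => ToVal.toVal (v i) := by
  refine (ofFn hKb hK (f := fun i k => if h : k < K i then ToVal.toVal (v i ⟨k, h⟩) else int 0)
    (hv.congr fun j => by rw [dif_pos j.2])).congr fun i => ?_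
  simp [ToVal.toVal, List.map_ofFn, Function.comp_def]

/-- The entry of a bit string at a position, `false` beyond its end. -/
def _root_.bitAt {k : ℕ} (d : Bits k) (p : ℕ) : Bool := if h : p < k then d ⟨p, h⟩ else false

theorem toVal_bitAt {k : ℕ} (d : Bits k) (p : ℕ) :
    (Val.snd^[p] (ToVal.toVal d)).fst = ToVal.toVal (bitAt d p) := by
  by_cases h : p < k
  · rw [bitAt, dif_pos h]; exact toVal_fun_drop d ⟨p, h⟩
  · rw [bitAt, dif_neg h]
    change (Val.snd^[p] (Val.ofList ((List.ofFn d).map ToVal.toVal))).fst = _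
    rw [Val.iterate_snd_ofList, List.drop_eq_nil_of_le (by simpa using h)]
    rfl

theorem bitAt {k p : ι → ℕ} {d : ∀ i, Bits (k i)} (hd : PolyComp N e fun i => ToVal.toVal (d i))
    (hpb : PolyBdd N p) (hp : PolyComp N e fun i => int (p i)) :
    PolyComp N e fun i => ToVal.toVal (_root_.bitAt (d i) (p i)) :=
  (hd.drop hpb hp).fst'.congr fun i => toVal_bitAt _ _

theorem boolToNat {b : ι → Bool} (hb : PolyComp N e fun i => ToVal.toVal (b i)) :
    PolyComp N e fun i => int ((if b i then 1 else 0 : ℕ) : ℕ) :=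
  hb.congr fun i => by cases h : b i <;> simp [ToVal.toVal]

theorem natLe {k l : ι → ℕ} (hk : PolyComp N e fun i => int (k i))
    (hl : PolyComp N e fun i => int (l i)) :
    PolyComp N e fun i => ToVal.toVal (decide (k i ≤ l i)) :=
  (hk.le hl).congr fun i => by simp

/-- The length of a list. -/
theorem length {α : ι → Type} [∀ i, ToVal (α i)] {m : ι → ℕ} {v : ∀ i, Fin (m i) → α i}
    (hn : PolyComp N e fun i => int (N i)) (hm : ∀ i, m i ≤ N i)
    (hv : PolyComp N e fun i => ToVal.toVal (v i)) : PolyComp N e fun i => int (m i) := by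
  -- The number of `k < N i` for which the `k`-th tail is still a pair. In this way `m` is recovered
  -- from the list `Q`, without a program for `m`.
  refine (natSum (f := fun i k => if k < m i then 1 else 0) .self hn
    ((((hv.inBelow .self).drop ?_ (counter hn.1 .self)).isPair).congr fun j => ?_)).congr
    fun i => ?_
  · exact (PolyBdd.self (N := N).reindex fun j : Below N => j.1.1).mono fun j => j.2.le
  · change (Val.snd^[j.1.2] (Val.ofList ((List.ofFn (v j.1.1)).map ToVal.toVal))).isPair = _
    rw [Val.iterate_snd_ofList]
    by_cases h : j.1.2 < m j.1.1
    · rw [List.drop_eq_getElem_cons (by simpa using h)]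
      simp [Val.ofList, Val.isPair, h]
    · rw [List.drop_eq_nil_of_le (by simpa using h)]
      simp [Val.ofList, Val.isPair, h]
  · have : (Finset.range (N i)).filter (fun k => k < m i) = Finset.range (m i) := by
      ext k
      simp only [Finset.mem_filter, Finset.mem_range]
      have := hm i
      omega
    rw [Finset.sum_boole, this]
    simp

/-- Both components of a Gaussian integer are computable. -/
def Gauss (N : ι → ℕ) (e : ι → Val) (g : ι → GaussianInt) : Prop :=
  PolyComp N e (fun i => int (g i).re) ∧ PolyComp N e fun i => int (g i).im

theorem Gauss.mul {g h : ι → GaussianInt} (hg : Gauss N e g) (hh : Gauss N e h) :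
    Gauss N e fun i => g i * h i :=
  ⟨((hg.1.mul hh.1).sub (hg.2.mul hh.2)).congr fun i => by
      simp [Zsqrtd.re_mul]; ring,
    ((hg.1.mul hh.2).add (hg.2.mul hh.1)).congr fun i => by simp [Zsqrtd.im_mul]⟩

theorem Gauss.norm {g : ι → GaussianInt} (hg : Gauss N e g) :
    PolyComp N e fun i => int (g i).norm :=
  ((hg.1.mul hg.1).add (hg.2.mul hg.2)).congr fun i => by simp [Zsqrtd.norm_def]

theorem Gauss.ofPair {p : ι → ℤ × ℤ} (hp : PolyComp N e fun i => ToVal.toVal (p i)) :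
    Gauss N e fun i => ⟨(p i).1, (p i).2⟩ :=
  ⟨hp.fst', hp.snd'⟩

theorem ratioInt {k D : ι → ℕ} {P u v : ι → GaussianInt} (hkb : PolyBdd N k)
    (hk : PolyComp N e fun i => int (k i)) (hD : PolyComp N e fun i => int (D i))
    (hP : Gauss N e P) (hu : Gauss N e u) (hv : Gauss N e v) :
    PolyComp N e fun i => int (ratioInt (k i) (D i) (P i) (u i) (v i)) := by
  have hs : Gauss N e fun i => star (v i) :=
    ⟨hv.1, ((const hk.1 (int 0)).sub hv.2).congr fun i => by simp⟩
  exact ((((const hk.1 (int 2)).mul ((hs.mul hP).mul hu).1).mul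
    ((natConst hk.1 2).natPow hkb hk)).div ((hu.norm.add hv.norm).mul hD)).congr fun i => by
      simp [_root_.ratioInt]

end PolyComp

theorem size_toVal_intPair_le {p : ℤ × ℤ} {B : ℕ} (h1 : p.1.natAbs ≤ 2 ^ B)
    (h2 : p.2.natAbs ≤ 2 ^ B) : (ToVal.toVal p).size ≤ 2 * B + 5 := by
  have h3 := Val.size_int_le h1
  have h4 := Val.size_int_le h2
  simp only [ToVal.toVal, Val.size] at h3 h4 ⊢
  omega

theorem natAbs_le_of_norm_le {g : GaussianInt} {B : ℕ} (h : ‖(g : ℂ)‖ ≤ 2 ^ B) :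
    g.re.natAbs ≤ 2 ^ B ∧ g.im.natAbs ≤ 2 ^ B := by
  have h1 := (Complex.abs_re_le_norm (g : ℂ)).trans h
  have h2 := (Complex.abs_im_le_norm (g : ℂ)).trans h
  rw [← GaussianInt.intCast_re, ← Int.cast_abs, Int.abs_eq_natAbs] at h1
  rw [← GaussianInt.intCast_im, ← Int.cast_abs, Int.abs_eq_natAbs] at h2
  exact ⟨by exact_mod_cast h1, by exact_mod_cast h2⟩

/-! ### The steps of the walks -/

section Steps

/-- Row indices of the entries used in step `k`. -/
def rowFun {n m s : ℕ} (Q : Fin m → Fin n) (row : Fin n × Fin s × Bits n → Bits n) (k l : ℕ)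
    (z : Bits n) : Bits n :=
  if h : k < m ∧ l < s then row (Q ⟨k, h.1⟩, ⟨l, h.2⟩, z) else z

/-- Coefficients of step `k`: `u` for staying, and the entries with the sign given by bit number
`k` of `j` otherwise. -/
def coefFun {R : Type*} [Ring R] {n m s : ℕ} (Q : Fin m → Fin n) (u : R)
    (ent : Fin n × Fin s × Bits n → R) (j k d : ℕ) (z : Bits n) : R :=
  if d = 0 then u else if h : k < m ∧ d - 1 < s then
    ((1 - 2 * ((j / 2 ^ k % 2 : ℕ) : ℤ) : ℤ) : R) * ent (Q ⟨k, h.1⟩, ⟨d - 1, h.2⟩, z) else 0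

end Steps

section Estimate

variable {m : ℕ → ℕ} {Q : ∀ n, Fin (m n) → Fin n} {c : ℕ}
  {row : ∀ n, Fin n × Fin ((Polynomial.C c).eval n) × Bits n → Bits n}
  {ent : ∀ n, Fin n × Fin ((Polynomial.C c).eval n) × Bits n → ℤ × ℤ}
  {amp : ∀ n, Bits n → ℤ × ℤ} {E : Polynomial ℕ}

/-- The integer matrix entries of step `k`, in units of `2 ^ (-(E(n) + 1))`. -/
noncomputable def stepCoef (Q : ∀ n, Fin (m n) → Fin n)
    (ent : ∀ n, Fin n × Fin ((Polynomial.C c).eval n) × Bits n → ℤ × ℤ) (E : Polynomial ℕ)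
    (n j : ℕ) : ℕ → ℕ → Bits n → GaussianInt :=
  coefFun (Q n) (2 ^ E.eval n) (fun a => ⟨(ent n a).1, (ent n a).2⟩) j

variable {ι : Type} {N : ι → ℕ} {e : ι → Val} {j w : ι → ℕ} {x : ∀ i, Bits (N i)}

open Val (int)
open PolyComp (Gauss)

theorem polyComp_list (hQ : PolyTime fun n (_ : Unit) => Q n) (hmn : ∀ n, 1 ≤ n → m n ≤ n)
    (hN : ∀ i, 1 ≤ N i) (hn : PolyComp N e fun i => int (N i)) :
    PolyComp N e fun i => ToVal.toVal (Q (N i)) := by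
  refine PolyComp.ofPolyTime hQ hN (a := fun _ => ()) hn (PolyComp.const hn.1 (int 0)) ?_
  refine ((PolyBdd.const 1).add (PolyBdd.self.mul (PolyBdd.self.add (.const 3)))).mono fun i => ?_
  refine (Val.size_ofList_le (B := N i + 2) fun v hv => ?_).trans ?_
  · obtain ⟨q, -, rfl⟩ := List.mem_map.1 hv
    exact Val.size_int_le (by simpa using q.2.le.trans Nat.lt_two_pow_self.le)
  · simp only [List.length_map, List.length_ofFn]
    have := hmn _ (hN i)
    gcongr

/-- The loop state consists of the unread digits, the position and the Gaussian integer accumulated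
so far. Its size stays polynomial: the digits only shrink, and by `hg` the product after `k` steps
has norm at most `2 ^ ((E + 1) k)`. -/
theorem polyComp_walk (hQ : PolyTime fun n (_ : Unit) => Q n) (hmn : ∀ n, 1 ≤ n → m n ≤ n)
    (hrow : PolyTime row) (hent : PolyTime ent)
    (hentb : ∀ n, 1 ≤ n → ∀ a, (ent n a).1.natAbs ≤ 2 ^ (E.eval n + 1) ∧
      (ent n a).2.natAbs ≤ 2 ^ (E.eval n + 1))
    (hg : ∀ n, 1 ≤ n → ∀ j k d z, ‖(stepCoef Q ent E n j k d z : ℂ) / (2 ^ (E.eval n + 1) : ℂ)‖ ≤ 1)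
    (hN : ∀ i, 1 ≤ N i) (hn : PolyComp N e fun i => int (N i))
    (hj : PolyComp N e fun i => int (j i)) (hw : PolyComp N e fun i => int (w i))
    (hx : PolyComp N e fun i => ToVal.toVal (x i)) :
    PolyComp N e (fun i => ToVal.toVal
      (walk c (rowFun (Q (N i)) (row (N i))) (w i) (x i) (m (N i))).2) ∧
    Gauss N e fun i => walkCoef c (rowFun (Q (N i)) (row (N i)))
      (stepCoef Q ent E (N i) (j i)) (w i) (x i) (m (N i)) := by
  have hmb : PolyBdd N fun i => m (N i) := PolyBdd.self.mono fun i => hmn _ (hN i)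
  have hl := polyComp_list hQ hmn hN hn
  have hm := PolyComp.length hn (fun i => hmn _ (hN i)) hl
  let s : ι → ℕ → Val := fun i k =>
    .pair (int (walk c (rowFun (Q (N i)) (row (N i))) (w i) (x i) k).1)
      (.pair (ToVal.toVal (walk c (rowFun (Q (N i)) (row (N i))) (w i) (x i) k).2)
        (.pair (int (walkCoef c (rowFun (Q (N i)) (row (N i)))
          (stepCoef Q ent E (N i) (j i)) (w i) (x i) k).re)
          (int (walkCoef c (rowFun (Q (N i)) (row (N i)))
          (stepCoef Q ent E (N i) (j i)) (w i) (x i) k).im)))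
  have hs : PolyBdd (fun r : Below fun i => m (N i) + 1 => N r.1.1) fun r =>
      (s r.1.1 r.1.2).size := by
    obtain ⟨T, hT⟩ := hw.2.1
    refine PolyBdd.mono (g := fun r => 1 + (T.eval (N r.1.1) + 2) + (1 + (1 + N r.1.1 * 3) +
      (1 + ((E.eval (N r.1.1) + 1) * N r.1.1 + 2) + ((E.eval (N r.1.1) + 1) * N r.1.1 + 2))))
      ⟨1 + (T + 2) + (1 + (1 + Polynomial.X * 3) +
      (1 + ((E + 1) * Polynomial.X + 2) + ((E + 1) * Polynomial.X + 2))), fun r => by simp⟩ ?_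
    rintro ⟨⟨i, k⟩, hk⟩
    have hk' : k ≤ N i := (Nat.lt_succ_iff.1 hk).trans (hmn _ (hN i))
    have h1 : (walk c (rowFun (Q (N i)) (row (N i))) (w i) (x i) k).1 ≤ w i := by
      clear hk hk'
      induction k with
      | zero => exact le_rfl
      | succ k ih => exact (Nat.div_le_self _ _).trans ih
    have h2 := norm_walkCoef_le c (rowFun (Q (N i)) (row (N i))) (hg (N i) (hN i) (j i)) (w i) (x i) k
    rw [walkCoef_div, norm_div, div_le_one (by simp), norm_pow, norm_pow, Complex.norm_two,
      ← pow_mul] at h2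
    have h3 := natAbs_le_of_norm_le (h2.trans (pow_le_pow_right₀ one_le_two
      (Nat.mul_le_mul_left (E.eval (N i) + 1) hk')))
    have h4 : (int (walk c (rowFun (Q (N i)) (row (N i))) (w i) (x i) k).1).size ≤
        T.eval (N i) + 2 := Val.size_int_le (by
      simpa using h1.trans ((by simpa using (Val.natAbs_lt_of_size (w i)).le : w i ≤ _).trans
        (Nat.pow_le_pow_right (by norm_num) (hT i))))
    have h5 := Val.size_int_le h3.1
    have h6 := Val.size_int_le h3.2
    have h7 := size_toVal_bits (walk c (rowFun (Q (N i)) (row (N i))) (w i) (x i) k).2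
    simp only [s, Val.size] at h4 h5 h6 h7 ⊢
    omega
  have h0 : PolyComp N e fun i => s i 0 :=
    hw.pair (hx.pair (((PolyComp.const hn.1 (int 1)).congr fun i => by simp [walkCoef]).pair
      ((PolyComp.const hn.1 (int 0)).congr fun i => by simp [walkCoef])))
  have hs' : PolyBdd (fun r : Below fun i => m (N i) => N r.1.1) fun r => (s r.1.1 r.1.2).size :=
    hs.reindex fun r : Below fun i => m (N i) => r.castSucc
  have hfin := PolyComp.fold (s := s) hmb hm h0 hs ?_
  · exact ⟨hfin.snd.fst, hfin.snd.snd.fst, hfin.snd.snd.snd⟩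
  -- one step of the loop
  have hS := PolyComp.var (((PolyComp.self hn.1).inBelow hmb)).1 hs'
  have hn' := (hn.inBelow hmb).weaken hs'
  have hj' := (hj.inBelow hmb).weaken hs'
  have hl' := (hl.inBelow hmb).weaken hs'
  have hk' := (PolyComp.counter hn.1 hmb).weaken hs'
  have hkb : PolyBdd (fun r : Below fun i => m (N i) => N r.1.1) fun r => r.1.2 :=
    (hmb.reindex fun r : Below fun i => m (N i) => r.1.1).mono fun r => r.2.le
  have hq' := hS.fst
  have hz' := hS.snd.fst
  have hP' : Gauss _ _ _ := ⟨hS.snd.snd.fst, hS.snd.snd.snd⟩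
  have hB := PolyComp.natConst hn'.1 (c + 1)
  have hd' := hq'.natMod hB
  have hd0 := hd'.natLe (PolyComp.natConst hn'.1 0)
  set d : (Below fun i => m (N i)) → ℕ := fun r =>
    (walk c (rowFun (Q (N r.1.1)) (row (N r.1.1))) (w r.1.1) (x r.1.1) r.1.2).1 % (c + 1) with hd
  -- A non-zero digit `d ≤ c` refers to entry number `d - 1 < c`, so the arguments of `row` and
  -- `ent` exist on this branch, and the calls are made only there.
  have hdc : ∀ r, ¬ d r ≤ 0 → d r - 1 < (Polynomial.C c).eval (N r.1.1) := fun r hr => by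
    have : d r < c + 1 := Nat.mod_lt _ (Nat.succ_pos c)
    rw [Polynomial.eval_C]; omega
  -- arguments of the calls
  let sub : {r : Below fun i => m (N i) // ¬ d r ≤ 0} → Below fun i => m (N i) := Subtype.val
  let a : ∀ r : {r : Below fun i => m (N i) // ¬ d r ≤ 0},
      Fin (N r.1.1.1) × Fin ((Polynomial.C c).eval (N r.1.1.1)) × Bits (N r.1.1.1) := fun r =>
    (Q _ ⟨r.1.1.2, r.1.2⟩, ⟨d r.1 - 1, hdc r.1 r.2⟩,
      (walk c (rowFun (Q (N r.1.1.1)) (row (N r.1.1.1))) (w r.1.1.1) (x r.1.1.1) r.1.1.2).2)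
  have hd1 := (hd'.sub (PolyComp.natConst hn'.1 1)).reindex sub
  have ha : PolyComp (fun r : {r : Below fun i => m (N i) // ¬ d r ≤ 0} => N r.1.1.1)
      (fun r => Val.pair (.pair (e r.1.1.1) (int r.1.1.2)) (s r.1.1.1 r.1.1.2))
      fun r => ToVal.toVal (a r) :=
    ((hl'.reindex sub).apply (m := fun r : {r : Below fun i => m (N i) // ¬ d r ≤ 0} =>
      ⟨r.1.1.2, r.1.2⟩) ((hmb.reindex fun r : Below fun i => m (N i) => r.1.1).reindex sub)
      (hk'.reindex sub)).pair ((hd1.congr fun r => by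
        have := r.2
        change int ((d r.1 : ℤ) - (1 : ℕ)) = int ((d r.1 - 1 : ℕ) : ℤ)
        congr 1; omega).pair (hz'.reindex sub))
  have hr := PolyComp.ofPolyTime hrow (fun r => hN _) (hn'.reindex sub) ha
    ((((PolyBdd.const 1).add (PolyBdd.self.mul (.const 3)))).mono fun r => size_toVal_bits _)
  have he := PolyComp.ofPolyTime hent (fun r => hN _) (hn'.reindex sub) ha
    ((((PolyBdd.const 2).mul ((PolyBdd.eval E).add (.const 1))).add (.const 5)).mono fun r =>
      size_toVal_intPair_le (hentb _ (hN _) _).1 (hentb _ (hN _) _).2)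
  have hsign := (PolyComp.const hn'.1 (int 1)).sub ((PolyComp.const hn'.1 (int 2)).mul
    ((hj'.natDiv ((PolyComp.natConst hn'.1 2).natPow hkb hk')).natMod (PolyComp.natConst hn'.1 2)))
  have hzero := PolyComp.const hn'.1 (int 0)
  have hEb : PolyBdd (fun r : Below fun i => m (N i) => N r.1.1) fun r => E.eval (N r.1.1) :=
    (PolyBdd.eval E).reindex fun r : Below fun i => m (N i) => r.1.1
  have hpow := (PolyComp.natConst hn'.1 2).natPow hEb (hn'.eval E)
  have hsgn : Gauss (fun r : {r : Below fun i => m (N i) // ¬ d r ≤ 0} => N r.1.1.1)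
      (fun r => Val.pair (.pair (e r.1.1.1) (int r.1.1.2)) (s r.1.1.1 r.1.1.2))
      fun r => ((1 - 2 * ((j r.1.1.1 / 2 ^ r.1.1.2 % 2 : ℕ) : ℤ) : ℤ) : GaussianInt) :=
    ⟨(hsign.reindex sub).congr fun r => (congrArg int (Zsqrtd.re_intCast _)).symm,
      (hzero.reindex sub).congr fun r => (congrArg int (Zsqrtd.im_intCast _)).symm⟩
  have hmul := hsgn.mul (Gauss.ofPair he)
  have hcoef : Gauss (fun r : Below fun i => m (N i) => N r.1.1)
      (fun r => Val.pair (.pair (e r.1.1) (int r.1.2)) (s r.1.1 r.1.2))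
      fun r => stepCoef Q ent E (N r.1.1) (j r.1.1) r.1.2 (d r)
        (walk c (rowFun (Q (N r.1.1)) (row (N r.1.1))) (w r.1.1) (x r.1.1) r.1.2).2 := by
    have hz0 : ∀ b : ℕ, ((2 ^ b : GaussianInt)).re = ((2 ^ b : ℕ) : ℤ) ∧
        ((2 ^ b : GaussianInt)).im = 0 := fun b => by
      have : (2 ^ b : GaussianInt) = ((2 ^ b : ℕ) : GaussianInt) := by push_cast; rfl
      rw [this]
      exact ⟨Zsqrtd.re_natCast _, Zsqrtd.im_natCast _⟩
    have hdif : ∀ r : {r : Below fun i => m (N i) // ¬ d r ≤ 0},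
        stepCoef Q ent E (N r.1.1.1) (j r.1.1.1) r.1.1.2 (d r.1) (a r).2.2 =
        ((1 - 2 * ((j r.1.1.1 / 2 ^ r.1.1.2 % 2 : ℕ) : ℤ) : ℤ) : GaussianInt) *
          ⟨(ent _ (a r)).1, (ent _ (a r)).2⟩ := fun r => by
      have h := r.2
      rw [stepCoef, coefFun, if_neg (by omega), dif_pos ⟨r.1.2, hdc r.1 r.2⟩]
    have h0' : ∀ r : {r : Below fun i => m (N i) // d r ≤ 0}, ∀ z,
        stepCoef Q ent E (N r.1.1.1) (j r.1.1.1) r.1.1.2 (d r.1) z = 2 ^ E.eval (N r.1.1.1) :=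
      fun r z => by
        have h := r.2
        rw [stepCoef, coefFun, if_pos (by omega)]
    constructor
    · exact (hd0.ite ((hpow.reindex _).congr fun r => 
        (congrArg int ((congrArg Zsqrtd.re (h0' r _)).trans (hz0 _).1)).symm)
        (hmul.1.congr fun r => (congrArg (fun g => int g.re) (hdif r)).symm)).congr fun r => ite_self _
    · exact (hd0.ite ((hzero.reindex _).congr fun r => 
        (congrArg int ((congrArg Zsqrtd.im (h0' r _)).trans (hz0 _).2)).symm)
        (hmul.2.congr fun r => (congrArg (fun g => int g.im) (hdif r)).symm)).congr fun r => ite_self _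
  have hnext : PolyComp (fun r : Below fun i => m (N i) => N r.1.1)
      (fun r => Val.pair (.pair (e r.1.1) (int r.1.2)) (s r.1.1 r.1.2))
      fun r => ToVal.toVal (walkStep (rowFun (Q (N r.1.1)) (row (N r.1.1))) r.1.2 (d r)
        (walk c (rowFun (Q (N r.1.1)) (row (N r.1.1))) (w r.1.1) (x r.1.1) r.1.2).2) := by
    refine (hd0.ite ((hz'.reindex _).congr fun r => ?_) (hr.congr fun r => ?_)).congr
      fun r => ite_self _
    · rw [walkStep, if_pos (Nat.le_zero.1 r.2)]
    · rw [walkStep, if_neg fun h => r.2 h.le, rowFun, dif_pos ⟨r.1.2, hdc r.1 r.2⟩]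
  have hPnext := Gauss.mul hP' hcoef
  exact (hq'.natDiv hB).pair (hnext.pair (hPnext.1.pair hPnext.2))

end Estimate

/-! ### The estimator, its table and the sampler in polynomial time -/

/-- The coins with numbers `s, …, s + L - 1`. -/
def coinsFrom {l : ℕ} (L : ℕ) (r : Bits l) (s : ℕ) : Bits L := fun i => bitAt r (s + i)

theorem coinsFst_eq {l k j : ℕ} (h : l = k + j) (r : Bits l) : coinsFst h r = coinsFrom k r 0 := by
  ext i
  rw [coinsFst, coinsFrom, bitAt, dif_pos (by omega)]
  congr 1; ext; simp

theorem coinsSnd_eq {l k j : ℕ} (h : l = k + j) (r : Bits l) : coinsSnd h r = coinsFrom j r k := by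
  ext i
  rw [coinsSnd, coinsFrom, bitAt, dif_pos (by omega)]
  congr 1

theorem coinsBlock_eq {l K L : ℕ} (h : l = K * L) (r : Bits l) (k : Fin K) :
    coinsBlock h r k = coinsFrom L r (L * k) := by
  ext i
  have hlt : L * k + i < l := by
    have := (finProdFinEquiv (k, i)).2
    rw [finProdFinEquiv_apply_val] at this
    simp only at this
    omega
  rw [coinsBlock, coinsFrom, bitAt, dif_pos hlt]
  congr 1; ext; simp [add_comm]

theorem bitsEquiv_val_eq_sum_range {n : ℕ} (x : Bits n) :
    (bitsEquiv n x : ℕ) = ∑ i ∈ Finset.range n, (if bitAt x i then 1 else 0) * 2 ^ i := by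
  rw [bitsEquiv_val, Finset.sum_range]
  simp [bitAt]

/-- The integer nearest to `S` in the range of the weights with denominator `2 ^ b`. -/
def clampWeight (b : ℕ) (S : ℤ) : ℕ := min S.toNat (2 ^ b)

/-- Binary table of the weights `c 0, c 1, …` with `b` bits each. -/
def tableBits (b k : ℕ) (c : ℕ → ℕ) : Bits k := fun p => decide (1 ≤ c (p / b) / 2 ^ (p % b) % 2)

/-- Weight number `j` in a binary table. -/
def tableEntry (b : ℕ) {k : ℕ} (d : Bits k) (j : ℕ) : ℕ :=
  ∑ t ∈ Finset.range b, (if bitAt d (j * b + t) then 1 else 0) * 2 ^ t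

theorem tableEntry_tableBits {b k M : ℕ} {c : ℕ → ℕ} {j : ℕ} (hk : k = M * b) (hj : j < M)
    (hc : c j < 2 ^ b) : tableEntry b (tableBits b k c) j = c j := by
  rw [tableEntry]
  refine (Finset.sum_congr rfl fun t ht => ?_).trans (sum_bit_mul_two_pow hc)
  have ht := Finset.mem_range.1 ht
  have hlt : j * b + t < k := by
    rw [hk]; calc j * b + t < (j + 1) * b := by linarith
      _ ≤ M * b := Nat.mul_le_mul_right _ hj
  rw [bitAt, dif_pos hlt, tableBits]
  have h1 : (j * b + t) / b = j := by
    rw [mul_comm, Nat.mul_add_div (by omega), Nat.div_eq_of_lt ht, add_zero]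
  have h2 : (j * b + t) % b = t := by rw [mul_comm, Nat.mul_add_mod, Nat.mod_eq_of_lt ht]
  simp only [h1, h2, decide_eq_true_eq]

/-- The outcome selected by the coins `u` from the binary table `d`. -/
def tableOutcome (b m : ℕ) {k l : ℕ} (d : Bits k) (u : Bits l) : Bits m :=
  (bitsEquiv m).symm
    ⟨tableIndex (tableEntry b d) (2 ^ m) (bitsEquiv l u), tableIndex_lt (by positivity) _⟩

/-- Accuracy of the distribution sampled from a binary table of weights. -/
theorem sum_abs_sub_tableOutcome_le {b m k M : ℕ} {c : ℕ → ℕ} {p : Bits m → ℝ} {δ : ℝ}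
    (hp : ∑ y, p y = 1) (hk : k = M * (b + 1)) (hM : 2 ^ m ≤ M) (hc : ∀ j, c j ≤ 2 ^ b)
    (hδ : 0 ≤ δ) (h : ∀ j : Fin (2 ^ m), |(c j : ℝ) / 2 ^ b - p ((bitsEquiv m).symm j)| ≤ δ) :
    ∑ y, |p y - coinProb fun u : Bits b =>
      tableOutcome (b + 1) m (tableBits (b + 1) k c) u = y| ≤ 2 * (2 ^ m * δ) :=
  sum_abs_sub_coinProb_table_le hp hδ fun j => by
    -- A weight may equal `2 ^ b`, which is why the table reserves `b + 1` bits per entry.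
    rw [tableEntry_tableBits hk (j.2.trans_le hM)
      ((hc j).trans_lt (Nat.pow_lt_pow_right (by norm_num) (Nat.lt_succ_self _)))]
    exact h j

namespace PolyComp

variable {ι : Type} {N : ι → ℕ} {e : ι → Val}

open Val (int)

theorem coinsFrom {l L s : ι → ℕ} {r : ∀ i, Bits (l i)}
    (hr : PolyComp N e fun i => ToVal.toVal (r i)) (hLb : PolyBdd N L)
    (hL : PolyComp N e fun i => int (L i)) (hsb : PolyBdd N s)
    (hs : PolyComp N e fun i => int (s i)) :
    PolyComp N e fun i => ToVal.toVal (coinsFrom (L i) (r i) (s i)) :=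
  toValFun hLb hL (bitAt (hr.inBelow hLb)
    ((hsb.reindex fun j : Below L => j.1.1).add
      ((hLb.reindex fun j : Below L => j.1.1).mono fun j => j.2.le))
    ((hs.inBelow hLb).natAdd (counter hr.1 hLb)))

theorem bitSum {k b s : ι → ℕ} {d : ∀ i, Bits (k i)} (hd : PolyComp N e fun i => ToVal.toVal (d i))
    (hbb : PolyBdd N b) (hb : PolyComp N e fun i => int (b i)) (hsb : PolyBdd N s)
    (hs : PolyComp N e fun i => int (s i)) :
    PolyComp N e fun i => int (∑ t ∈ Finset.range (b i),
      (if _root_.bitAt (d i) (s i + t) then 1 else 0) * 2 ^ t : ℕ) := by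
  have hc := counter hd.1 hbb
  have hcb : PolyBdd (fun j : Below b => N j.1.1) fun j => j.1.2 :=
    (hbb.reindex fun j : Below b => j.1.1).mono fun j => j.2.le
  exact natSum (f := fun i t => (if _root_.bitAt (d i) (s i + t) then 1 else 0) * 2 ^ t) hbb hb
    ((boolToNat (bitAt (hd.inBelow hbb) ((hsb.reindex fun j : Below b => j.1.1).add hcb)
      ((hs.inBelow hbb).natAdd hc))).natMul ((natConst hc.1 2).natPow hcb hc))

theorem clampWeight {b : ι → ℕ} {S : ι → ℤ} (hbb : PolyBdd N b)
    (hb : PolyComp N e fun i => int (b i)) (hS : PolyComp N e fun i => int (S i)) :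
    PolyComp N e fun i => int (clampWeight (b i) (S i) : ℕ) := by
  have hz := const hb.1 (int 0)
  have hp := (natConst hb.1 2).natPow hbb hb
  refine ((hS.le hz).ite' hz ((hS.le hp).ite' hS hp)).congr fun i => ?_
  rw [_root_.clampWeight]
  split_ifs with h1 h2
  · simp [Int.toNat_of_nonpos h1]
  · congr 1; omega
  · congr 1; omega

/-- As `2 ^ m` is polynomially bounded, every partial sum of the weights can be recomputed from the
table by nested loops. -/
theorem tableOutcome {b m k l : ι → ℕ} {d : ∀ i, Bits (k i)} {u : ∀ i, Bits (l i)}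
    (hd : PolyComp N e fun i => ToVal.toVal (d i)) (hu : PolyComp N e fun i => ToVal.toVal (u i))
    (hbb : PolyBdd N b) (hb : PolyComp N e fun i => int (b i)) (hlb : PolyBdd N l)
    (hl : PolyComp N e fun i => int (l i)) (hmb : PolyBdd N fun i => 2 ^ m i)
    (hm : PolyComp N e fun i => int (m i)) :
    PolyComp N e fun i => ToVal.toVal (tableOutcome (b i) (m i) (d i) (u i)) := by
  have hmb' : PolyBdd N m := hmb.mono fun i => Nat.lt_two_pow_self.le
  have hz : PolyBdd N fun _ => 0 := .const 0
  have hun : PolyComp N e fun i => int (bitsEquiv (l i) (u i) : ℕ) :=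
    (bitSum hu hlb hl hz (natConst hd.1 0)).congr fun i => by
      simp [bitsEquiv_val_eq_sum_range]
  have hpow := (natConst hd.1 2).natPow hmb' hm
  have hM : PolyComp N e fun i => int (2 ^ m i - 1 : ℕ) :=
    (hpow.sub (natConst hd.1 1)).congr fun i => by
      have := Nat.one_le_two_pow (n := m i)
      congr 1; omega
  have hMb : PolyBdd N fun i => 2 ^ m i - 1 := hmb.mono fun i => Nat.sub_le _ _
  let K1 : ι → ℕ := fun i => 2 ^ m i - 1
  let K2 : Below K1 → ℕ := fun j => j.1.2 + 1
  have hc1 : PolyComp _ _ fun j : Below K1 => int j.1.2 := counter hd.1 hMb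
  have hc1b : PolyBdd (fun j : Below K1 => N j.1.1) fun j => j.1.2 :=
    (hMb.reindex fun j : Below K1 => j.1.1).mono fun j => j.2.le
  have hK2 := hc1.natAdd (natConst hc1.1 1)
  have hK2b : PolyBdd (fun j : Below K1 => N j.1.1) K2 := hc1b.add (.const 1)
  have hc2 : PolyComp _ _ fun j : Below K2 => int j.1.2 := counter hc1.1 hK2b
  have hc2b : PolyBdd (fun j : Below K2 => N j.1.1.1.1) fun j => j.1.2 :=
    (hK2b.reindex fun j : Below K2 => j.1.1).mono fun j => j.2.le
  have hentry : PolyComp (fun j : Below K2 => N j.1.1.1.1) _ fun j =>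
      int (tableEntry (b j.1.1.1.1) (d j.1.1.1.1) j.1.2 : ℕ) :=
    bitSum (s := fun j : Below K2 => j.1.2 * b j.1.1.1.1) ((hd.inBelow hMb).inBelow hK2b)
      ((hbb.reindex fun j : Below K1 => j.1.1).reindex fun j : Below K2 => j.1.1)
      ((hb.inBelow hMb).inBelow hK2b)
      (hc2b.mul ((hbb.reindex fun j : Below K1 => j.1.1).reindex fun j : Below K2 => j.1.1))
      (hc2.natMul ((hb.inBelow hMb).inBelow hK2b))
  have hidx : PolyComp N e fun i =>
      int (tableIndex (tableEntry (b i) (d i)) (2 ^ m i) (bitsEquiv (l i) (u i)) : ℕ) :=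
    (natSum (f := fun i j => if decide (∑ t ∈ Finset.range (j + 1), tableEntry (b i) (d i) t ≤
        bitsEquiv (l i) (u i)) then 1 else 0) hMb hM
      (boolToNat ((natSum (f := fun (j : Below K1) t => tableEntry (b j.1.1) (d j.1.1) t)
        hK2b hK2 hentry).natLe (hun.inBelow hMb)))).congr fun i => by
          simp only [decide_eq_true_eq]; rfl
  have hc := counter hd.1 hmb'
  have hcb : PolyBdd (fun j : Below m => N j.1.1) fun j => j.1.2 :=
    (hmb'.reindex fun j : Below m => j.1.1).mono fun j => j.2.le
  refine toValFun hmb' hm (((natConst hc.1 1).natLe (((hidx.inBelow hmb').natDiv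
    ((natConst hc.1 2).natPow hcb hc)).natMod (natConst hc.1 2))).congr fun j => ?_)
  rw [_root_.tableOutcome, bitsEquiv_symm_apply]

end PolyComp

section Estimate

variable {m : ℕ → ℕ} {Q : ∀ n, Fin (m n) → Fin n} {c : ℕ}
  {row : ∀ n, Fin n × Fin ((Polynomial.C c).eval n) × Bits n → Bits n}
  {ent : ∀ n, Fin n × Fin ((Polynomial.C c).eval n) × Bits n → ℤ × ℤ}
  {amp : ∀ n, Bits n → ℤ × ℤ} {E R L K l : Polynomial ℕ}
  {smp : ∀ n, Unit × Bits (L.eval n) → Bits n}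

/-- The estimate obtained from the sample `x` for the outcome with number `j`. -/
noncomputable def outcomeEstimate (Q : ∀ n, Fin (m n) → Fin n)
    (row : ∀ n, Fin n × Fin ((Polynomial.C c).eval n) × Bits n → Bits n)
    (ent : ∀ n, Fin n × Fin ((Polynomial.C c).eval n) × Bits n → ℤ × ℤ)
    (amp : ∀ n, Bits n → ℤ × ℤ) (E : Polynomial ℕ) (n j : ℕ) (x : Bits n) : ℤ :=
  sampleInt c (E.eval n) (rowFun (Q n) (row n)) (stepCoef Q ent E n j)
    (fun x => ⟨(amp n x).1, (amp n x).2⟩) (m n) x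

/-- The weight of the outcome with number `j`: average of the estimates over the samples drawn
with the coins `r`. -/
noncomputable def outcomeWeight (Q : ∀ n, Fin (m n) → Fin n)
    (row : ∀ n, Fin n × Fin ((Polynomial.C c).eval n) × Bits n → Bits n)
    (ent : ∀ n, Fin n × Fin ((Polynomial.C c).eval n) × Bits n → ℤ × ℤ)
    (amp : ∀ n, Bits n → ℤ × ℤ) (E K : Polynomial ℕ)
    (smp : ∀ n, Unit × Bits (L.eval n) → Bits n) (n : ℕ) {l : ℕ} (r : Bits l) (j : ℕ) : ℕ :=
  clampWeight (E.eval n) ((∑ k ∈ Finset.range (K.eval n), outcomeEstimate Q row ent amp E n j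
    (smp n ((), coinsFrom (L.eval n) r (L.eval n * k)))) / K.eval n)

open Val (int)

variable (hQ : PolyTime fun n (_ : Unit) => Q n) (hmn : ∀ n, 1 ≤ n → m n ≤ n)
  (hrow : PolyTime row) (hent : PolyTime ent)
  (hentb : ∀ n, 1 ≤ n → ∀ a, (ent n a).1.natAbs ≤ 2 ^ (E.eval n + 1) ∧
    (ent n a).2.natAbs ≤ 2 ^ (E.eval n + 1))
  (hg : ∀ n, 1 ≤ n → ∀ j k d z, ‖(stepCoef Q ent E n j k d z : ℂ) / (2 ^ (E.eval n + 1) : ℂ)‖ ≤ 1)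
  (hamp : PolyTime amp)
  (hampb : ∀ n, 1 ≤ n → ∀ x, (amp n x).1.natAbs ≤ 2 ^ (E.eval n + 1) ∧
    (amp n x).2.natAbs ≤ 2 ^ (E.eval n + 1))
  (hR : ∀ n, 1 ≤ n → (c + 2) ^ m n ≤ R.eval n) (hsmp : PolyTime smp)

include hQ hmn hrow hent hentb hg hamp hampb hR

theorem polyComp_outcomeEstimate {ι : Type} {N : ι → ℕ} {e : ι → Val} {j : ι → ℕ}
    {x : ∀ i, Bits (N i)} (hN : ∀ i, 1 ≤ N i) (hn : PolyComp N e fun i => int (N i))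
    (hj : PolyComp N e fun i => int (j i)) (hx : PolyComp N e fun i => ToVal.toVal (x i)) :
    PolyComp N e fun i => int (outcomeEstimate Q row ent amp E (N i) (j i) (x i)) := by
  have hmb : PolyBdd N fun i => m (N i) := PolyBdd.self.mono fun i => hmn _ (hN i)
  have hm := PolyComp.length hn (fun i => hmn _ (hN i)) (polyComp_list hQ hmn hN hn)
  have hWb : PolyBdd N fun i => (c + 1) ^ m (N i) := (PolyBdd.eval R).mono fun i =>
    (Nat.pow_le_pow_left (by omega) _).trans (hR _ (hN i))
  have hW := (PolyComp.natConst hn.1 (c + 1)).natPow hmb hm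
  have hEb : PolyBdd N fun i => E.eval (N i) := .eval E
  have hE := hn.eval E
  have hD := ((PolyComp.natConst hn.1 2).natPow (hEb.add (.const 1))
    (hE.natAdd (PolyComp.natConst hn.1 1))).natPow hmb hm
  have hcall : ∀ {κ : Type} {N' : κ → ℕ} {e' : κ → Val} {x' : ∀ i, Bits (N' i)},
      (∀ i, 1 ≤ N' i) → (PolyComp N' e' fun i => int (N' i)) →
      (PolyComp N' e' fun i => ToVal.toVal (x' i)) →
      PolyComp.Gauss N' e' fun i => ⟨(amp _ (x' i)).1, (amp _ (x' i)).2⟩ := fun hN' hn' hx' =>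
    PolyComp.Gauss.ofPair (PolyComp.ofPolyTime hamp hN' hn' hx'
      ((((PolyBdd.const 2).mul ((PolyBdd.eval E).add (.const 1))).add (.const 5)).mono fun r =>
        size_toVal_intPair_le (hampb _ (hN' _) _).1 (hampb _ (hN' _) _).2))
  have hwalk := polyComp_walk (c := c) hQ hmn hrow hent hentb hg
    (fun r : Below fun i => (c + 1) ^ m (N i) => hN r.1.1) (hn.inBelow hWb) (hj.inBelow hWb)
    (PolyComp.counter hn.1 hWb) (hx.inBelow hWb)
  exact PolyComp.sum (f := fun i w => ratioInt _ _ _ _ _) hWb hW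
    (PolyComp.ratioInt (hEb.reindex fun r : Below fun i => (c + 1) ^ m (N i) => r.1.1)
      (hE.inBelow hWb) (hD.inBelow hWb) hwalk.2
      (hcall (fun r => hN _) (hn.inBelow hWb) (hx.inBelow hWb))
      (hcall (fun r => hN _) (hn.inBelow hWb) hwalk.1))

include hsmp

theorem polyComp_outcomeWeight {ι : Type} {N l : ι → ℕ} {e : ι → Val} {j : ι → ℕ}
    {r : ∀ i, Bits (l i)} (hN : ∀ i, 1 ≤ N i) (hn : PolyComp N e fun i => int (N i))
    (hj : PolyComp N e fun i => int (j i)) (hr : PolyComp N e fun i => ToVal.toVal (r i)) :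
    PolyComp N e fun i => int (outcomeWeight Q row ent amp E K smp (N i) (r i) (j i) : ℕ) := by
  have hKb : PolyBdd N fun i => K.eval (N i) := .eval K
  have hc := PolyComp.counter hn.1 hKb
  have hn' := hn.inBelow hKb
  have hcb : PolyBdd (fun j : Below fun i => K.eval (N i) => N j.1.1) fun j => j.1.2 :=
    (hKb.reindex fun j : Below fun i => K.eval (N i) => j.1.1).mono fun j => j.2.le
  have hLb : PolyBdd (fun j : Below fun i => K.eval (N i) => N j.1.1) fun j => L.eval (N j.1.1) :=
    .eval L
  have hx := PolyComp.ofPolyTime hsmp (fun r => hN _) hn'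
    ((PolyComp.const hn'.1 (int 0)).pair (PolyComp.coinsFrom (hr.inBelow hKb) hLb (hn'.eval L)
      (hLb.mul hcb) ((hn'.eval L).natMul hc)))
    (a := fun j : Below fun i => K.eval (N i) => ((), coinsFrom (L.eval (N j.1.1)) (r j.1.1) (L.eval (N j.1.1) * j.1.2)))
    (((PolyBdd.const 1).add (PolyBdd.self.mul (.const 3))).mono fun r => size_toVal_bits _)
  exact PolyComp.clampWeight (.eval E) (hn.eval E) ((PolyComp.sum
    (f := fun i k => outcomeEstimate Q row ent amp E (N i) (j i) (smp (N i) ((),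
      coinsFrom (L.eval (N i)) (r i) (L.eval (N i) * k)))) hKb (hn.eval K)
    (polyComp_outcomeEstimate hQ hmn hrow hent hentb hg hamp hampb hR (fun r => hN _) hn'
      (hj.inBelow hKb) hx)).div (hn.eval K))

/-- The table has `R(n)` rows instead of `2 ^ m`, since its length has to be a polynomial in `n`;
the surplus rows are never read. Each bit recomputes the weight to which it belongs. -/
theorem polyTime_tableBits : PolyTime fun n (r : Bits (l.eval n)) =>
    tableBits (E.eval n + 1) ((R * (E + 1)).eval n)
      (outcomeWeight Q row ent amp E K smp n r) := by
  apply PolyComp.polyTime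
  let N : {i : Σ n, Bits (l.eval n) // 1 ≤ i.1} → ℕ := fun i => i.1.1
  have henv : PolyBdd N fun i => (Val.pair (int i.1.1) (ToVal.toVal i.1.2)).size := by
    refine PolyBdd.mono (g := fun i => 1 + (N i + 2) + (1 + l.eval (N i) * 3))
      (((PolyBdd.const 1).add (PolyBdd.self.add (.const 2))).add
        ((PolyBdd.const 1).add ((PolyBdd.eval l).mul (.const 3)))) fun i => ?_
    have h1 : (int i.1.1).size ≤ N i + 2 :=
      Val.size_int_le (by simpa using Nat.lt_two_pow_self.le)
    have h2 := size_toVal_bits i.1.2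
    simp only [Val.size, N] at h1 ⊢
    omega
  have hn : PolyComp N _ fun i => int (N i) := (PolyComp.self henv).fst
  have hr := (PolyComp.self henv).snd
  have hkb : PolyBdd N fun i => (R * (E + 1)).eval (N i) := .eval _
  have hc := PolyComp.counter hn.1 hkb
  have hb : PolyComp N _ fun i => int (E.eval (N i) + 1 : ℕ) :=
    (hn.eval E).natAdd (PolyComp.natConst hn.1 1)
  have hcb := (hkb.reindex fun j : Below fun i => (R * (E + 1)).eval (N i) => j.1.1).mono
    fun j => (Nat.mod_le j.1.2 (E.eval (N j.1.1) + 1)).trans j.2.le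
  exact PolyComp.toValFun hkb (hn.eval _) ((PolyComp.natConst hc.1 1).natLe
    (((polyComp_outcomeWeight hQ hmn hrow hent hentb hg hamp hampb hR hsmp (fun r => r.1.1.2)
      (hn.inBelow hkb) (hc.natDiv (hb.inBelow hkb)) (hr.inBelow hkb)).natDiv
      ((PolyComp.natConst hc.1 2).natPow hcb (hc.natMod (hb.inBelow hkb)))).natMod
        (PolyComp.natConst hc.1 2)))

omit hrow hent hentb hg hamp hampb hsmp in
theorem polyTime_tableOutcome {k : Polynomial ℕ} : PolyTime
    fun n (a : Bits (k.eval n) × Bits (E.eval n)) => tableOutcome (E.eval n + 1) (m n) a.1 a.2 := by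
  apply PolyComp.polyTime
  let N : {i : Σ n, Bits (k.eval n) × Bits (E.eval n) // 1 ≤ i.1} → ℕ := fun i => i.1.1
  have henv : PolyBdd N fun i => (Val.pair (int i.1.1) (ToVal.toVal i.1.2)).size := by
    refine PolyBdd.mono (g := fun i => 1 + (N i + 2) + (1 + (1 + k.eval (N i) * 3) +
      (1 + E.eval (N i) * 3)))
      (((PolyBdd.const 1).add (PolyBdd.self.add (.const 2))).add
        (((PolyBdd.const 1).add ((PolyBdd.const 1).add ((PolyBdd.eval k).mul (.const 3)))).add
          ((PolyBdd.const 1).add ((PolyBdd.eval E).mul (.const 3))))) fun i => ?_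
    have h1 : (int i.1.1).size ≤ N i + 2 :=
      Val.size_int_le (by simpa using Nat.lt_two_pow_self.le)
    have h2 := size_toVal_bits i.1.2.1
    have h3 := size_toVal_bits i.1.2.2
    simp only [Val.size, ToVal.toVal, N] at h1 h2 h3 ⊢
    omega
  have hn : PolyComp N _ fun i => int (N i) := (PolyComp.self henv).fst
  have ha := (PolyComp.self henv).snd
  have hmb : PolyBdd N fun i => 2 ^ m (N i) := (PolyBdd.eval R).mono fun i =>
    (Nat.pow_le_pow_left (by omega) _).trans (hR _ i.2)
  have hm := PolyComp.length hn (fun i => hmn _ i.2) (polyComp_list hQ hmn (fun i => i.2) hn)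
  exact PolyComp.tableOutcome ha.fst' ha.snd' ((PolyBdd.eval E).add (.const 1))
    ((hn.eval E).natAdd (PolyComp.natConst hn.1 1)) (.eval E) (hn.eval E) hmb hm

end Estimate

/-! ### Accuracy of the estimates -/

section Accuracy

theorem norm_toComplex_le_of_approx {g : GaussianInt} {v : ℂ} {b : ℕ} (hv : ‖v‖ ≤ 1)
    (h : ‖(g : ℂ) / 2 ^ b - v‖ ≤ 1 / 2 ^ b) : ‖(g : ℂ)‖ ≤ 2 ^ (b + 1) := by
  have h2 : (1 : ℝ) ≤ 2 ^ b := one_le_pow₀ one_le_two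
  have h1 : ‖(g : ℂ) / 2 ^ b‖ ≤ 1 + 1 / 2 ^ b := by
    have := norm_le_norm_add_norm_sub' ((g : ℂ) / 2 ^ b) v
    linarith
  rw [norm_div, norm_pow, Complex.norm_two, div_le_iff₀ (by positivity), add_mul,
    div_mul_cancel₀ _ (by positivity)] at h1
  rw [pow_succ]; linarith

theorem norm_sign (j k : ℕ) : ‖((1 - 2 * ((j / 2 ^ k % 2 : ℕ) : ℤ) : ℤ) : ℂ)‖ = 1 := by
  rcases Nat.mod_two_eq_zero_or_one (j / 2 ^ k) with h | h <;> rw [h] <;> norm_num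

variable {n m s : ℕ} {Q : Fin m → Fin n} {M : Fin n → QOp n}

/-- The exact coefficients of the walks. -/
noncomputable def exactCoef (s : ℕ) (Q : Fin m → Fin n) (M : Fin n → QOp n) (j : ℕ) :
    ℕ → ℕ → Bits n → ℂ :=
  coefFun Q (1 / 2 : ℂ)
    (fun a : Fin n × Fin s × Bits n => entryOf (M a.1) a.2.1 a.2.2 / 2) j

theorem norm_exactCoef_le (hM : ∀ i, M i ∈ Matrix.unitaryGroup (Bits n) ℂ) (j k d : ℕ)
    (z : Bits n) : ‖exactCoef s Q M j k d z‖ ≤ 1 / 2 := by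
  rw [exactCoef, coefFun]
  split_ifs with h1 h2
  · simp
  · rw [norm_mul, norm_sign, one_mul, norm_div, Complex.norm_two]
    have := norm_entryOf_le_one (M (Q ⟨k, h2.1⟩)) z (hM _) (d - 1)
    linarith
  · simp

theorem norm_coefFun_sub_exactCoef_le {b : ℕ} {ent : Fin n × Fin s × Bits n → GaussianInt}
    (hent : ∀ a, ‖(ent a : ℂ) / 2 ^ b - entryOf (M a.1) a.2.1 a.2.2‖ ≤ 1 / 2 ^ b)
    (j k d : ℕ) (z : Bits n) :
    ‖((coefFun Q (2 ^ b) ent j k d z : GaussianInt) : ℂ) / 2 ^ (b + 1) - exactCoef s Q M j k d z‖ ≤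
      1 / 2 ^ b / 2 := by
  rw [exactCoef, coefFun, coefFun]
  split_ifs with h1 h2
  · rw [map_pow, map_ofNat, pow_succ]
    have : (2 : ℂ) ^ b ≠ 0 := pow_ne_zero _ two_ne_zero
    rw [← div_div, div_self this, sub_self, norm_zero]
    positivity
  · rw [map_mul, map_intCast]
    have h3 : ∀ σ u v : ℂ, σ * u / 2 ^ (b + 1) - σ * (v / 2) = σ * ((u / 2 ^ b - v) / 2) := by
      intro σ u v; rw [pow_succ]; field_simp
    rw [h3, norm_mul, norm_sign, one_mul, norm_div, Complex.norm_two]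
    have := hent (Q ⟨k, h2.1⟩, ⟨d - 1, h2.2⟩, z)
    linarith
  · rw [map_zero, zero_div, sub_self, norm_zero]
    positivity

/-- Digit `0` is the identity term of `(1 ± M) / 2`, and the digits `1, …, s` run through the
entries of `M`. Bit `k` of `j` is bit `k` of the outcome and fixes the sign. -/
theorem sum_exactCoef_mul (hc : ∀ i x, (colSupport (M i) x).length ≤ s) {j : ℕ}
    (hj : j < 2 ^ m) {k : ℕ} (hk : k < m) (z : Bits n) (f : Bits n → ℂ) :
    ∑ d ∈ Finset.range (s + 1), exactCoef s Q M j k d z *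
      f (walkStep (rowFun Q fun a : Fin n × Fin s × Bits n => rowOf (M a.1) a.2.1 a.2.2) k d z) =
    ∑ z', ((1 / 2 : ℂ) • (1 + (bitSign ((bitsEquiv m).symm ⟨j, hj⟩ ⟨k, hk⟩) : ℂ) •
      M (Q ⟨k, hk⟩))) z' z * f z' := by
  rw [Finset.sum_range_succ']
  have h0 : exactCoef s Q M j k 0 z = 1 / 2 := by simp [exactCoef, coefFun]
  have hsgn : (bitSign ((bitsEquiv m).symm ⟨j, hj⟩ ⟨k, hk⟩) : ℂ) =
      ((1 - 2 * ((j / 2 ^ k % 2 : ℕ) : ℤ) : ℤ) : ℂ) := by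
    rw [bitsEquiv_symm_apply, bitSign]
    rcases Nat.mod_two_eq_zero_or_one (j / 2 ^ k) with h | h <;> simp only [h] <;> norm_num
  have h1 : ∀ l ∈ Finset.range s, exactCoef s Q M j k (l + 1) z *
      f (walkStep (rowFun Q fun a : Fin n × Fin s × Bits n => rowOf (M a.1) a.2.1 a.2.2)
        k (l + 1) z) =
      (1 / 2 * (bitSign ((bitsEquiv m).symm ⟨j, hj⟩ ⟨k, hk⟩) : ℂ)) *
        (entryOf (M (Q ⟨k, hk⟩)) l z * f (rowOf (M (Q ⟨k, hk⟩)) l z)) := fun l hl => by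
    have hl := Finset.mem_range.1 hl
    rw [exactCoef, coefFun, if_neg (Nat.succ_ne_zero l), walkStep, if_neg (Nat.succ_ne_zero l),
      rowFun, dif_pos ⟨hk, by simpa using hl⟩, dif_pos ⟨hk, by simpa using hl⟩, hsgn]
    simp only [Nat.add_sub_cancel]
    ring
  rw [Finset.sum_congr rfl h1, ← Finset.mul_sum, sum_entryOf_mul _ _ (hc _ _), h0]
  simp only [walkStep, if_true, Matrix.smul_apply, Matrix.add_apply, smul_eq_mul, mul_add, add_mul,
    Finset.sum_add_distrib, Matrix.one_apply]
  rw [add_comm]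
  congr 1
  · simp
  · rw [Finset.mul_sum]
    exact Finset.sum_congr rfl fun z' _ => by ring

/-- The mean of the estimates is close to the output probability. -/
theorem abs_mean_sub_outDist_le {U V : Circuit n} (hM : ∀ i, M i = (Circuit.mat V)ᴴ *
      onQubit pauliZ i * Circuit.mat V)
    (hMu : ∀ i, M i ∈ Matrix.unitaryGroup (Bits n) ℂ)
    (hc : ∀ i x, (colSupport (M i) x).length ≤ s) {b : ℕ}
    {ent : Fin n × Fin s × Bits n → GaussianInt}
    (hent : ∀ a, ‖(ent a : ℂ) / 2 ^ b - entryOf (M a.1) a.2.1 a.2.2‖ ≤ 1 / 2 ^ b)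
    {amp : Bits n → GaussianInt}
    (hamp : ∀ x, ‖(amp x : ℂ) / 2 ^ b - Circuit.state U x‖ ≤ 1 / 2 ^ b)
    {D : Bits n → ℝ} (hD0 : ∀ x, 0 ≤ D x) (hD1 : ∑ x, D x = 1)
    (hD : ∑ x, |D x - ‖Circuit.state U x‖ ^ 2| ≤ 1 / 2 ^ b) {j : ℕ} (hj : j < 2 ^ m) :
    |∑ x, D x * ((sampleInt s b
        (rowFun Q fun a : Fin n × Fin s × Bits n => rowOf (M a.1) a.2.1 a.2.2)
        (coefFun Q (2 ^ b) ent j) amp m x : ℝ) / 2 ^ b) -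
      Circuit.outDist (U ++ V) Q ((bitsEquiv m).symm ⟨j, hj⟩)| ≤
      (s + 1) ^ m * (2 ^ n * (m + 8)) / 2 ^ b := by
  set y := (bitsEquiv m).symm ⟨j, hj⟩ with hy
  have hV := Circuit.mat_mem_unitaryGroup V
  have hb : (1 : ℝ) / 2 ^ b ≤ 1 := div_le_one_of_le₀ (one_le_pow₀ one_le_two) (by positivity)
  have hb0 : (0 : ℝ) < 1 / 2 ^ b := by positivity
  have hout : Circuit.outDist (U ++ V) Q y =
      (star (Circuit.state U) ⬝ᵥ (pulledProj (Circuit.mat V) Q y m *ᵥ Circuit.state U)).re := by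
    rw [← outDist_append, Complex.ofReal_re]
  rw [hout]
  refine abs_mean_sampleInt_sub_le (co := exactCoef s Q M j) (P := pulledProj (Circuit.mat V) Q y)
    (H := fun k => if hk : k < m then (1 / 2 : ℂ) • (1 + (bitSign (y ⟨k, hk⟩) : ℂ) •
      M (Q ⟨k, hk⟩)) else 0) (pulledProj_zero Q y hV) (fun k hk => ?_) (fun k hk z f => ?_)
    (pulledProj_isHermitian _ Q y m) (fun k d z => ?_) (fun k d z => ?_) (fun k d z => ?_)
    (Circuit.norm_state_le_one U) hamp hD0 hD1 hD
  · rw [dif_pos hk, hM]; exact pulledProj_succ Q y hV hk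
  · rw [sum_exactCoef_mul hc hj hk, dif_pos hk]
  · linarith [norm_exactCoef_le (s := s) (Q := Q) hMu j k d z]
  -- The exact coefficients are at most `1 / 2`, which leaves room for the rounding error: the
  -- rounded ones are still at most one.
  · have h1 := norm_exactCoef_le (s := s) (Q := Q) hMu j k d z
    have h2 := norm_coefFun_sub_exactCoef_le (Q := Q) hent j k d z
    have h3 := norm_le_norm_add_norm_sub' (((coefFun Q (2 ^ b) ent j k d z : GaussianInt) : ℂ) / 2 ^ (b + 1))
      (exactCoef s Q M j k d z)
    linarith
  · linarith [norm_coefFun_sub_exactCoef_le (Q := Q) hent j k d z]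

end Accuracy

/-! ### From the mean of the estimates to a single random weight -/

section Failure

/-- Projecting onto an interval that contains `p` does not increase the distance to `p`. -/
theorem abs_clampWeight_sub_le {b : ℕ} {S : ℤ} {p a : ℝ} (hp0 : 0 ≤ p) (hp1 : p ≤ 1)
    (h : |(S : ℝ) / 2 ^ b - p| ≤ a) : |(clampWeight b S : ℝ) / 2 ^ b - p| ≤ a := by
  have h2 : (0 : ℝ) < 2 ^ b := by positivity
  rcases le_or_gt S 0 with hS | hS
  · have h0 : clampWeight b S = 0 := by simp [clampWeight, Int.toNat_of_nonpos hS]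
    have h1 : (S : ℝ) / 2 ^ b ≤ 0 :=
      div_nonpos_of_nonpos_of_nonneg (by exact_mod_cast hS) h2.le
    rw [h0, abs_le] at *
    constructor <;> simp <;> linarith [h.1, h.2]
  · rcases le_or_gt S (2 ^ b) with hS' | hS'
    · have h0 : ((clampWeight b S : ℕ) : ℤ) = S := by
        rw [clampWeight, Nat.cast_min, Int.toNat_of_nonneg hS.le]; push_cast; exact min_eq_left hS'
      have h1 : ((clampWeight b S : ℕ) : ℝ) = S := by exact_mod_cast h0
      rwa [h1]
    · have h0 : ((clampWeight b S : ℕ) : ℤ) = 2 ^ b := by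
        rw [clampWeight, Nat.cast_min, Int.toNat_of_nonneg hS.le]; push_cast
        exact min_eq_right hS'.le
      have h1 : ((clampWeight b S : ℕ) : ℝ) = 2 ^ b := by exact_mod_cast h0
      have h3 : (1 : ℝ) ≤ (S : ℝ) / 2 ^ b := by
        rw [le_div_iff₀ h2, one_mul]; exact_mod_cast hS'.le
      rw [h1, div_self h2.ne', abs_le]
      rw [abs_le] at h
      constructor <;> linarith [h.1, h.2]

/-- The probability that the clamped average of integer estimates is inaccurate. -/
theorem coinProb_clampWeight_le {X : Type*} [Fintype X] {l K L b : ℕ} (hl : l = K * L)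
    (hK : 0 < K) {F : Bits L → X} {g : X → ℤ} {B μ p β δ : ℝ} (hB : 0 < B) (hδ : 0 ≤ δ)
    (hg : ∀ x, |(g x : ℝ) / 2 ^ b| ≤ B)
    (hμ : ∑ x, coinProb (fun r => F r = x) * ((g x : ℝ) / 2 ^ b) = μ) (hβ : |μ - p| ≤ β)
    (hp0 : 0 ≤ p) (hp1 : p ≤ 1) :
    coinProb (fun r : Bits l => δ + β + 1 / 2 ^ b <
      |(clampWeight b ((∑ k ∈ Finset.range K, g (F (coinsFrom L r (L * k)))) / K) : ℝ) / 2 ^ b - p|)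
      ≤ 2 * Real.exp (-(K * δ ^ 2 / (8 * B ^ 2))) := by
  have hμ' : (∑ r, (g (F r) : ℝ) / 2 ^ b) / Fintype.card (Bits L) = μ := by
    rw [← hμ, sum_coinProb_mul F fun x => (g x : ℝ) / 2 ^ b]
    simp
  have hmain := card_abs_avg_sub_mean_le (X := fun r : Bits L => (g (F r) : ℝ) / 2 ^ b) hB hδ
    (fun r => hg (F r)) hμ' hK
  refine (coinProb_mono (F := fun r : Bits l => δ <
    |(∑ k, (g (F (coinsBlock hl r k)) : ℝ) / 2 ^ b) / K - μ|) fun r hr => ?_).trans ?_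
  · by_contra hcon
    rw [not_lt] at hcon
    refine absurd hr (not_lt.2 (abs_clampWeight_sub_le hp0 hp1 ?_))
    have h1 := abs_ediv_sub_div_le (∑ k ∈ Finset.range K, g (F (coinsFrom L r (L * k)))) K
    have h2 : (∑ k, (g (F (coinsBlock hl r k)) : ℝ) / 2 ^ b) / K =
        (((∑ k ∈ Finset.range K, g (F (coinsFrom L r (L * k))) : ℤ) : ℝ) / (K : ℤ)) / 2 ^ b := by
      rw [Finset.sum_range, ← Finset.sum_div, Int.cast_natCast, div_right_comm]
      push_cast
      simp only [coinsBlock_eq]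
    have hb : (0 : ℝ) < 2 ^ b := by positivity
    rw [h2] at hcon
    have h3 : ∀ u v : ℝ, |u - v| ≤ 1 → |u / 2 ^ b - v / 2 ^ b| ≤ 1 / 2 ^ b := fun u v huv => by
      rw [← sub_div, abs_div, abs_of_pos hb]; gcongr
    have h4 := h3 _ _ h1
    rw [abs_le] at *
    constructor <;> linarith [hcon.1, hcon.2, hβ.1, hβ.2, h4.1, h4.2]
  · rw [coinProb_block hl fun w => δ < |(∑ k, (g (F (w k)) : ℝ) / 2 ^ b) / K - μ|,
      div_le_iff₀ (by positivity), mul_comm]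
    simpa using hmain

end Failure

/-! ### Classical simulation -/

section Simulation

/-- For large `n` one has `2 ^ m ≤ n ^ D`, and `c ≤ 2 ^ c` gives `c ^ m ≤ n ^ (c D)`. The finitely
many remaining `n` go into the constant term. -/
theorem exists_poly_pow_le {m : ℕ → ℕ}
    (hm : (fun n => (m n : ℝ)) =O[Filter.atTop] fun n : ℕ => Real.logb 2 n) (c : ℕ) :
    ∃ R : Polynomial ℕ, ∀ n, 1 ≤ n → c ^ m n ≤ R.eval n := by
  obtain ⟨C, hC⟩ := hm.bound
  obtain ⟨N, hN⟩ := Filter.eventually_atTop.1 hC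
  obtain ⟨D, hD⟩ := exists_nat_ge C
  refine ⟨Polynomial.X ^ (c * D) + Polynomial.C (∑ n ∈ Finset.range N, c ^ m n), fun n hn => ?_⟩
  simp only [Polynomial.eval_add, Polynomial.eval_pow, Polynomial.eval_X, Polynomial.eval_C]
  rcases lt_or_ge n N with h | h
  · exact (Finset.single_le_sum (f := fun n => c ^ m n) (fun _ _ => Nat.zero_le _)
      (Finset.mem_range.2 h)).trans (Nat.le_add_left _ _)
  · refine le_trans ?_ (Nat.le_add_right _ _)
    have hn1 : (1 : ℝ) ≤ n := by exact_mod_cast hn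
    have hlog : 0 ≤ Real.logb 2 n := Real.logb_nonneg one_lt_two hn1
    have h1 : (m n : ℝ) ≤ D * Real.logb 2 n := by
      have := hN n h
      rw [Real.norm_of_nonneg (Nat.cast_nonneg _), Real.norm_of_nonneg hlog] at this
      exact this.trans (mul_le_mul_of_nonneg_right hD hlog)
    have h2 : (2 : ℝ) ^ (m n : ℝ) ≤ (n : ℝ) ^ D := by
      calc (2 : ℝ) ^ (m n : ℝ) ≤ 2 ^ (D * Real.logb 2 n) :=
            Real.rpow_le_rpow_of_exponent_le one_le_two h1
        _ = (n : ℝ) ^ D := by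
          rw [mul_comm, Real.rpow_mul zero_le_two, Real.rpow_logb two_pos (by norm_num)
            (by linarith), Real.rpow_natCast]
    rw [Real.rpow_natCast] at h2
    have h3 : 2 ^ m n ≤ n ^ D := by exact_mod_cast h2
    calc c ^ m n ≤ (2 ^ c) ^ m n := Nat.pow_le_pow_left Nat.lt_two_pow_self.le _
      _ = (2 ^ m n) ^ c := by rw [← pow_mul, ← pow_mul, mul_comm]
      _ ≤ (n ^ D) ^ c := Nat.pow_le_pow_left h3 _
      _ = n ^ (c * D) := by rw [← pow_mul, mul_comm]

/-- A table of weights describing the output distribution is computed in polynomial time with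
exponentially small failure probability. -/
theorem exists_polyTime_table {C : ∀ n, Circuit n} (hC : IsCTECS1 C) {m : ℕ → ℕ}
    (hm : (fun n => (m n : ℝ)) =O[Filter.atTop] fun n : ℕ => Real.logb 2 n)
    {Q : ∀ n, Fin (m n) → Fin n} (hmn : ∀ n, 1 ≤ n → m n ≤ n)
    (hQunif : PolyTime fun n (_ : Unit) => Q n)
    {f : Polynomial ℕ} (hf : ∀ n, 1 ≤ n → 0 < f.eval n) (h : Polynomial ℕ) :
    ∃ (l k : Polynomial ℕ) (A : ∀ n, Bits (l.eval n) → Bits (k.eval n))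
        (q : ∀ n, Bits (k.eval n) → Bits (m n) → ℝ),
      PolyTime A ∧ Samplable q ∧ ∀ n : ℕ, 1 ≤ n →
        coinProb (fun r : Bits (l.eval n) =>
          ¬ ∑ x, |(C n).outDist (Q n) x - q n (A n r) x| ≤ 1 / f.eval n) ≤
          Real.exp (-((h.eval n : ℕ) : ℝ)) := by
  obtain ⟨U, V, hCUV, -, -, ⟨hsamp, hampl⟩, c, hM, hrow, hentry⟩ := hC
  -- The base `c + 2` dominates both `c + 1`, for the walks, and `2`, for the outcomes.
  obtain ⟨R, hR⟩ := exists_poly_pow_le hm (c + 2)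
  -- The summand `n` cancels the factor `2 ^ n` in the bias. The rest is an exponent `G` with `2 ^ G
  -- ≥ G = 4 f R² (n + 9)`, which brings bias and rounding below `1 / (4 f R)`.
  let E : Polynomial ℕ := Polynomial.X + 4 * f * R * R * (Polynomial.X + 9)
  -- With `δ = 1 / (4 f R)` and estimates bounded by `2 R`, the exponent `K δ² / (8 (2R)²)` in
  -- Hoeffding's inequality is exactly `2 R + h`. The part `2 R` is spent on the union bound.
  let K : Polynomial ℕ := 512 * R ^ 4 * f ^ 2 * (2 * R + h)
  obtain ⟨D, ⟨L, smp, hsmp, hDsmp⟩, hD⟩ := hsamp E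
  obtain ⟨amp, hamp, hampa⟩ := hampl E
  obtain ⟨ent, hent, henta⟩ := hentry E
  set M : ∀ n, Fin n → QOp n :=
    fun n i => ((V n).mat)ᴴ * onQubit pauliZ i * (V n).mat with hMdef
  have hgauss : ∀ p : ℤ × ℤ, ((⟨p.1, p.2⟩ : GaussianInt) : ℂ) = p.1 + p.2 * Complex.I := fun p =>
    GaussianInt.toComplex_def' _ _
  have hampa' : ∀ n, 1 ≤ n → ∀ x, ‖((⟨(amp n x).1, (amp n x).2⟩ : GaussianInt) : ℂ) / 2 ^ E.eval n -
      (U n).state x‖ ≤ 1 / 2 ^ E.eval n := fun n hn x => by rw [hgauss]; exact hampa n hn x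
  have henta' : ∀ n, 1 ≤ n → ∀ a, ‖((⟨(ent n a).1, (ent n a).2⟩ : GaussianInt) : ℂ) / 2 ^ E.eval n -
      entryOf (M n a.1) a.2.1 a.2.2‖ ≤ 1 / 2 ^ E.eval n := fun n hn a => by
    rw [hgauss]; exact henta n hn a
  have hampb : ∀ n, 1 ≤ n → ∀ x, (amp n x).1.natAbs ≤ 2 ^ (E.eval n + 1) ∧
      (amp n x).2.natAbs ≤ 2 ^ (E.eval n + 1) := fun n hn x =>
    natAbs_le_of_norm_le (norm_toComplex_le_of_approx (Circuit.norm_state_le_one _ _)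
      (hampa' n hn x))
  have hentb : ∀ n, 1 ≤ n → ∀ a, (ent n a).1.natAbs ≤ 2 ^ (E.eval n + 1) ∧
      (ent n a).2.natAbs ≤ 2 ^ (E.eval n + 1) := fun n hn a =>
    natAbs_le_of_norm_le (norm_toComplex_le_of_approx
      (norm_entryOf_le_one _ _ (hM n hn a.1).1 _) (henta' n hn a))
  have hg : ∀ n, 1 ≤ n → ∀ j k d z,
      ‖(stepCoef Q ent E n j k d z : ℂ) / (2 ^ (E.eval n + 1) : ℂ)‖ ≤ 1 := fun n hn j k d z => by
    have h1 := norm_exactCoef_le (s := (Polynomial.C c).eval n) (Q := Q n) (M := M n)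
      (fun i => (hM n hn i).1) j k d z
    have h2 := norm_coefFun_sub_exactCoef_le (Q := Q n) (henta' n hn) j k d z
    have h3 := norm_le_norm_add_norm_sub' ((stepCoef Q ent E n j k d z : ℂ) / 2 ^ (E.eval n + 1))
      (exactCoef ((Polynomial.C c).eval n) (Q n) (M n) j k d z)
    have hb : (1 : ℝ) / 2 ^ E.eval n ≤ 1 :=
      div_le_one_of_le₀ (one_le_pow₀ one_le_two) (by positivity)
    rw [stepCoef] at *
    linarith
  let row : ∀ n, Fin n × Fin ((Polynomial.C c).eval n) × Bits n → Bits n :=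
    fun n a => rowOf (M n a.1) a.2.1 a.2.2
  let wt : ∀ n, Bits ((K * L).eval n) → ℕ → ℕ := fun n r =>
    outcomeWeight Q row ent amp E K smp n r
  let F : ∀ n, Bits ((R * (E + 1)).eval n) × Bits (E.eval n) → Bits (m n) := fun n a =>
    tableOutcome (E.eval n + 1) (m n) a.1 a.2
  refine ⟨K * L, R * (E + 1), fun n r => tableBits (E.eval n + 1) ((R * (E + 1)).eval n) (wt n r),
    fun n d y => coinProb fun u => F n (d, u) = y,
    polyTime_tableBits hQunif hmn hrow hent hentb hg hamp hampb hR hsmp,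
    ⟨E, F, polyTime_tableOutcome hQunif hmn hR, fun n _ d y => rfl⟩, fun n hn => ?_⟩
  -- sizes of the parameters
  have hR1 : 1 ≤ R.eval n := (Nat.one_le_pow _ _ (by omega)).trans (hR n hn)
  have hf1 : 1 ≤ f.eval n := hf n hn
  have hW : (c + 1) ^ m n ≤ R.eval n := (Nat.pow_le_pow_left (by omega) _).trans (hR n hn)
  have hJ : 2 ^ m n ≤ R.eval n := (Nat.pow_le_pow_left (by omega) _).trans (hR n hn)
  set ρ : ℝ := ((R.eval n : ℕ) : ℝ) with hρ
  set φ : ℝ := ((f.eval n : ℕ) : ℝ) with hφ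
  have hρ1 : 1 ≤ ρ := by rw [hρ]; exact_mod_cast hR1
  have hφ1 : 1 ≤ φ := by rw [hφ]; exact_mod_cast hf1
  have hWρ : ((c : ℝ) + 1) ^ m n ≤ ρ := by rw [hρ]; exact_mod_cast hW
  have hJρ : (2 : ℝ) ^ m n ≤ ρ := by rw [hρ]; exact_mod_cast hJ
  have hKρ : ((K.eval n : ℕ) : ℝ) = 512 * ρ ^ 4 * φ ^ 2 * (2 * ρ + h.eval n) := by
    simp [K, hρ, hφ]
  have hK0 : 0 < K.eval n := by
    have : (0 : ℝ) < (K.eval n : ℕ) := by rw [hKρ]; positivity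
    exact_mod_cast this
  -- Sampling error and bias with rounding get `δ` each. A table with weights accurate to `2 δ` has
  -- distance at most `2 · 2 ^ m · 2 δ ≤ 4 ρ δ = 1 / φ`.
  set δ : ℝ := 1 / (4 * φ * ρ) with hδ
  have hδ0 : 0 < δ := by positivity
  set β : ℝ := (c + 1) ^ m n * (2 ^ n * (m n + 8)) / 2 ^ E.eval n with hβ
  have hβδ : β + 1 / 2 ^ E.eval n ≤ δ := by
    have hEn : (2 : ℝ) ^ E.eval n = 2 ^ n * 2 ^ (4 * f * R * R * (Polynomial.X + 9)).eval n := by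
      rw [← pow_add]; simp [E]
    have hG : 4 * φ * ρ * ρ * (n + 9) ≤
        (2 : ℝ) ^ (4 * f * R * R * (Polynomial.X + 9)).eval n := by
      have h1 : (((4 * f * R * R * (Polynomial.X + 9)).eval n : ℕ) : ℝ) = 4 * φ * ρ * ρ * (n + 9) := by
        simp [hρ, hφ]
      rw [← h1]
      exact_mod_cast Nat.lt_two_pow_self.le
    have hmn' : (m n : ℝ) ≤ n := by exact_mod_cast hmn n hn
    have h2n : (1 : ℝ) ≤ 2 ^ n := one_le_pow₀ one_le_two
    rw [hβ, ← add_div, hEn, hδ, div_le_div_iff₀ (by positivity) (by positivity), one_mul]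
    have h1 : ((c : ℝ) + 1) ^ m n * (2 ^ n * (m n + 8)) + 1 ≤ 2 ^ n * (ρ * (n + 9)) := by
      have h2 : ((c : ℝ) + 1) ^ m n * (2 ^ n * (m n + 8)) ≤ ρ * (2 ^ n * (n + 8)) := by gcongr
      have h3 : 1 ≤ 2 ^ n * ρ := one_le_mul_of_one_le_of_one_le h2n hρ1
      linarith
    calc _ ≤ 2 ^ n * (ρ * (n + 9)) * (4 * φ * ρ) := by gcongr
      _ = 2 ^ n * (4 * φ * ρ * ρ * (n + 9)) := by ring
      _ ≤ _ := by gcongr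
  -- a single weight
  have hp1 : ∀ y, (C n).outDist (Q n) y ≤ 1 := fun y => by
    rw [← (C n).sum_outDist (Q n)]
    exact Finset.single_le_sum (fun y _ => (C n).outDist_nonneg (Q n) y) (Finset.mem_univ y)
  have hbad : ∀ j : Fin (2 ^ m n), coinProb (fun r : Bits ((K * L).eval n) => 2 * δ <
      |(wt n r j : ℝ) / 2 ^ E.eval n - (C n).outDist (Q n) ((bitsEquiv (m n)).symm j)|) ≤
      2 * Real.exp (-(2 * ρ + h.eval n)) := fun j => by
    have hmean := abs_mean_sub_outDist_le (U := U n) (V := V n) (M := M n) (Q := Q n)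
      (s := (Polynomial.C c).eval n)
      (fun i => rfl) (fun i => (hM n hn i).1) (fun i x => (hM n hn i).2.2 x) (henta' n hn)
      (hampa' n hn) (D := D n ()) (fun x => by rw [hDsmp n hn]; exact coinProb_nonneg _)
      (by simp only [hDsmp n hn]; exact sum_coinProb _) (hD n hn) j.2
    rw [← hCUV n hn] at hmean
    simp only [hDsmp n hn, Polynomial.eval_C] at hmean
    have hfail := coinProb_clampWeight_le (l := (K * L).eval n) (K := K.eval n) (L := L.eval n)
      (b := E.eval n) (F := fun r => smp n ((), r))
      (g := outcomeEstimate Q row ent amp E n j) (B := 2 * ρ) (δ := δ)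
      Polynomial.eval_mul hK0 (by positivity) hδ0.le
      (fun x => (abs_sampleInt_le _ (hg n hn j) x).trans (by linarith)) rfl hmean
      ((C n).outDist_nonneg _ _) (hp1 _)
    refine (coinProb_mono fun r hr => ?_).trans (hfail.trans (le_of_eq ?_))
    · exact lt_of_le_of_lt (by linarith) hr
    · rw [hKρ, hδ]
      congr 2
      field_simp
      ring
  refine (coinProb_mono (F := fun r => ∃ j ∈ (Finset.univ : Finset (Fin (2 ^ m n))), 2 * δ <
    |(wt n r j : ℝ) / 2 ^ E.eval n - (C n).outDist (Q n) ((bitsEquiv (m n)).symm j)|)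
    fun r hr => ?_).trans ((coinProb_exists_le _ _).trans
      ((Finset.sum_le_card_nsmul _ _ _ fun j _ => hbad j).trans ?_))
  · by_contra hcon
    push Not at hcon
    apply hr
    have hsim := sum_abs_sub_tableOutcome_le (b := E.eval n) (m := m n)
      (k := (R * (E + 1)).eval n) (M := R.eval n) (c := wt n r) (p := (C n).outDist (Q n))
      (δ := 2 * δ) ((C n).sum_outDist (Q n)) (by simp) hJ (fun j => Nat.min_le_right _ _)
      (by positivity) fun j => hcon j (Finset.mem_univ j)
    refine hsim.trans ?_
    calc 2 * (2 ^ m n * (2 * δ)) ≤ 2 * (ρ * (2 * δ)) := by gcongr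
      _ = 1 / φ := by rw [hδ]; field_simp; norm_num
  · rw [Finset.card_univ, Fintype.card_fin, nsmul_eq_mul]
    push_cast
    have h1 : 2 * ρ * Real.exp (-(2 * ρ)) ≤ 1 := by
      rw [Real.exp_neg, ← div_eq_mul_inv, div_le_one (Real.exp_pos _)]
      linarith [Real.add_one_le_exp (2 * ρ)]
    calc (2 : ℝ) ^ m n * (2 * Real.exp (-(2 * ρ + h.eval n)))
        ≤ ρ * (2 * Real.exp (-(2 * ρ + h.eval n))) := by gcongr
      _ = (2 * ρ * Real.exp (-(2 * ρ))) * Real.exp (-((h.eval n : ℕ) : ℝ)) := by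
        rw [neg_add, Real.exp_add]; ring
      _ ≤ 1 * Real.exp (-((h.eval n : ℕ) : ℝ)) := by gcongr
      _ = _ := one_mul _

end Simulation

/-! ### Averaging over the random tables -/

section Averaging

/-- A randomized polynomial-time description of a distribution followed by sampling from the
described distribution is sampling from the averaged distribution. -/
theorem samplable_average {l k : Polynomial ℕ} {m : ℕ → ℕ} (hmn : ∀ n, 1 ≤ n → m n ≤ n)
    {A : ∀ n, Bits (l.eval n) → Bits (k.eval n)} {q : ∀ n, Bits (k.eval n) → Bits (m n) → ℝ}
    (hA : PolyTime A) (hq : Samplable q) :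
    Samplable fun n (_ : Unit) y => (∑ r, q n (A n r) y) / 2 ^ l.eval n := by
  obtain ⟨j, F, hF, hFq⟩ := hq
  refine ⟨l + j, fun n a => F n (A n (coinsFrom (l.eval n) a.2 0),
    coinsFrom (j.eval n) a.2 (l.eval n)), ?_, fun n hn a y => ?_⟩
  · apply PolyComp.polyTime
    let N : {i : Σ n, Unit × Bits ((l + j).eval n) // 1 ≤ i.1} → ℕ := fun i => i.1.1
    have henv : PolyBdd N fun i => (Val.pair (.int i.1.1) (ToVal.toVal i.1.2)).size := by
      refine PolyBdd.mono (g := fun i => 1 + (N i + 2) + (1 + 1 + (1 + (l + j).eval (N i) * 3)))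
        (((PolyBdd.const 1).add (PolyBdd.self.add (.const 2))).add
          ((PolyBdd.const 2).add ((PolyBdd.const 1).add ((PolyBdd.eval _).mul (.const 3)))))
        fun i => ?_
      have h1 : (Val.int i.1.1).size ≤ N i + 2 :=
        Val.size_int_le (by simpa using Nat.lt_two_pow_self.le)
      have h2 := size_toVal_bits i.1.2.2
      have h3 : (ToVal.toVal i.1.2.1).size = 1 := by simp [ToVal.toVal, Val.size]
      change 1 + (Val.int i.1.1).size + (1 + (ToVal.toVal i.1.2.1).size +
        (ToVal.toVal i.1.2.2).size) ≤ _
      simp only [N] at h1 ⊢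
      omega
    have hN : ∀ i, 1 ≤ N i := fun i => i.2
    have hn : PolyComp N _ fun i => .int (N i) := (PolyComp.self henv).fst
    have hr := (PolyComp.self henv).snd.snd'
    have hd := PolyComp.ofPolyTime hA hN hn
      (PolyComp.coinsFrom hr (.eval l) (hn.eval l) (.const 0) (PolyComp.natConst hn.1 0))
      (((PolyBdd.const 1).add ((PolyBdd.eval k).mul (.const 3))).mono fun r => size_toVal_bits _)
    exact PolyComp.ofPolyTime hF hN (a := fun i : {i : Σ n, Unit × Bits ((l + j).eval n) //
        1 ≤ i.1} => (A (N i) (coinsFrom (l.eval (N i)) i.1.2.2 0),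
          coinsFrom (j.eval (N i)) i.1.2.2 (l.eval (N i)))) hn
      (hd.pair (PolyComp.coinsFrom hr (.eval j) (hn.eval j) (.eval l) (hn.eval l)))
      (((PolyBdd.const 1).add (PolyBdd.self.mul (.const 3))).mono fun i =>
        (size_toVal_bits _).trans (by
          have := hmn _ (hN i)
          omega))
  · simp only [← coinsFst_eq (Polynomial.eval_add : (l + j).eval n = _),
      ← coinsSnd_eq (Polynomial.eval_add : (l + j).eval n = _)]
    rw [coinProb_split (Polynomial.eval_add : (l + j).eval n = _)
      fun r s => F n (A n r, s) = y]
    simp only [hFq n hn]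

/-- The average of distributions that are close to `p` with high probability is close to `p`. -/
theorem sum_abs_sub_average_le {β : Type*} [Fintype β] {l : ℕ} {p : β → ℝ}
    {q : Bits l → β → ℝ} (hp0 : ∀ y, 0 ≤ p y) (hp1 : ∑ y, p y = 1) (hq0 : ∀ r y, 0 ≤ q r y)
    (hq1 : ∀ r, ∑ y, q r y = 1) {ε : ℝ} (hε : 0 ≤ ε) :
    ∑ y, |p y - (∑ r, q r y) / 2 ^ l| ≤
      ε + 2 * coinProb fun r => ¬ ∑ y, |p y - q r y| ≤ ε := by
  classical
  have h2 : (0 : ℝ) < 2 ^ l := by positivity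
  have hterm : ∀ y, |p y - (∑ r, q r y) / 2 ^ l| ≤ (∑ r, |p y - q r y|) / 2 ^ l := fun y => by
    have h : p y - (∑ r, q r y) / 2 ^ l = (∑ r, (p y - q r y)) / 2 ^ l := by
      rw [Finset.sum_sub_distrib, sub_div]
      simp
    rw [h, abs_div, abs_of_pos h2]
    gcongr
    exact Finset.abs_sum_le_sum_abs _ _
  refine (Finset.sum_le_sum fun y _ => hterm y).trans ?_
  rw [← Finset.sum_div, Finset.sum_comm, div_le_iff₀ h2]
  -- For the coins where the description fails, the distance of two probability distributions is at
  -- most `2`.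
  have hr : ∀ r, ∑ y, |p y - q r y| ≤ ε + 2 * if ¬ ∑ y, |p y - q r y| ≤ ε then 1 else 0 := by
    intro r
    by_cases h : ∑ y, |p y - q r y| ≤ ε
    · simp [h]
    · have : ∑ y, |p y - q r y| ≤ ∑ y, (p y + q r y) := Finset.sum_le_sum fun y _ => by
        rw [abs_le]; constructor <;> linarith [hp0 y, hq0 r y]
      rw [Finset.sum_add_distrib, hp1, hq1] at this
      rw [if_pos h]
      linarith
  refine (Finset.sum_le_sum fun r _ => hr r).trans (le_of_eq ?_)
  rw [Finset.sum_add_distrib, ← Finset.mul_sum, Finset.sum_boole]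
  unfold coinProb
  simp only [Finset.sum_const, Finset.card_univ, nsmul_eq_mul, Fintype.card_pi, Fintype.card_bool,
    Finset.prod_const, Fintype.card_fin]
  push_cast
  field_simp
  congr!

end Averaging

theorem mainTheorem4 (C : ∀ n, Circuit n)
    (hunif : PolyTime fun n (_ : Unit) => C n) (hC : IsCTECS1 C)
    (m : ℕ → ℕ) (hm : (fun n => (m n : ℝ)) =O[Filter.atTop] fun n : ℕ => Real.logb 2 n)
    (Q : ∀ n, Fin (m n) → Fin n) (hQ : ∀ n, 1 ≤ n → Function.Injective (Q n))
    (hQunif : PolyTime fun n (_ : Unit) => Q n)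
    (f : Polynomial ℕ) (hf : ∀ n, 1 ≤ n → 0 < f.eval n) :
    (∃ (l k : Polynomial ℕ) (A : ∀ n, Bits (l.eval n) → Bits (k.eval n))
        (q : ∀ n, Bits (k.eval n) → Bits (m n) → ℝ),
      PolyTime A ∧ Samplable q ∧ ∀ n : ℕ, 1 ≤ n →
        1 - 1 / Real.exp n ≤ coinProb fun r : Bits (l.eval n) =>
          ∑ x, |(C n).outDist (Q n) x - q n (A n r) x| ≤ 1 / f.eval n) ∧
    ∃ q : ∀ n, Unit → Bits (m n) → ℝ, Samplable q ∧ ∀ n : ℕ, 1 ≤ n →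
      ∑ x, |(C n).outDist (Q n) x - q n () x| ≤ 1 / f.eval n 
    := by
  -- Distinctness of the measured qubits enters only through this inequality.
  have hmn : ∀ n, 1 ≤ n → m n ≤ n := fun n hn => by
    simpa using Fintype.card_le_of_injective _ (hQ n hn)
  constructor
  · obtain ⟨l, k, A, q, hA, hq, hAq⟩ := exists_polyTime_table hC hm hmn hQunif hf Polynomial.X
    refine ⟨l, k, A, q, hA, hq, fun n hn => ?_⟩
    have h := hAq n hn
    rw [coinProb_not, Polynomial.eval_X, Real.exp_neg, inv_eq_one_div] at h
    linarith
  -- Half of the error is the accuracy `1 / (2f)` of the tables; the other half pays for failures,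
  -- since `2 exp (-4f) ≤ 1 / (2f)`.
  · obtain ⟨l, k, A, q, hA, hq, hAq⟩ := exists_polyTime_table hC hm hmn hQunif (f := 2 * f)
      (fun n hn => by simpa using hf n hn) (4 * f)
    refine ⟨_, samplable_average hmn hA hq, fun n hn => ?_⟩
    obtain ⟨j, F, -, hFq⟩ := hq
    have hf0 : (0 : ℝ) < ((f.eval n : ℕ) : ℝ) := by exact_mod_cast hf n hn
    refine (sum_abs_sub_average_le (ε := 1 / ((2 * f).eval n : ℕ)) ((C n).outDist_nonneg (Q n))
      ((C n).sum_outDist (Q n)) (fun r y => ?_) (fun r => ?_) (by positivity)).trans ?_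
    · rw [hFq n hn]; exact coinProb_nonneg _
    · simp only [hFq n hn]; exact sum_coinProb _
    · have h1 : Real.exp (-((4 * f).eval n : ℕ)) ≤ 1 / (4 * (f.eval n : ℕ)) := by
        rw [Real.exp_neg, inv_eq_one_div]
        apply one_div_le_one_div_of_le (by positivity)
        have := Real.add_one_le_exp (((4 * f).eval n : ℕ) : ℝ)
        simp only [Polynomial.eval_mul, Polynomial.eval_ofNat] at this ⊢
        push_cast at this ⊢
        linarith
      have h2 : (1 : ℝ) / ((2 * f).eval n : ℕ) = 1 / (2 * (f.eval n : ℕ)) := by simp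
      have h3 : (1 : ℝ) / (2 * (f.eval n : ℕ)) + 2 * (1 / (4 * (f.eval n : ℕ))) =
          1 / (f.eval n : ℕ) := by field_simp; norm_num
      rw [← h3, h2]
      have h4 := hAq n hn
      rw [h2] at h4
      linarith
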